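/- **Setting.** Let $p$ be a natural number and consider DAGs on $[p]=\{1,\dots,p\}$. Two DAGs are Markov equivalent if they have the same d-separations; a class is called an MEC. The characteristic imset $c_{\mathcal G}\in\mathbb R^{\{S\subseteq[p]:|S|\ge 2\}}$ of a DAG $\mathcal G$ has $c_{\mathcal G}(S)=1$ if some $i\in S$ has $S\setminus\{i\}\subseteq \mathrm{pa}_{\mathcal G}(i)$, and $c_{\mathcal G}(S)=0$ otherwise. Let $\mathrm{CIM}_p=\mathrm{conv}\{c_{\mathcal G}:\mathcal G\text{ a DAG on }[p]\}$, and for an undirected graph $K$ on $[p]$ let $\mathrm{CIM}_{\le K}=\mathrm{conv}\{c_{\mathcal G}:\text{the skeleton of }\mathcal G\text{ is a subgraph of }K\}$. An *edge-walk* on a polytope $P$ is a nonempty finite sequence $x_0,\dots,x_m$ of vertices of $P$ such that every $\mathrm{conv}(x_k,x_{k+1})$ is an edge (a face of dimension $1$) of $P$. It is *greedy* for a linear function $w$ if $w(x_k)<w(x_{k+1})$ for all $k$. A score $s$ on DAGs (such as BIC for fixed data) is decomposable if $s(\mathcal G)=\sum_i q_i(\mathrm{pa}_{\mathcal G}(i))$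 for some functions $q_i$, and score equivalent if it is constant on MECs. A *greedy phase* for a given kind of moves repeatedly goes to a neighbour of highest score, as long as this strictly increases the score, and stops when no neighbour has a higher score. - *GES*: the states are MECs, starting from the class of the empty DAG. A greedy forward phase (add an arrow to some DAG of the class) is followed by a greedy backward phase (delete an arrow of some DAG of the class). - *GIES with purely observational data*: the same, with a third greedy turning phase (reverse an arrow of some DAG of the class, the result being a DAG); rounds of the three phases are repeated until a round makes no backward and no turning move. - *MMHC*: given an undirected graph $K$ of candidate edges (the output of the independence tests), a greedy phase over DAGs from the empty DAG, with the moves of deleting or reversing an arrow, or adding one along an edge of $K$. - *Greedy SP*: let $C$ be a graphoid of conditional independence relations on $[p]$. For an ordering $\pi$ let $\mathcal G_\pi$ be the DAG with $a\to b$ if $a$ precedes $b$ and $a$ is not independent of $b$ given the other predecessors of $b$. A move reverses a covered arrow $i\to j$ of the DAG (one with $\mathrm{pa}(j)=\mathrm{pa}(i)\cup\{i\}$) and passes to $\mathcal G_\tau$ for a topological ordering $\tau$ of the result. From a starting $\mathcal G_\pi$, the algorithm repeatedly searches, to a depth of at most $d\in\mathbb N\cup\{\infty\}$, for a path of moves through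 distinct DAGs with as many arrows as the current one to a DAG with fewer arrows, and continues from there; it returns the current DAG if there is none. (There are no restarts.) A *DAG associahedron* of $C$ is a polytope $Q\subset\mathbb R^p$ whose normal fan is obtained from the fan of the braid arrangement by merging the chambers of two orderings that differ by transposing the adjacent entries $\pi_k,\pi_{k+1}$ exactly if $\pi_k$ is independent of $\pi_{k+1}$ given $\pi_1,\dots,\pi_{k-1}$ in $C$. Write $v_\pi$ for the vertex of $Q$ belonging to the chamber of $\pi$. **Theorem.** GES, GIES with purely observational data, MMHC and greedy SP are greedy edge-walks along a convex polytope. In detail: 1. Let $s$ be a decomposable and score equivalent score. The characteristic imset is constant on MECs, and there are a linear function $w$ and a constant $a$ with $s(\mathcal G)=w(c_{\mathcal G})+a$ for all DAGs $\mathcal G$. Moreover GES and GIES with purely observational data, and MMHC for every $K$, have a (finite, complete) run; the characteristic imsets of the states of every run of GES or GIES form an edge-walk on $\mathrm{CIM}_p$ that is greedy for $w$; $\mathrm{CIM}_{\le K}$ is a face of $\mathrm{CIM}_p$; and those of the states of every run of MMHC form an edge-walk on $\mathrm{CIM}_{\le K}$ that is greedy for $w$. 2. Let $C$ be a graphoid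 and $Q$ a DAG associahedron of $C$. Then $v_\pi$ depends only on $\mathcal G_\pi$. For every starting ordering $\pi$ and every search depth, greedy SP has a (finite, complete) run, and for every run the vertices of $Q$ belonging to the DAGs passed from $\mathcal G_\pi$ to the output form an edge-walk on $Q$, along which the number of arrows never increases; the output is $\mathcal G_\pi$ or has strictly fewer arrows than $\mathcal G_\pi$. 3. For every DAG $\mathcal G$ on $[p]$, the d-separation relations of $\mathcal G$ form a graphoid that has a DAG associahedron. -/

import Mathlib

/-- A directed acyclic graph on the nodes `Fin p`, given by its parent sets:
`a ∈ pa b` means that `a → b` is an arrow. -/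
@[ext]
structure DAG (p : ℕ) where
  pa : Fin p → Finset (Fin p)
  acyclic : ∀ i, ¬ Relation.TransGen (fun a b => a ∈ pa b) i i

namespace DAG

variable {p : ℕ}

/-- `a → b` is an arrow of `G`. -/
def Arrow (G : DAG p) (a b : Fin p) : Prop := a ∈ G.pa b

/-- `a` and `b` are joined by an arrow, in one direction or the other. -/
def Neighbor (G : DAG p) (a b : Fin p) : Prop := G.Arrow a b ∨ G.Arrow b a

/-- The number of arrows of `G`. -/
def numArrows (G : DAG p) : ℕ := ∑ i, (G.pa i).card

/-- The skeleton of `G`. -/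
def skeleton (G : DAG p) : SimpleGraph (Fin p) where
  Adj a b := G.Neighbor a b
  symm := ⟨fun _ _ h => Or.symm h⟩
  loopless := ⟨fun i h => G.acyclic i (Relation.TransGen.single (h.elim id id))⟩

/-- The DAG without arrows. -/
def empty (p : ℕ) : DAG p where
  pa _ := ∅
  acyclic i h := by
    obtain ⟨b, _, hb⟩ := Relation.TransGen.tail'_iff.mp h
    simp at hb

/-! ### d-separation and Markov equivalence -/

/-- `l` is a path in (the skeleton of) `G` that is active given `K`: every collider
`a → b ← c` on it is in `K` or has a descendant in `K`, and no other inner node is in `K`. -/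
def IsActivePath (G : DAG p) (K : Finset (Fin p)) (l : List (Fin p)) : Prop :=
  l.Nodup ∧ l.IsChain G.Neighbor ∧
    ∀ a b c, [a, b, c] <:+: l →
      ((G.Arrow a b ∧ G.Arrow c b) → ∃ d ∈ K, Relation.ReflTransGen G.Arrow b d) ∧
      (¬ (G.Arrow a b ∧ G.Arrow c b) → b ∉ K)

/-- `i` and `j` are d-separated given `K` in `G`: no path between them is active given `K`.
(Two sets of nodes are d-separated given `K` exactly if their elements are so pairwise.) -/
def DSep (G : DAG p) (i j : Fin p) (K : Finset (Fin p)) : Prop :=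
  ¬ ∃ l, l.head? = some i ∧ l.getLast? = some j ∧ G.IsActivePath K l

/-- Two DAGs are Markov equivalent if they encode the same conditional independence
statements, that is, have the same d-separations. -/
def MarkovEquiv (G H : DAG p) : Prop :=
  ∀ i j K, i ≠ j → i ∉ K → j ∉ K → (G.DSep i j K ↔ H.DSep i j K)

instance markovSetoid (p : ℕ) : Setoid (DAG p) where
  r := MarkovEquiv
  iseqv :=
    { refl := fun _ _ _ _ _ _ _ => Iff.rfl
      symm := fun h i j K h1 h2 h3 => (h i j K h1 h2 h3).symm
      trans := fun h k i j K h1 h2 h3 => (h i j K h1 h2 h3).trans (k i j K h1 h2 h3) }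

/-! ### Local moves on DAGs -/

/-- `H` is `G` with an arrow `i → j` added between two non-adjacent nodes. -/
def IsArrowAddition (G H : DAG p) (i j : Fin p) : Prop :=
  i ≠ j ∧ ¬ G.Neighbor i j ∧ ∀ a b, H.Arrow a b ↔ G.Arrow a b ∨ (a = i ∧ b = j)

/-- `H` is `G` with the arrow `i → j` of `G` replaced by `j → i`. -/
def IsArrowReversal (G H : DAG p) (i j : Fin p) : Prop :=
  G.Arrow i j ∧
    ∀ a b, H.Arrow a b ↔ (G.Arrow a b ∧ ¬ (a = i ∧ b = j)) ∨ (a = j ∧ b = i)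

end DAG

/-- Markov equivalence classes of DAGs on `p` nodes. -/
abbrev MEC (p : ℕ) : Type := Quotient (DAG.markovSetoid p)

/-! ### Scores -/

/-- The score is (additively) decomposable. -/
def IsDecomposable {p : ℕ} (s : DAG p → ℝ) : Prop :=
  ∃ q : Fin p → Finset (Fin p) → ℝ, ∀ G : DAG p, s G = ∑ i, q i (G.pa i)

/-- The score takes the same value on Markov equivalent DAGs. -/
def IsScoreEquivalent {p : ℕ} (s : DAG p → ℝ) : Prop :=
  ∀ G H : DAG p, G.MarkovEquiv H → s G = s H

/-- A score equivalent score as a function of the Markov equivalence class. -/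
def mecScore {p : ℕ} (s : DAG p → ℝ) (hs : IsScoreEquivalent s) : MEC p → ℝ :=
  Quotient.lift s hs

/-! ### Characteristic imsets and their polytopes -/

/-- Real vectors indexed by the subsets of `Fin p` with at least two elements. -/
abbrev ImsetSpace (p : ℕ) : Type := {S : Finset (Fin p) // 2 ≤ S.card} → ℝ

open Classical in
/-- The characteristic imset of a DAG. -/
noncomputable def charImset {p : ℕ} (G : DAG p) : ImsetSpace p := fun S =>
  if ∃ i ∈ S.1, ∀ j ∈ S.1 \ {i}, j ∈ G.pa i then 1 else 0

/-- The characteristic imset polytope on `p` nodes. -/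
def CIM (p : ℕ) : Set (ImsetSpace p) :=
  convexHull ℝ {x | ∃ G : DAG p, x = charImset G}

/-- The convex hull of the characteristic imsets of the DAGs whose skeleton is a subgraph
of `K`. -/
def CIMBelow {p : ℕ} (K : SimpleGraph (Fin p)) : Set (ImsetSpace p) :=
  convexHull ℝ {x | ∃ G : DAG p, G.skeleton ≤ K ∧ x = charImset G}

/-! ### Edge-walks. Faces are Mathlib's exposed subsets, vertices its exposed points. -/

/-- `F` is an edge of `P`: a face of dimension one. -/
def IsPolytopeEdge {ι : Type*} (P F : Set (ι → ℝ)) : Prop :=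
  IsExposed ℝ P F ∧ Module.finrank ℝ (vectorSpan ℝ F) = 1

/-- A nonempty sequence of vertices of `P`, consecutive ones being the ends of an edge. -/
def IsEdgeWalk {ι : Type*} (P : Set (ι → ℝ)) (l : List (ι → ℝ)) : Prop :=
  l ≠ [] ∧ (∀ x ∈ l, x ∈ Set.exposedPoints ℝ P) ∧
    l.IsChain (fun x y => IsPolytopeEdge P (convexHull ℝ {x, y}))

/-- An edge-walk along which the linear function `w` strictly increases at every step. -/
def IsGreedyEdgeWalk {ι : Type*} (P : Set (ι → ℝ)) (w : (ι → ℝ) →ₗ[ℝ] ℝ)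
    (l : List (ι → ℝ)) : Prop :=
  IsEdgeWalk P l ∧ l.IsChain (fun x y => w x < w y)

/-! ### Greedy search -/

/-- One greedy step: go to a neighbor of highest score, if this improves the score. -/
def IsGreedyStep {α : Type*} (s : α → ℝ) (nbr : α → α → Prop) (x y : α) : Prop :=
  nbr x y ∧ s x < s y ∧ ∀ z, nbr x z → s z ≤ s y

/-- `l` is the list of states visited after `x` when greedy steps are made from `x` until
no neighbor improves the score. The phase ends in `l.getLastD x`. -/
def IsGreedyPhase {α : Type*} (s : α → ℝ) (nbr : α → α → Prop) (x : α) (l : List α) :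
    Prop :=
  (x :: l).IsChain (IsGreedyStep s nbr) ∧ ∀ z, nbr (l.getLastD x) z → s z ≤ s (l.getLastD x)

/-- Forward neighbors of a class: add an arrow to some DAG in the class. -/
def ForwardMove {p : ℕ} (E F : MEC p) : Prop :=
  ∃ G H : DAG p, ⟦G⟧ = E ∧ ⟦H⟧ = F ∧ ∃ i j, G.IsArrowAddition H i j

/-- Backward neighbors of a class: delete an arrow from some DAG in the class. -/
def BackwardMove {p : ℕ} (E F : MEC p) : Prop :=
  ∃ G H : DAG p, ⟦G⟧ = E ∧ ⟦H⟧ = F ∧ ∃ i j, H.IsArrowAddition G i j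

/-- Turning neighbors of a class: reverse an arrow of some DAG in the class. -/
def TurningMove {p : ℕ} (E F : MEC p) : Prop :=
  ∃ G H : DAG p, ⟦G⟧ = E ∧ ⟦H⟧ = F ∧ ∃ i j, G.IsArrowReversal H i j

/-- `l` is the list of states of a run of GES: from the class of the empty DAG, a forward
phase followed by a backward phase. -/
def IsGESRun {p : ℕ} (s : MEC p → ℝ) (l : List (MEC p)) : Prop :=
  ∃ f b, l = ⟦DAG.empty p⟧ :: (f ++ b) ∧
    IsGreedyPhase s ForwardMove ⟦DAG.empty p⟧ f ∧
    IsGreedyPhase s BackwardMove (f.getLastD ⟦DAG.empty p⟧) b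

/-- `GIESFrom s E l`: the list of states visited after `E` in a run of GIES (on purely
observational data) from `E` is `l`. Rounds of a forward, a backward and a turning phase are
repeated until a round makes no backward and no turning move. -/
inductive GIESFrom {p : ℕ} (s : MEC p → ℝ) : MEC p → List (MEC p) → Prop
  | last (E : MEC p) (f : List (MEC p))
      (hf : IsGreedyPhase s ForwardMove E f)
      (hb : IsGreedyPhase s BackwardMove (f.getLastD E) [])
      (ht : IsGreedyPhase s TurningMove (f.getLastD E) []) :
      GIESFrom s E f
  | round (E : MEC p) (f b t r : List (MEC p))
      (hf : IsGreedyPhase s ForwardMove E f)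
      (hb : IsGreedyPhase s BackwardMove (f.getLastD E) b)
      (ht : IsGreedyPhase s TurningMove ((f ++ b).getLastD E) t)
      (hne : b ≠ [] ∨ t ≠ [])
      (hr : GIESFrom s ((f ++ b ++ t).getLastD E) r) :
      GIESFrom s E (f ++ b ++ t ++ r)

/-- `l` is the list of states of a run of GIES from the class of the empty DAG. -/
def IsGIESRun {p : ℕ} (s : MEC p → ℝ) (l : List (MEC p)) : Prop :=
  ∃ r, l = ⟦DAG.empty p⟧ :: r ∧ GIESFrom s ⟦DAG.empty p⟧ r

/-- The moves of the hill climbing of MMHC: delete or reverse an arrow, or add one that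
joins two nodes adjacent in `K`. -/
def HillClimbingMove {p : ℕ} (K : SimpleGraph (Fin p)) (G H : DAG p) : Prop :=
  ∃ i j, (K.Adj i j ∧ G.IsArrowAddition H i j) ∨ H.IsArrowAddition G i j ∨
    G.IsArrowReversal H i j

/-- `l` is the list of states of a run of the search phase of MMHC: hill climbing over DAGs
from the empty DAG, where `K` is the graph of candidate edges left by the independence
tests. -/
def IsMMHCRun {p : ℕ} (s : DAG p → ℝ) (K : SimpleGraph (Fin p)) (l : List (DAG p)) : Prop :=
  ∃ r, l = DAG.empty p :: r ∧ IsGreedyPhase s (HillClimbingMove K) (DAG.empty p) r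

/-! ### Greedy SP and DAG associahedra

A set of conditional independence relations is a predicate `C`, with `C i j K` read as
"`i` is independent of `j` given `K`"; only triples with `i ≠ j` and `i, j ∉ K` matter.
A permutation `π` is read as the ordering `π 0, π 1, …` of the nodes. -/

/-- The graphoid axioms, for single nodes. -/
structure IsGraphoid {p : ℕ} (C : Fin p → Fin p → Finset (Fin p) → Prop) : Prop where
  symm : ∀ i j K, i ≠ j → i ∉ K → j ∉ K → C i j K → C j i K
  exchange : ∀ i j k L, i ≠ j → i ≠ k → j ≠ k → i ∉ L → j ∉ L → k ∉ L →
    C i j L → C i k (insert j L) → C i k L ∧ C i j (insert k L)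
  intersection : ∀ i j k L, i ≠ j → i ≠ k → j ≠ k → i ∉ L → j ∉ L → k ∉ L →
    C i j (insert k L) → C i k (insert j L) → C i j L ∧ C i k L

/-- The nodes that come before `b` in the ordering `π`. -/
def before {p : ℕ} (π : Equiv.Perm (Fin p)) (b : Fin p) : Finset (Fin p) :=
  Finset.univ.filter (fun a => π.symm a < π.symm b)

open Classical in
/-- The DAG of the ordering `π`: there is an arrow `a → b` if `a` comes before `b` and `a` is
not independent of `b` given the other nodes before `b`. -/
noncomputable def minIMap {p : ℕ} (C : Fin p → Fin p → Finset (Fin p) → Prop)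
    (π : Equiv.Perm (Fin p)) : DAG p where
  pa b := (before π b).filter (fun a => ¬ C a b ((before π b).erase a))
  acyclic i h := by
    have key : ∀ a b, Relation.TransGen
        (fun a b => a ∈ (before π b).filter (fun a => ¬ C a b ((before π b).erase a))) a b →
        π.symm a < π.symm b := by
      intro a b hab
      induction hab with
      | single h => exact (Finset.mem_filter.mp (Finset.mem_filter.mp h).1).2
      | tail _ h ih => exact ih.trans (Finset.mem_filter.mp (Finset.mem_filter.mp h).1).2
    exact lt_irrefl _ (key i i h)

/-- `π` is a linear extension (topological ordering) of `G`. -/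
def IsLinearExtension {p : ℕ} (G : DAG p) (π : Equiv.Perm (Fin p)) : Prop :=
  ∀ a b, G.Arrow a b → π.symm a < π.symm b

/-- A move of greedy SP: reverse a covered arrow `i → j` of `D`, that is, an arrow with
`pa j = pa i ∪ {i}`, and pass to the DAG of an ordering of the result. -/
def GreedySPMove {p : ℕ} (C : Fin p → Fin p → Finset (Fin p) → Prop) (D E : DAG p) : Prop :=
  ∃ i j, D.Arrow i j ∧ D.pa j = insert i (D.pa i) ∧
    ∃ H : DAG p, D.IsArrowReversal H i j ∧
      ∃ τ, IsLinearExtension H τ ∧ E = minIMap C τ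

/-- A successful search of greedy SP from `D`, of depth at most `d`: a path of moves from `D`
through the DAGs in `t`, all different and with as many arrows as `D`, to a DAG `E` with
fewer arrows. -/
def IsGreedySPSearch {p : ℕ} (C : Fin p → Fin p → Finset (Fin p) → Prop) (d : ℕ∞)
    (D : DAG p) (t : List (DAG p)) (E : DAG p) : Prop :=
  (D :: t ++ [E]).IsChain (GreedySPMove C) ∧ (D :: t).Nodup ∧
    (∀ F ∈ t, F.numArrows = D.numArrows) ∧ E.numArrows < D.numArrows ∧
    (t.length + 1 : ℕ) ≤ d

/-- `GreedySPFrom C d D l`: the DAGs passed, from `D` to the output, in a run of greedy SP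
from `D` with search depth `d` are `l`. Searches are made until none succeeds. -/
inductive GreedySPFrom {p : ℕ} (C : Fin p → Fin p → Finset (Fin p) → Prop) (d : ℕ∞) :
    DAG p → List (DAG p) → Prop
  | finish (D : DAG p) (h : ∀ t E, ¬ IsGreedySPSearch C d D t E) : GreedySPFrom C d D [D]
  | search (D : DAG p) (t : List (DAG p)) (E : DAG p) (r : List (DAG p))
      (h : IsGreedySPSearch C d D t E) (hr : GreedySPFrom C d E r) :
      GreedySPFrom C d D (D :: t ++ r)

/-- `Q` is a DAG associahedron of `C`, with `v π` its vertex for the ordering `π`: a polytope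
whose normal fan is the coarsening of the braid fan in which the chambers of two orderings
that differ by an adjacent transposition are merged exactly if `C` holds for the transposed
nodes given the nodes before them. (Equivalently, the permutohedron with these edges
contracted.) -/
structure IsDAGAssociahedron {p : ℕ} (C : Fin p → Fin p → Finset (Fin p) → Prop)
    (Q : Set (Fin p → ℝ)) (v : Equiv.Perm (Fin p) → (Fin p → ℝ)) : Prop where
  hull : Q = convexHull ℝ (Set.range v)
  chamber : ∀ (π : Equiv.Perm (Fin p)) (w : Fin p → ℝ), StrictAnti (fun k => w (π k)) →
    ∀ τ, v τ ≠ v π → ∑ i, w i * v τ i < ∑ i, w i * v π i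
  wall : ∀ (π : Equiv.Perm (Fin p)) (k l : Fin p), (k : ℕ) + 1 = l →
    (v (π * Equiv.swap k l) = v π ↔ C (π k) (π l) (before π (π k)))

/-!
The theorem has three independent parts.

**Scores.** A nonempty set `S` of nodes has a sink in `G` (one node with all others as parents) if and only
if no two elements `j`, `k` of `S` are d-separated given any set that contains `S \ {j, k}`
(`DAG.hasSink_iff_forall_not_dSep`), so the characteristic imset is constant on Markov equivalence
classes. Complete DAGs on a set `T` of nodes in different orders are Markov equivalent, hence a
decomposable score equivalent score is determined by its values on them, and their Möbius inverse
is the linear functional (`DAG.exists_linear_score`). The imsets are 0/1 vectors, hence vertices.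
If `H` arises from `G` by adding or reversing an arrow between `i` and `j`, a single coordinate `R`
recognizes `H` among the DAGs whose imset agrees with those of `G` and `H` where these agree: `R`
consists of `i`, `j` and the parents of the new head that are not joined to the new tail
(`DAG.IsArrowAddition.hasSink_iff`, `DAG.IsArrowReversal.hasSink_iff`; for a reversal this requires
that there are such parents, as otherwise no coordinate increases from `G` to `H`, and `G` is
recognized in the same way). A functional that
rewards this coordinate, penalizes the other changing ones, and enforces agreement on the constant
ones exposes the edge (`isPolytopeEdge_of_le`, `isPolytopeEdge_of_detect`).

**Greedy SP.** Any two orderings are linked by adjacent transpositions that correct inversions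
(`bubble_sort_induction`). Transposing independent adjacent nodes changes neither the DAG of an
ordering nor its vertex, so both are the same for all linear extensions of a DAG that contains the
DAG of one of them (`IsGraphoid.eq_of_isLinearExtension`). A covered arrow `i → j` becomes adjacent
in some linear extension, and its reversal amounts to one adjacent transposition of dependent
nodes, which follows an edge of the DAG associahedron (`IsDAGAssociahedron.isPolytopeEdge`).

**d-separation.** By cutting loops, d-separation can be tested on walks instead of paths
(`DAG.not_dSep_iff`); concatenation of walks then gives the graphoid axioms and composition. A
polytope is obtained as the base polytope of a submodular function `g` whose submodular
inequalities are tight exactly for the d-separations (`DAG.exists_isFaithfulOn_univ`). It is built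
one node at a time, parents first: the value that a new node `v` adds to a set `S` is
`1 - ε * exp (-h S)`, where `h S` is the value that the parents of `v` add to `S`. This is tight for
`i`, `v` given `K` if and only if `i` is separated from all parents of `v` outside `K`, and by strict
concavity it is tight for `i`, `j` given `K ∪ {v}` if and only if `i`, `j` are separated by `K` and one
of them is separated from `v` by `K`. These are the recursions of d-separation
(`DAG.conn_iff_exists_parent`, `DAG.conn_insert_iff`).
-/

/-! ### d-separation by walks -/

namespace DAG

variable {p : ℕ}

/-- The node `b`, entered from `a` and left towards `c`, does not block a path given `K`. -/
def ActiveTriple (G : DAG p) (K : Finset (Fin p)) (a b c : Fin p) : Prop :=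
  ((G.Arrow a b ∧ G.Arrow c b) → ∃ d ∈ K, Relation.ReflTransGen G.Arrow b d) ∧
    (¬ (G.Arrow a b ∧ G.Arrow c b) → b ∉ K)

/-- An active path, except that nodes may be repeated. -/
def IsActiveWalk (G : DAG p) (K : Finset (Fin p)) (l : List (Fin p)) : Prop :=
  l.IsChain G.Neighbor ∧ ∀ a b c, [a, b, c] <:+: l → G.ActiveTriple K a b c

/-- Some walk from `i` to `j` is active given `K`. -/
def Conn (G : DAG p) (K : Finset (Fin p)) (i j : Fin p) : Prop :=
  ∃ l, l.head? = some i ∧ l.getLast? = some j ∧ G.IsActiveWalk K l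

variable {G : DAG p} {K : Finset (Fin p)}

theorem Arrow.not_symm {a b : Fin p} (h : G.Arrow a b) : ¬ G.Arrow b a := fun h' =>
  G.acyclic a ((Relation.TransGen.single h).tail h')

theorem Arrow.ne {a b : Fin p} (h : G.Arrow a b) : a ≠ b := by
  rintro rfl
  exact h.not_symm h

theorem Neighbor.symm {a b : Fin p} (h : G.Neighbor a b) : G.Neighbor b a := Or.symm h

theorem Neighbor.ne {a b : Fin p} (h : G.Neighbor a b) : a ≠ b :=
  h.elim Arrow.ne fun h => h.ne.symm

theorem not_transGen_of_reflTransGen {a b : Fin p} (h : Relation.ReflTransGen G.Arrow a b) :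
    ¬ Relation.TransGen G.Arrow b a := fun h' => G.acyclic b (h'.trans_left h)

theorem ActiveTriple.symm {a b c : Fin p} (h : G.ActiveTriple K a b c) :
    G.ActiveTriple K c b a :=
  ⟨fun h' => h.1 h'.symm, fun h' => h.2 fun h'' => h' h''.symm⟩

theorem isActiveWalk_nil : G.IsActiveWalk K [] := by
  refine ⟨List.IsChain.nil, fun a b c h => ?_⟩
  simpa using h.length_le

theorem isActiveWalk_singleton (a : Fin p) : G.IsActiveWalk K [a] := by
  refine ⟨List.IsChain.singleton a, fun a b c h => ?_⟩
  simpa using h.length_le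

theorem isActiveWalk_pair {a b : Fin p} : G.IsActiveWalk K [a, b] ↔ G.Neighbor a b := by
  refine ⟨fun h => by simpa using h.1, fun h => ⟨by simpa using h, fun a b c h => ?_⟩⟩
  simpa using h.length_le

theorem isActiveWalk_cons_cons_cons {a b c : Fin p} {l : List (Fin p)} :
    G.IsActiveWalk K (a :: b :: c :: l) ↔
      G.Neighbor a b ∧ G.ActiveTriple K a b c ∧ G.IsActiveWalk K (b :: c :: l) := by
  constructor
  · rintro ⟨h1, h2⟩
    rw [List.isChain_cons_cons] at h1
    exact ⟨h1.1, h2 a b c ⟨[], l, by simp⟩, h1.2, fun x y z h => h2 x y z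
      (List.infix_cons_iff.2 (Or.inr h))⟩
  · rintro ⟨h1, h2, h3, h4⟩
    refine ⟨List.isChain_cons_cons.2 ⟨h1, h3⟩, fun x y z h => ?_⟩
    rcases List.infix_cons_iff.1 h with h | h
    · simp only [List.cons_prefix_cons, List.nil_prefix, and_true] at h
      obtain ⟨rfl, rfl, rfl⟩ := h
      exact h2
    · exact h4 x y z h

theorem isActiveWalk_append_cons {x : Fin p} {A C : List (Fin p)} :
    G.IsActiveWalk K (A ++ x :: C) ↔ G.IsActiveWalk K (A ++ [x]) ∧ G.IsActiveWalk K (x :: C) ∧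
      ∀ a ∈ A.getLast?, ∀ c ∈ C.head?, G.ActiveTriple K a x c := by
  induction A with
  | nil => simp [isActiveWalk_singleton]
  | cons a A ih =>
    cases A with
    | nil =>
      cases C with
      | nil => simp [isActiveWalk_singleton]
      | cons c C =>
        simp only [List.cons_append, List.nil_append, isActiveWalk_cons_cons_cons,
          isActiveWalk_pair, List.getLast?_singleton, Option.mem_some_iff, List.head?_cons,
          forall_eq']
        tauto
    | cons b A =>
      have hl : (a :: b :: A).getLast? = (b :: A).getLast? := by simp [List.getLast?_cons]
      rw [hl]
      cases A with
      | nil =>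
        simp only [List.cons_append, List.nil_append, isActiveWalk_cons_cons_cons] at ih ⊢
        rw [ih]
        tauto
      | cons d A =>
        simp only [List.cons_append, isActiveWalk_cons_cons_cons (l := A ++ _)] at ih ⊢
        tauto

theorem IsActiveWalk.reverse {l : List (Fin p)} (h : G.IsActiveWalk K l) :
    G.IsActiveWalk K l.reverse := by
  refine ⟨List.isChain_reverse.2 (h.1.imp fun _ _ h => h.symm), fun a b c h' => ?_⟩
  refine (h.2 c b a ?_).symm
  rw [← List.reverse_infix]
  simpa using h'

theorem Conn.symm {i j : Fin p} (h : G.Conn K i j) : G.Conn K j i := by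
  obtain ⟨l, h1, h2, h3⟩ := h
  exact ⟨l.reverse, by simpa using h2, by simpa using h1, h3.reverse⟩

theorem Conn.refl (i : Fin p) : G.Conn K i i :=
  ⟨[i], rfl, rfl, isActiveWalk_singleton i⟩

theorem Conn.of_arrow {i j : Fin p} (h : G.Neighbor i j) : G.Conn K i j :=
  ⟨[i, j], rfl, rfl, isActiveWalk_pair.2 h⟩

/-- An active walk that starts along an arrow `x → y` either meets a collider, the first of
which descends from `x`, or is directed throughout. -/
theorem IsActiveWalk.of_arrow {x y : Fin p} {l : List (Fin p)}
    (h : G.IsActiveWalk K (x :: y :: l)) (hxy : G.Arrow x y) :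
    (∃ d ∈ K, Relation.ReflTransGen G.Arrow x d) ∨
      ∀ z ∈ y :: l, Relation.TransGen G.Arrow x z := by
  induction l generalizing x y with
  | nil =>
    right
    intro z hz
    obtain rfl : z = y := by simpa using hz
    exact Relation.TransGen.single hxy
  | cons c l ih =>
    obtain ⟨-, h2, h3⟩ := isActiveWalk_cons_cons_cons.1 h
    by_cases hc : G.Arrow c y
    · obtain ⟨d, hd, hd'⟩ := h2.1 ⟨hxy, hc⟩
      exact Or.inl ⟨d, hd, hd'.head hxy⟩
    · have hyc : G.Arrow y c := by
        have := h3.1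
        rw [List.isChain_cons_cons] at this
        exact this.1.resolve_right hc
      rcases ih h3 hyc with ⟨d, hd, hd'⟩ | h4
      · exact Or.inl ⟨d, hd, hd'.head hxy⟩
      · right
        intro z hz
        rcases List.mem_cons.1 hz with rfl | hz
        · exact Relation.TransGen.single hxy
        · exact Relation.TransGen.head hxy (h4 z hz)

/-- A loop at `x` can be cut out of an active walk. If `x` becomes a collider without having been
one at its first occurrence, then the loop leaves `x` along an arrow; as it returns to `x`, it
cannot be directed throughout, and its first collider is a descendant of `x`. -/
theorem IsActiveWalk.cut {x : Fin p} {A B C : List (Fin p)}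
    (h : G.IsActiveWalk K (A ++ x :: (B ++ x :: C))) : G.IsActiveWalk K (A ++ x :: C) := by
  obtain ⟨h1, h2, h3⟩ := isActiveWalk_append_cons.1 h
  obtain ⟨-, h4, h5⟩ := isActiveWalk_append_cons.1
    (show G.IsActiveWalk K ((x :: B) ++ x :: C) from h2)
  refine isActiveWalk_append_cons.2 ⟨h1, h4, fun a ha c hc => ⟨?_, ?_⟩⟩
  · rintro ⟨hax, hcx⟩
    obtain ⟨b, D, hb⟩ : ∃ b D, B ++ x :: C = b :: D := by cases B <;> simp
    rw [hb] at h2 h3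
    by_cases hbx : G.Arrow b x
    · exact (h3 a ha b rfl).1 ⟨hax, hbx⟩
    · have hn := h2.1
      rw [List.isChain_cons_cons] at hn
      rcases h2.of_arrow (hn.1.resolve_right hbx) with h6 | h6
      · exact h6
      · exact (G.acyclic x (h6 x (by rw [← hb]; simp))).elim
  · intro hn
    by_cases hax : G.Arrow a x
    · obtain ⟨b, hb⟩ : ∃ b, (x :: B).getLast? = some b := by
        cases hq : (x :: B).getLast? with
        | none => simp at hq
        | some b => exact ⟨b, rfl⟩
      exact (h5 b hb c hc).2 fun h => hn ⟨hax, h.2⟩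
    · obtain ⟨b, D, hb⟩ : ∃ b D, B ++ x :: C = b :: D := by cases B <;> simp
      rw [hb] at h3
      exact (h3 a ha b rfl).2 fun h => hax h.1

theorem exists_eq_append_of_not_nodup {α : Type*} {l : List α} (h : ¬ l.Nodup) :
    ∃ A x B C, l = A ++ x :: (B ++ x :: C) := by
  induction l with
  | nil => simp at h
  | cons a l ih =>
    by_cases ha : a ∈ l
    · obtain ⟨B, C, rfl⟩ := List.append_of_mem ha
      exact ⟨[], a, B, C, rfl⟩
    · obtain ⟨A, x, B, C, rfl⟩ := ih fun hl => h (List.nodup_cons.2 ⟨ha, hl⟩)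
      exact ⟨a :: A, x, B, C, rfl⟩

theorem Conn.exists_nodup {i j : Fin p} (h : G.Conn K i j) :
    ∃ l, l.head? = some i ∧ l.getLast? = some j ∧ G.IsActiveWalk K l ∧ l.Nodup := by
  obtain ⟨l, h⟩ := h
  induction hn : l.length using Nat.strong_induction_on generalizing l with
  | _ n ih =>
    subst hn
    by_cases hl : l.Nodup
    · exact ⟨l, h.1, h.2.1, h.2.2, hl⟩
    · obtain ⟨A, x, B, C, rfl⟩ := exists_eq_append_of_not_nodup hl
      refine ih _ ?_ (A ++ x :: C) ⟨?_, ?_, h.2.2.cut⟩ rfl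
      · simp
      · have := h.1
        cases A <;> simpa using this
      · have := h.2.1
        simpa [List.getLast?_append, List.getLast?_cons] using this

theorem not_dSep_iff {i j : Fin p} : ¬ G.DSep i j K ↔ G.Conn K i j := by
  unfold DSep
  rw [not_not]
  constructor
  · rintro ⟨l, h1, h2, h3⟩
    exact ⟨l, h1, h2, h3.2⟩
  · intro h
    obtain ⟨l, h1, h2, h3, h4⟩ := h.exists_nodup
    exact ⟨l, h1, h2, h4, h3⟩

theorem dSep_iff {i j : Fin p} : G.DSep i j K ↔ ¬ G.Conn K i j := by
  rw [← not_dSep_iff, not_not]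

/-- The nodes of an active walk are ancestors of its ends or of the conditioning set. -/
theorem IsActiveWalk.ancestor {i j x : Fin p} {l : List (Fin p)} (h : G.IsActiveWalk K l)
    (hi : l.head? = some i) (hj : l.getLast? = some j) (hx : x ∈ l) :
    ∃ d ∈ insert i (insert j K), Relation.ReflTransGen G.Arrow x d := by
  obtain ⟨A, C, rfl⟩ := List.append_of_mem hx
  have mono : (∃ d ∈ K, Relation.ReflTransGen G.Arrow x d) →
      ∃ d ∈ insert i (insert j K), Relation.ReflTransGen G.Arrow x d :=
    fun ⟨d, hd, hd'⟩ => ⟨d, by simp [hd], hd'⟩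
  obtain ⟨h1, h2, h3⟩ := isActiveWalk_append_cons.1 h
  rcases C with _ | ⟨c, C⟩
  · obtain rfl : x = j := by simpa using hj
    exact ⟨x, by simp, Relation.ReflTransGen.refl⟩
  rcases List.eq_nil_or_concat A with rfl | ⟨A, a, rfl⟩
  · obtain rfl : x = i := by simpa using hi
    exact ⟨x, by simp, Relation.ReflTransGen.refl⟩
  have hjC : j ∈ c :: C := by
    have : (c :: C).getLast? = some j := by
      simpa [List.getLast?_append, List.getLast?_cons] using hj
    exact List.mem_of_getLast? this
  have h1' := h1.reverse
  simp only [List.concat_eq_append, List.append_assoc, List.reverse_append, List.reverse_cons,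
    List.reverse_nil, List.nil_append, List.cons_append] at h1'
  have hiA : i ∈ a :: A.reverse := by
    have : (A ++ [a]).head? = some i := by
      rw [← hi]; cases A <;> simp
    simpa [or_comm] using List.mem_of_mem_head? this
  have hn2 := h2.1
  have hn1 := h1'.1
  rw [List.isChain_cons_cons] at hn1 hn2
  by_cases hax : G.Arrow a x
  · by_cases hcx : G.Arrow c x
    · exact mono ((h3 a (by simp) c rfl).1 ⟨hax, hcx⟩)
    · rcases h2.of_arrow (hn2.1.resolve_right hcx) with h | h
      · exact mono h
      · exact ⟨j, by simp, (h j hjC).to_reflTransGen⟩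
  · rcases h1'.of_arrow (hn1.1.resolve_right hax) with h | h
    · exact mono h
    · exact ⟨i, by simp, (h i hiA).to_reflTransGen⟩

/-- A directed path is active given `K` if its start has no descendant in `K`. -/
theorem isActiveWalk_of_isChain_arrow {c : Fin p} {D : List (Fin p)}
    (hD : (c :: D).IsChain G.Arrow) (hc : ¬ ∃ d ∈ K, Relation.ReflTransGen G.Arrow c d) :
    G.IsActiveWalk K (c :: D) := by
  induction D generalizing c with
  | nil => exact isActiveWalk_singleton c
  | cons b D ih =>
    rw [List.isChain_cons_cons] at hD
    have hb : ¬ ∃ d ∈ K, Relation.ReflTransGen G.Arrow b d := fun ⟨d, hd, hd'⟩ =>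
      hc ⟨d, hd, hd'.head hD.1⟩
    have hw := ih hD.2 hb
    cases D with
    | nil => exact isActiveWalk_pair.2 (Or.inl hD.1)
    | cons e D =>
      have hbe := hD.2
      rw [List.isChain_cons_cons] at hbe
      exact isActiveWalk_cons_cons_cons.2 ⟨Or.inl hD.1,
        ⟨fun h => (hbe.1.not_symm h.2).elim, fun _ h => hb ⟨b, h, Relation.ReflTransGen.refl⟩⟩,
        hw⟩

/-- If an active walk given `insert k L` is not active given `L`, it has a first collider
that needs `k`. -/
theorem IsActiveWalk.split_insert {k : Fin p} {l : List (Fin p)} {S : Finset (Fin p)}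
    (h : G.IsActiveWalk (insert k S) l) :
    G.IsActiveWalk S l ∨ ∃ A c C, l = A ++ c :: C ∧ A ≠ [] ∧ G.IsActiveWalk S (A ++ [c]) ∧
      Relation.ReflTransGen G.Arrow c k ∧ ¬ ∃ d ∈ S, Relation.ReflTransGen G.Arrow c d := by
  induction l with
  | nil => exact Or.inl isActiveWalk_nil
  | cons a l ih =>
    rcases l with _ | ⟨b, _ | ⟨c, l⟩⟩
    · exact Or.inl (isActiveWalk_singleton a)
    · exact Or.inl (isActiveWalk_pair.2 (isActiveWalk_pair.1 h))
    · obtain ⟨h1, h2, h3⟩ := isActiveWalk_cons_cons_cons.1 h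
      by_cases ht : G.ActiveTriple S a b c
      · rcases ih h3 with h4 | ⟨A, d, C, hA, hne, h4, h5⟩
        · exact Or.inl (isActiveWalk_cons_cons_cons.2 ⟨h1, ht, h4⟩)
        · right
          refine ⟨a :: A, d, C, by simp [hA], by simp, ?_, h5⟩
          rcases A with _ | ⟨b', A⟩
          · exact absurd rfl hne
          obtain ⟨rfl, hA⟩ : b = b' ∧ c :: l = A ++ d :: C := by simpa using hA
          rcases A with _ | ⟨c', A⟩
          · obtain ⟨rfl, -⟩ : c = d ∧ l = C := by simpa using hA
            exact isActiveWalk_cons_cons_cons.2 ⟨h1, ht, h4⟩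
          · obtain ⟨rfl, -⟩ : c = c' ∧ _ := by simpa using hA
            exact isActiveWalk_cons_cons_cons.2 ⟨h1, ht, h4⟩
      · right
        have hcol : G.Arrow a b ∧ G.Arrow c b := by
          by_contra hcol
          exact ht ⟨fun h => (hcol h).elim, fun h hb => h2.2 h (Finset.mem_insert_of_mem hb)⟩
        have hS : ¬ ∃ d ∈ S, Relation.ReflTransGen G.Arrow b d := fun hS =>
          ht ⟨fun _ => hS, fun h => (h hcol).elim⟩
        obtain ⟨d, hd, hd'⟩ := h2.1 hcol
        rcases Finset.mem_insert.1 hd with rfl | hd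
        · exact ⟨[a], b, c :: l, rfl, by simp, isActiveWalk_pair.2 h1, hd', hS⟩
        · exact (hS ⟨d, hd, hd'⟩).elim

/-- Composition, by following the first collider that needs `k` down to `k`. -/
theorem Conn.of_insert {i j k : Fin p} (h : G.Conn (insert k K) i j) :
    G.Conn K i j ∨ G.Conn K i k := by
  obtain ⟨l, h1, h2, h3⟩ := h
  rcases h3.split_insert with h4 | ⟨A, c, C, rfl, hA, h4, hck, hc⟩
  · exact Or.inl ⟨l, h1, h2, h4⟩
  · right
    obtain ⟨D, hD, hk⟩ := List.exists_isChain_cons_of_relationReflTransGen hck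
    refine ⟨A ++ c :: D, ?_, ?_, ?_⟩
    · rcases A with _ | ⟨a, A⟩
      · exact absurd rfl hA
      · simpa using h1
    · rw [List.getLast?_append, List.getLast?_eq_some_getLast (by simp), hk]
      rfl
    · refine isActiveWalk_append_cons.2 ⟨h4, isActiveWalk_of_isChain_arrow hD hc, ?_⟩
      intro a ha d hd
      rcases D with _ | ⟨d', D⟩
      · simp at hd
      obtain rfl : d' = d := by simpa using hd
      rw [List.isChain_cons_cons] at hD
      exact ⟨fun h => (hD.1.not_symm h.2).elim,
        fun _ h => hc ⟨c, h, Relation.ReflTransGen.refl⟩⟩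

theorem ActiveTriple.insert {a b c k : Fin p} (h : G.ActiveTriple K a b c) (hb : b ≠ k) :
    G.ActiveTriple (insert k K) a b c := by
  refine ⟨fun h' => ?_, fun h' h'' => ?_⟩
  · obtain ⟨d, hd, hd'⟩ := h.1 h'
    exact ⟨d, Finset.mem_insert_of_mem hd, hd'⟩
  · exact h.2 h' ((Finset.mem_insert.1 h'').resolve_left hb)

theorem IsActiveWalk.insert {k : Fin p} {l : List (Fin p)} (h : G.IsActiveWalk K l)
    (hk : k ∉ l) : G.IsActiveWalk (insert k K) l :=
  ⟨h.1, fun a b c hl => (h.2 a b c hl).insert fun hb => hk (hb ▸ hl.subset (by simp))⟩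

/-- Contraction: a node that blocks an active walk is reached by a part of it. -/
theorem Conn.insert_or {i j : Fin p} (k : Fin p) (h : G.Conn K i j) :
    G.Conn (insert k K) i j ∨ G.Conn K i k := by
  obtain ⟨l, h1, h2, h3⟩ := h
  by_cases hkl : k ∈ l
  · right
    obtain ⟨A, C, rfl⟩ := List.append_of_mem hkl
    refine ⟨A ++ [k], ?_, by simp, (isActiveWalk_append_cons.1 h3).1⟩
    cases A <;> simpa using h1
  · exact Or.inl ⟨l, h1, h2, h3.insert hkl⟩

/-- Intersection: if `k` blocks an active path from `i` to `j`, then the part of the path up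
to `k` does not pass through `j`. -/
theorem Conn.insert_or_insert {i j k : Fin p} (hk : k ≠ j) (h : G.Conn K i j) :
    G.Conn (insert k K) i j ∨ G.Conn (insert j K) i k := by
  obtain ⟨l, h1, h2, h3, h4⟩ := h.exists_nodup
  by_cases hkl : k ∈ l
  · right
    obtain ⟨A, C, rfl⟩ := List.append_of_mem hkl
    refine ⟨A ++ [k], ?_, by simp, (isActiveWalk_append_cons.1 h3).1.insert ?_⟩
    · cases A <;> simpa using h1
    · have hjC : j ∈ C := by
        rcases C with _ | ⟨c, C⟩
        · exact (hk (by simpa using h2)).elim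
        · have : (c :: C).getLast? = some j := by
            simpa [List.getLast?_append, List.getLast?_cons] using h2
          exact List.mem_of_getLast? this
      rw [List.nodup_append'] at h4
      intro hj
      rcases List.mem_append.1 hj with hj | hj
      · exact h4.2.2 hj (List.mem_cons_of_mem _ hjC)
      · exact hk (List.mem_singleton.1 hj).symm
  · exact Or.inl ⟨l, h1, h2, h3.insert hkl⟩

/-- The walks that end in a node without descendants among the others arrive there along an
arrow from a parent. -/
theorem conn_iff_exists_parent {i v : Fin p} (hi : i ∉ K)
    (hv : ∀ d ∈ insert i K, ¬ Relation.ReflTransGen G.Arrow v d) :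
    G.Conn K i v ↔ ∃ u ∈ G.pa v, u ∉ K ∧ G.Conn K i u := by
  constructor
  · intro h
    obtain ⟨l, h1, h2, h3⟩ := h.symm
    obtain ⟨m, rfl⟩ := List.head?_eq_some_iff.1 h1
    rcases m with _ | ⟨u, m⟩
    · obtain rfl : v = i := by simpa using h2
      exact (hv v (by simp) Relation.ReflTransGen.refl).elim
    have h2' : (u :: m).getLast? = some i := by simpa [List.getLast?_cons] using h2
    have hn := h3.1
    rw [List.isChain_cons_cons] at hn
    rcases hn.1 with huv | huv
    · exfalso
      rcases h3.of_arrow huv with ⟨d, hd, hd'⟩ | h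
      · exact hv d (Finset.mem_insert_of_mem hd) hd'
      · exact hv i (by simp) (h i (List.mem_of_getLast? h2')).to_reflTransGen
    · refine ⟨u, huv, ?_, Conn.symm ⟨u :: m, rfl, h2', ?_⟩⟩
      · rcases m with _ | ⟨c, m⟩
        · obtain rfl : u = i := by simpa using h2'
          exact hi
        · exact (isActiveWalk_cons_cons_cons.1 h3).2.1.2 fun h => h.1.not_symm huv
      · exact (isActiveWalk_append_cons (A := [v]).1 h3).2.1
  · rintro ⟨u, hu, huK, l, h1, h2, h3⟩
    obtain ⟨A, rfl⟩ := List.getLast?_eq_some_iff.1 h2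
    refine ⟨A ++ u :: [v], ?_, by simp, ?_⟩
    · cases A <;> simpa using h1
    · refine isActiveWalk_append_cons.2 ⟨h3, isActiveWalk_pair.2 (Or.inl hu), ?_⟩
      intro a ha c hc
      obtain rfl : v = c := by simpa using hc
      exact ⟨fun h => ((show G.Arrow u v from hu).not_symm h.2).elim, fun _ => huK⟩

theorem Conn.insert {i j v : Fin p} (hij : G.Conn K i j)
    (hv : ∀ d ∈ insert i (insert j K), ¬ Relation.ReflTransGen G.Arrow v d) :
    G.Conn (insert v K) i j := by
  obtain ⟨l, h1, h2, h3⟩ := hij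
  refine ⟨l, h1, h2, h3.insert fun hvl => ?_⟩
  obtain ⟨d, hd, hd'⟩ := h3.ancestor h1 h2 hvl
  exact hv d hd hd'

/-- Conditioning on a node `v` without descendants among the others opens exactly the walks
that have `v` as a collider. -/
theorem conn_insert_iff {i j v : Fin p} (hi : i ∉ K) (hj : j ∉ K)
    (hv : ∀ d ∈ insert i (insert j K), ¬ Relation.ReflTransGen G.Arrow v d) :
    G.Conn (insert v K) i j ↔ G.Conn K i j ∨ (G.Conn K i v ∧ G.Conn K j v) := by
  have hvi : ∀ d ∈ Insert.insert i K, ¬ Relation.ReflTransGen G.Arrow v d := fun d hd =>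
    hv d (by simp only [Finset.mem_insert] at hd ⊢; tauto)
  have hvj : ∀ d ∈ Insert.insert j K, ¬ Relation.ReflTransGen G.Arrow v d := fun d hd =>
    hv d (by simp only [Finset.mem_insert] at hd ⊢; tauto)
  constructor
  · intro h
    rcases h.of_insert with h1 | h1
    · exact Or.inl h1
    rcases h.symm.of_insert with h2 | h2
    · exact Or.inl h2.symm
    · exact Or.inr ⟨h1, h2⟩
  · rintro (h | ⟨h1, h2⟩)
    · exact h.insert hv
    · obtain ⟨u, hu, huK, hiu⟩ := (conn_iff_exists_parent hi hvi).1 h1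
      obtain ⟨w, hw, hwK, hjw⟩ := (conn_iff_exists_parent hj hvj).1 h2
      have hup : ∀ u ∈ G.pa v, ¬ Relation.ReflTransGen G.Arrow v u := fun u hu h =>
        not_transGen_of_reflTransGen h (Relation.TransGen.single hu)
      have ext : ∀ i u, G.Conn K i u → u ∈ G.pa v →
          (∀ d ∈ Insert.insert i K, ¬ Relation.ReflTransGen G.Arrow v d) →
          G.Conn (Insert.insert v K) i u := by
        intro i u h hu hd
        refine h.insert fun d hd' => ?_
        simp only [Finset.mem_insert] at hd' hd
        rcases hd' with rfl | rfl | hd'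
        · exact hd _ (Or.inl rfl)
        · exact hup _ hu
        · exact hd _ (Or.inr hd')
      obtain ⟨l, hl1, hl2, hl3⟩ := ext i u hiu hu hvi
      obtain ⟨m, hm1, hm2, hm3⟩ := (ext j w hjw hw hvj).symm
      obtain ⟨A, rfl⟩ := List.getLast?_eq_some_iff.1 hl2
      obtain ⟨C, rfl⟩ := List.head?_eq_some_iff.1 hm1
      have hu' : G.Arrow u v := hu
      have hw' : G.Arrow w v := hw
      have hwC : G.IsActiveWalk (Insert.insert v K) (v :: w :: C) := by
        refine isActiveWalk_append_cons (A := [v]).2 ⟨isActiveWalk_pair.2 (Or.inr hw'), hm3, ?_⟩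
        intro a ha c hc
        obtain rfl : v = a := by simpa using ha
        exact ⟨fun h => (hw'.not_symm h.1).elim, fun _ => by simp [hwK, hw'.ne]⟩
      refine ⟨A ++ u :: v :: w :: C, ?_, ?_, ?_⟩
      · cases A <;> simpa using hl1
      · simpa [List.getLast?_append, List.getLast?_cons] using hm2
      · refine isActiveWalk_append_cons.2 ⟨hl3, ?_, ?_⟩
        · refine isActiveWalk_cons_cons_cons.2 ⟨Or.inl hu', ⟨fun _ => ?_, fun h => ?_⟩, hwC⟩
          · exact ⟨v, by simp, Relation.ReflTransGen.refl⟩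
          · exact (h ⟨hu', hw'⟩).elim
        · intro a ha c hc
          obtain rfl : v = c := by simpa using hc
          exact ⟨fun h => (hu'.not_symm h.2).elim, fun _ => by simp [huK, hu'.ne]⟩

end DAG

/-! ### Characteristic imsets and Markov equivalence -/

namespace DAG

variable {p : ℕ} {G : DAG p}

/-- All other nodes of `S` are parents of one node of `S`. -/
def HasSink (G : DAG p) (S : Finset (Fin p)) : Prop :=
  ∃ i ∈ S, ∀ j ∈ S, j ≠ i → G.Arrow j i

open Classical in
theorem charImset_apply (G : DAG p) (S : {S : Finset (Fin p) // 2 ≤ S.card}) :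
    charImset G S = if G.HasSink S.1 then 1 else 0 := by
  unfold charImset
  refine if_congr ?_ rfl rfl
  simp only [HasSink, Finset.mem_sdiff, Finset.mem_singleton, and_imp]
  rfl

theorem charImset_eq_one {S : {S : Finset (Fin p) // 2 ≤ S.card}} :
    charImset G S = 1 ↔ G.HasSink S.1 := by
  rw [charImset_apply]
  split_ifs with h <;> simp [h]

theorem charImset_eq_zero {S : {S : Finset (Fin p) // 2 ≤ S.card}} :
    charImset G S = 0 ↔ ¬ G.HasSink S.1 := by
  rw [charImset_apply]
  split_ifs with h <;> simp [h]

theorem charImset_eq_charImset_iff {H : DAG p} {S : {S : Finset (Fin p) // 2 ≤ S.card}} :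
    charImset G S = charImset H S ↔ (G.HasSink S.1 ↔ H.HasSink S.1) := by
  rw [charImset_apply, charImset_apply]
  split_ifs with h h' h' <;> simp [h, h']

theorem HasSink.nonempty {S : Finset (Fin p)} (h : G.HasSink S) : S.Nonempty :=
  let ⟨i, hi, _⟩ := h
  ⟨i, hi⟩

theorem exists_no_descendant (G : DAG p) {S : Finset (Fin p)} (hS : S.Nonempty) :
    ∃ i ∈ S, ∀ j ∈ S, ¬ Relation.TransGen G.Arrow i j := by
  let r : Fin p → Fin p → Prop := fun a b => Relation.TransGen G.Arrow b a
  have : IsTrans (Fin p) r := ⟨fun a b c h1 h2 => h2.trans h1⟩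
  have : Std.Irrefl r := ⟨fun a h => G.acyclic a h⟩
  obtain ⟨i, hi, h⟩ := (Finite.wellFounded_of_trans_of_irrefl r).has_min (S : Set (Fin p)) hS
  exact ⟨i, hi, fun j hj hij => h j hj hij⟩

/-- The characteristic imset in terms of d-separation: if no node of `S` has all others as
parents, then a node `i` of `S` without descendants in `S` is separated from a non-parent `j`
in `S` by the other non-descendants of `i`. -/
theorem hasSink_iff_forall_not_dSep {S : Finset (Fin p)} (hS : S.Nonempty) :
    G.HasSink S ↔ ∀ j ∈ S, ∀ k ∈ S, j ≠ k → ∀ K : Finset (Fin p), j ∉ K → k ∉ K →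
      S \ {j, k} ⊆ K → ¬ G.DSep j k K := by
  constructor
  · rintro ⟨i, hi, h⟩ j hj k hk hjk K hjK hkK hK
    rw [not_dSep_iff]
    by_cases hji : j = i
    · subst hji
      exact Conn.of_arrow (Or.inr (h k hk hjk.symm))
    by_cases hki : k = i
    · subst hki
      exact Conn.of_arrow (Or.inl (h j hj hjk))
    have hiK : i ∈ K := hK (by simp [hi, Ne.symm hji, Ne.symm hki])
    refine ⟨[j, i, k], rfl, rfl, isActiveWalk_cons_cons_cons.2 ⟨Or.inl (h j hj hji), ⟨fun _ =>
      ⟨i, hiK, Relation.ReflTransGen.refl⟩, fun h' => (h' ⟨h j hj hji, h k hk hki⟩).elim⟩,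
      isActiveWalk_pair.2 (Or.inr (h k hk hki))⟩⟩
  · intro h
    by_contra hns
    classical
    obtain ⟨i, hi, hd⟩ := G.exists_no_descendant hS
    obtain ⟨j, hj, hji, hja⟩ : ∃ j ∈ S, j ≠ i ∧ ¬ G.Arrow j i := by
      by_contra hc
      push Not at hc
      exact hns ⟨i, hi, hc⟩
    have hdj : ∀ k ∈ S, k ≠ i → ¬ Relation.ReflTransGen G.Arrow i k := by
      intro k hk hki hr
      rcases Relation.reflTransGen_iff_eq_or_transGen.1 hr with rfl | hr
      · exact hki rfl
      · exact hd k hk hr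
    let K : Finset (Fin p) :=
      Finset.univ.filter fun x => x ≠ j ∧ ¬ Relation.ReflTransGen G.Arrow i x
    have hK : ∀ x, x ∈ K ↔ x ≠ j ∧ ¬ Relation.ReflTransGen G.Arrow i x := by simp [K]
    refine h j hj i hi hji K (by simp [hK]) (by simp [hK, Relation.ReflTransGen.refl]) ?_ ?_
    · intro x hx
      simp only [Finset.mem_sdiff, Finset.mem_insert, Finset.mem_singleton, not_or] at hx
      exact (hK x).2 ⟨hx.2.1, hdj x hx.1 hx.2.2⟩
    · rw [dSep_iff, conn_iff_exists_parent (by simp [hK])]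
      · rintro ⟨u, hu, huK, -⟩
        refine huK ((hK u).2 ⟨?_, fun hr => ?_⟩)
        · rintro rfl
          exact hja hu
        · exact not_transGen_of_reflTransGen hr (Relation.TransGen.single hu)
      · intro d hd'
        rcases Finset.mem_insert.1 hd' with rfl | hd'
        · exact hdj d hj hji
        · exact ((hK d).1 hd').2

theorem MarkovEquiv.charImset_eq {H : DAG p} (h : G.MarkovEquiv H) :
    charImset G = charImset H := by
  funext S
  have hS : S.1.Nonempty := Finset.card_pos.1 (by have := S.2; omega)
  rw [charImset_eq_charImset_iff, hasSink_iff_forall_not_dSep hS,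
    hasSink_iff_forall_not_dSep hS]
  refine forall₂_congr fun j hj => forall₂_congr fun k hk => forall_congr' fun hjk =>
    forall_congr' fun K => forall_congr' fun hjK => forall_congr' fun hkK =>
    forall_congr' fun hK => not_congr (h j k K hjk hjK hkK)

/-! ### Decomposable score equivalent scores are linear in the characteristic imset -/

/-- The DAG whose arrows join all pairs of nodes of `T`, in the direction in which `r`
increases. -/
def clique (r : Fin p → ℕ) (T : Finset (Fin p)) : DAG p where
  pa b := if b ∈ T then T.filter fun a => r a < r b else ∅
  acyclic i h := by
    have key : ∀ a b, Relation.TransGen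
        (fun a b => a ∈ if b ∈ T then T.filter fun a => r a < r b else ∅) a b → r a < r b := by
      have one : ∀ a b, (a ∈ if b ∈ T then T.filter fun a => r a < r b else ∅) → r a < r b := by
        intro a b hab
        split_ifs at hab
        · exact (Finset.mem_filter.1 hab).2
        · simp at hab
      intro a b hab
      induction hab with
      | single h => exact one _ _ h
      | tail _ h ih => exact ih.trans (one _ _ h)
    exact lt_irrefl _ (key i i h)

theorem clique_arrow {r : Fin p → ℕ} {T : Finset (Fin p)} {a b : Fin p} :
    (clique r T).Arrow a b ↔ a ∈ T ∧ b ∈ T ∧ r a < r b := by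
  unfold Arrow clique
  by_cases hb : b ∈ T <;> simp [hb]

theorem clique_neighbor {r : Fin p → ℕ} (hr : r.Injective) {T : Finset (Fin p)} {a b : Fin p} :
    (clique r T).Neighbor a b ↔ a ≠ b ∧ a ∈ T ∧ b ∈ T := by
  unfold Neighbor
  rw [clique_arrow, clique_arrow]
  have : r a = r b ↔ a = b := hr.eq_iff
  constructor
  · rintro (⟨h1, h2, h3⟩ | ⟨h1, h2, h3⟩)
    · exact ⟨fun h => by simp [h] at h3, h1, h2⟩
    · exact ⟨fun h => by simp [h] at h3, h2, h1⟩
  · rintro ⟨h1, h2, h3⟩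
    rcases lt_trichotomy (r a) (r b) with h | h | h
    · exact Or.inl ⟨h2, h3, h⟩
    · exact (h1 (this.1 h)).elim
    · exact Or.inr ⟨h3, h2, h⟩

theorem clique_conn {r : Fin p → ℕ} (hr : r.Injective) {T K : Finset (Fin p)} {a b : Fin p}
    (hab : a ≠ b) : (clique r T).Conn K a b ↔ a ∈ T ∧ b ∈ T := by
  constructor
  · have key : ∀ a b, a ≠ b → (clique r T).Conn K a b → a ∈ T := by
      rintro a b hab ⟨l, h1, h2, h3⟩
      obtain ⟨m, rfl⟩ := List.head?_eq_some_iff.1 h1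
      rcases m with _ | ⟨c, m⟩
      · exact (hab (by simpa using h2)).elim
      · have := h3.1
        rw [List.isChain_cons_cons] at this
        exact ((clique_neighbor hr).1 this.1).2.1
    exact fun h => ⟨key a b hab h, key b a hab.symm h.symm⟩
  · exact fun h => Conn.of_arrow ((clique_neighbor hr).2 ⟨hab, h⟩)

theorem clique_markovEquiv {r r' : Fin p → ℕ} (hr : r.Injective) (hr' : r'.Injective)
    (T : Finset (Fin p)) : (clique r T).MarkovEquiv (clique r' T) := by
  intro i j K hij _ _
  rw [dSep_iff, dSep_iff, clique_conn hr hij, clique_conn hr' hij]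

end DAG

/-- Möbius inversion on the lattice of finite subsets, in the form of existence. -/
theorem exists_eq_sum_powerset {α : Type*} [DecidableEq α] (m : Finset α → ℝ) :
    ∃ μ : Finset α → ℝ, ∀ T, m T = ∑ U ∈ T.powerset, μ U := by
  refine ⟨fun T => ∑ U ∈ T.powerset, (-1) ^ (T \ U).card * m U, fun T => ?_⟩
  induction T using Finset.induction generalizing m with
  | empty => simp
  | insert a T ha ih =>
    rw [Finset.sum_powerset_insert ha, ← ih m]
    have h2 : ∀ U ∈ T.powerset,
        ∑ V ∈ (insert a U).powerset, (-1 : ℝ) ^ (insert a U \ V).card * m V =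
        ∑ V ∈ U.powerset, (-1 : ℝ) ^ (U \ V).card * (m (insert a V) - m V) := by
      intro U hU
      have haU : a ∉ U := fun h => ha (Finset.mem_powerset.1 hU h)
      rw [Finset.sum_powerset_insert haU, ← Finset.sum_add_distrib]
      refine Finset.sum_congr rfl fun V hV => ?_
      have haV : a ∉ V := fun h => haU (Finset.mem_powerset.1 hV h)
      rw [Finset.insert_sdiff_of_notMem _ haV, Finset.card_insert_of_notMem (by simp [haU]),
        Finset.insert_sdiff_insert, Finset.sdiff_insert_of_notMem haU]
      ring
    rw [Finset.sum_congr rfl h2, ← ih fun V => m (insert a V) - m V]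
    ring

namespace DAG

variable {p : ℕ}

/-- Adding a last node `i` to a complete DAG on `S` changes a decomposable score by the
change of the `i`-th summand. -/
theorem score_clique_insert {s : DAG p → ℝ} {q : Fin p → Finset (Fin p) → ℝ}
    (hq : ∀ G : DAG p, s G = ∑ i, q i (G.pa i)) (hs : IsScoreEquivalent s) {i : Fin p}
    {S : Finset (Fin p)} (hi : i ∉ S) :
    s (clique Fin.val (insert i S)) - s (clique Fin.val S) = q i S - q i ∅ := by
  let r : Fin p → ℕ := fun a => if a = i then p else a
  have hr : r.Injective := by
    intro a b hab
    have ha := a.2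
    have hb := b.2
    simp only [r] at hab
    split_ifs at hab with h1 h2 h2
    · rw [h1, h2]
    · omega
    · omega
    · exact Fin.ext hab
  rw [hs _ _ (clique_markovEquiv Fin.val_injective hr _),
    hs _ _ (clique_markovEquiv Fin.val_injective hr S), hq, hq, ← Finset.sum_sub_distrib,
    Finset.sum_eq_single i]
  · congr 2
    · ext a
      have := a.2
      simp only [clique, Finset.mem_insert, true_or, if_true, Finset.mem_filter, r]
      by_cases hai : a = i
      · simp [hai, hi]
      · simp [hai]
    · simp [clique, hi]
  · intro b _ hb
    have : (clique r (insert i S)).pa b = (clique r S).pa b := by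
      ext a
      have := b.2
      simp only [clique, Finset.mem_insert, hb, false_or]
      by_cases hbS : b ∈ S
      · simp only [hbS, if_true, Finset.mem_filter, Finset.mem_insert]
        by_cases hai : a = i
        · simp [r, hai, hb, hi]
        · simp [hai]
      · simp [hbS]
    rw [this, sub_self]
  · simp

/-- A set has at most one sink. -/
theorem hasSink_indicator_sum (G : DAG p) (U : Finset (Fin p)) (x : ℝ) [Decidable (G.HasSink U)] :
    (∑ i, if i ∈ U ∧ U.erase i ⊆ G.pa i then x else 0) = if G.HasSink U then x else 0 := by
  have sub : ∀ i, U.erase i ⊆ G.pa i ↔ ∀ j ∈ U, j ≠ i → G.Arrow j i := by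
    intro i
    constructor
    · exact fun h j hj hji => h (Finset.mem_erase.2 ⟨hji, hj⟩)
    · intro h j hj
      exact h j (Finset.mem_of_mem_erase hj) (Finset.ne_of_mem_erase hj)
  split_ifs with h
  · obtain ⟨i, hi, h⟩ := h
    rw [Finset.sum_eq_single i]
    · rw [if_pos ⟨hi, (sub i).2 h⟩]
    · intro j _ hj
      rw [if_neg]
      rintro ⟨hjU, hj'⟩
      exact (h j hjU hj).not_symm ((sub j).1 hj' i hi hj.symm)
    · simp
  · refine Finset.sum_eq_zero fun i _ => if_neg ?_
    rintro ⟨hi, hi'⟩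
    exact h ⟨i, hi, (sub i).1 hi'⟩

/-- A decomposable score equivalent score is an affine function of the characteristic imset.
Its linear part is the Möbius inverse of the scores of the complete DAGs on sets of nodes. -/
theorem exists_linear_score {s : DAG p → ℝ} (hd : IsDecomposable s)
    (hs : IsScoreEquivalent s) : ∃ (w : ImsetSpace p →ₗ[ℝ] ℝ) (a : ℝ),
      ∀ G : DAG p, s G = w (charImset G) + a := by
  classical
  obtain ⟨q, hq⟩ := hd
  obtain ⟨μ, hμ⟩ := exists_eq_sum_powerset fun T => s (clique Fin.val T)
  refine ⟨∑ U : {S : Finset (Fin p) // 2 ≤ S.card}, μ U.1 • LinearMap.proj U, ∑ i, q i ∅,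
    fun G => ?_⟩
  have hsing : ∀ i, μ {i} = 0 := by
    intro i
    have h1 := score_clique_insert hq hs (Finset.notMem_empty i)
    rw [hμ, hμ] at h1
    rw [sub_self, Finset.sum_powerset_insert (Finset.notMem_empty i)] at h1
    simpa using h1
  have h1 : ∀ i, q i (G.pa i) = (∑ U, if i ∈ U ∧ U.erase i ⊆ G.pa i then μ U else 0) + q i ∅ := by
    intro i
    have hi : i ∉ G.pa i := fun h => Arrow.ne (G := G) h rfl
    have h2 := score_clique_insert hq hs hi
    rw [hμ, hμ, Finset.sum_powerset_insert hi, add_sub_cancel_left] at h2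
    rw [← Finset.sum_filter]
    have h3 : ∑ U with i ∈ U ∧ U.erase i ⊆ G.pa i, μ U =
        ∑ U ∈ (G.pa i).powerset, μ (insert i U) := by
      symm
      refine Finset.sum_bij' (fun U _ => insert i U) (fun U _ => U.erase i) ?_ ?_ ?_ ?_ ?_
      · intro U hU
        have := Finset.mem_powerset.1 hU
        have hiU : i ∉ U := fun h => hi (this h)
        simp [hiU, this]
      · intro U hU
        simpa using (Finset.mem_filter.1 hU).2.2
      · intro U hU
        have := Finset.mem_powerset.1 hU
        have hiU : i ∉ U := fun h => hi (this h)
        simp [hiU]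
      · intro U hU
        exact Finset.insert_erase (Finset.mem_filter.1 hU).2.1
      · intro U hU
        rfl
    rw [h3, h2]
    ring
  rw [hq, Finset.sum_congr rfl fun i _ => h1 i, Finset.sum_add_distrib, Finset.sum_comm]
  congr 1
  rw [Finset.sum_congr rfl fun U _ => hasSink_indicator_sum G U (μ U)]
  simp only [LinearMap.sum_apply, LinearMap.smul_apply, LinearMap.proj_apply, smul_eq_mul,
    charImset_apply, mul_ite, mul_one, mul_zero]
  rw [← Finset.sum_subtype (Finset.univ.filter fun S : Finset (Fin p) => 2 ≤ S.card) (by simp)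
    fun U => if G.HasSink U then μ U else 0]
  refine (Finset.sum_filter_of_ne fun U _ hU => ?_).symm
  rw [ite_ne_right_iff] at hU
  -- a one-element set is a sink of itself, but its Möbius coefficient vanishes
  by_contra hc
  have h0 : U.card ≠ 0 := Finset.card_ne_zero.2 hU.1.nonempty
  obtain ⟨i, rfl⟩ := Finset.card_eq_one.1 (by omega : U.card = 1)
  exact hU.2 (hsing i)

end DAG

/-! ### Faces, vertices and edges of polytopes -/

section Polytope

variable {ι : Type*}

/-- The linear functional with coefficients `c`. -/
noncomputable def coeffDual [Fintype ι] (c : ι → ℝ) : StrongDual ℝ (ι → ℝ) :=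
  LinearMap.toContinuousLinearMap (∑ i, c i • LinearMap.proj i)

theorem coeffDual_apply [Fintype ι] (c x : ι → ℝ) : coeffDual c x = ∑ i, c i * x i := by
  simp [coeffDual]

/-- The points of `V` that maximize a linear functional span an exposed face of `conv V`. -/
theorem isExposed_convexHull {V W : Set (ι → ℝ)} (l : StrongDual ℝ (ι → ℝ)) (m : ℝ)
    (hW : W ⊆ convexHull ℝ V) (hle : ∀ z ∈ V, l z ≤ m) (hWm : ∀ z ∈ W, l z = m)
    (hVW : ∀ z ∈ V, l z = m → z ∈ convexHull ℝ W) :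
    IsExposed ℝ (convexHull ℝ V) (convexHull ℝ W) := by
  rintro hne
  obtain ⟨x₀, hx₀⟩ := convexHull_nonempty_iff.1 hne
  have hsub : convexHull ℝ W ⊆ convexHull ℝ V :=
    convexHull_min hW (convex_convexHull ℝ V)
  have hA : ∀ z ∈ convexHull ℝ V, l z ≤ m ∧ (l z = m → z ∈ convexHull ℝ W) := by
    have : Convex ℝ {z | l z ≤ m ∧ (l z = m → z ∈ convexHull ℝ W)} := by
      rintro x ⟨hx1, hx2⟩ y ⟨hy1, hy2⟩ a b ha hb hab
      have e : l (a • x + b • y) = a * l x + b * l y := by simp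
      refine ⟨?_, fun h => ?_⟩
      · rw [e]
        calc a * l x + b * l y ≤ a * m + b * m := by gcongr
          _ = m := by rw [← add_mul, hab, one_mul]
      · rw [e] at h
        rcases ha.eq_or_lt with rfl | ha
        · obtain rfl : b = 1 := by linarith
          simpa using hy2 (by linarith)
        rcases hb.eq_or_lt with rfl | hb
        · obtain rfl : a = 1 := by linarith
          simpa using hx2 (by linarith)
        have e2 : a * (m - l x) + b * (m - l y) = 0 := by
          have : (a + b) * m = m := by rw [hab, one_mul]
          linarith
        have h1 := mul_nonneg ha.le (sub_nonneg.2 hx1)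
        have h2 := mul_nonneg hb.le (sub_nonneg.2 hy1)
        have h3 : a * (m - l x) = 0 := by linarith
        have h4 : b * (m - l y) = 0 := by linarith
        exact (convex_convexHull ℝ W)
          (hx2 (by have := (mul_eq_zero.1 h3).resolve_left ha.ne'; linarith))
          (hy2 (by have := (mul_eq_zero.1 h4).resolve_left hb.ne'; linarith)) ha.le hb.le hab
    exact convexHull_min (fun z hz => ⟨hle z hz, hVW z hz⟩) this
  have hB : ∀ z ∈ convexHull ℝ W, l z = m := by
    have : Convex ℝ {z | l z = m} := by
      rintro x (hx : l x = m) y (hy : l y = m) a b ha hb hab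
      change l (a • x + b • y) = m
      rw [map_add, map_smul, map_smul, hx, hy, smul_eq_mul, smul_eq_mul, ← add_mul, hab, one_mul]
    exact convexHull_min (fun z hz => hWm z hz) this
  refine ⟨l, Set.Subset.antisymm (fun x hx => ⟨hsub hx, fun y hy => ?_⟩) ?_⟩
  · rw [hB x hx]
    exact (hA y hy).1
  · rintro x ⟨hx, hx'⟩
    refine (hA x hx).2 (le_antisymm (hA x hx).1 ?_)
    rw [← hWm x₀ hx₀]
    exact hx' x₀ (hW hx₀)

theorem isPolytopeEdge_convexHull_pair {V : Set (ι → ℝ)} {x y : ι → ℝ}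
    (l : StrongDual ℝ (ι → ℝ)) (hx : x ∈ V) (hy : y ∈ V) (hxy : x ≠ y) (hl : l x = l y)
    (hle : ∀ z ∈ V, l z ≤ l x) (hV : ∀ z ∈ V, l z = l x → z ∈ convexHull ℝ {x, y}) :
    IsPolytopeEdge (convexHull ℝ V) (convexHull ℝ {x, y}) := by
  refine ⟨isExposed_convexHull l (l x) ?_ hle ?_ hV, ?_⟩
  · exact (Set.pair_subset hx hy).trans (subset_convexHull ℝ V)
  · rintro z (rfl | rfl)
    · rfl
    · exact hl.symm
  · rw [← direction_affineSpan, affineSpan_convexHull, direction_affineSpan,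
      vectorSpan_pair_rev]
    exact finrank_span_singleton (by simpa [sub_eq_zero] using hxy.symm)

theorem mem_exposedPoints_convexHull {V : Set (ι → ℝ)} {x : ι → ℝ}
    (l : StrongDual ℝ (ι → ℝ)) (hx : x ∈ V) (hV : ∀ z ∈ V, z ≠ x → l z < l x) :
    x ∈ (convexHull ℝ V).exposedPoints ℝ := by
  rw [mem_exposedPoints_iff_exposed_singleton, ← convexHull_singleton (𝕜 := ℝ) x]
  refine isExposed_convexHull l (l x) (by simpa using subset_convexHull ℝ V hx) ?_ (by simp) ?_
  · intro z hz
    by_cases h : z = x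
    · rw [h]
    · exact (hV z hz h).le
  · intro z hz h
    by_contra hc
    exact (hV z hz (by simpa using hc)).ne h

theorem IsExposed.mono_ambient {P Q F : Set (ι → ℝ)} (h : IsExposed ℝ P F) (hQ : Q ⊆ P)
    (hF : F ⊆ Q) : IsExposed ℝ Q F := by
  intro hne
  obtain ⟨l, hl⟩ := h hne
  refine ⟨l, Set.Subset.antisymm (fun x hx => ⟨hF hx, fun y hy => ?_⟩) ?_⟩
  · rw [hl] at hx
    exact hx.2 y (hQ hy)
  · rintro x ⟨hx, hx'⟩
    obtain ⟨x₀, hx₀⟩ := hne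
    rw [hl]
    refine ⟨hQ hx, fun y hy => ?_⟩
    have h0 := hF hx₀
    rw [hl] at hx₀
    exact (hx₀.2 y hy).trans (hx' x₀ h0)

/-! ### Edges of polytopes spanned by 0/1 vectors -/

variable {V : Set (ι → ℝ)} {x y : ι → ℝ}

theorem sign_mul_sub_nonneg (h01 : ∀ z ∈ V, ∀ i, z i = 0 ∨ z i = 1) (hx : x ∈ V)
    {z : ι → ℝ} (hz : z ∈ V) (i : ι) :
    0 ≤ (2 * x i - 1) * (x i - z i) ∧ (z i ≠ x i → (2 * x i - 1) * (x i - z i) = 1) := by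
  rcases h01 x hx i with h | h <;> rcases h01 z hz i with h' | h' <;> rw [h, h'] <;> norm_num

/-- To expose the segment between two 0/1 vectors `x` and `y`, it suffices to consider the
vectors that agree with both where `x` and `y` agree: a functional on the remaining coordinates
is dominated by a large multiple of one that enforces the agreement. -/
theorem isPolytopeEdge_of_coeff [Fintype ι] (h01 : ∀ z ∈ V, ∀ i, z i = 0 ∨ z i = 1)
    (hx : x ∈ V) (hy : y ∈ V) (hxy : x ≠ y) (D : Finset ι) (hD : ∀ i ∉ D, y i = x i)
    (c : ι → ℝ) (hc : ∑ i ∈ D, c i * x i = ∑ i ∈ D, c i * y i)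
    (h : ∀ z ∈ V, (∀ i ∉ D, z i = x i) → ∑ i ∈ D, c i * z i ≤ ∑ i ∈ D, c i * x i ∧
      (∑ i ∈ D, c i * z i = ∑ i ∈ D, c i * x i → z = x ∨ z = y)) :
    IsPolytopeEdge (convexHull ℝ V) (convexHull ℝ {x, y}) := by
  classical
  set B : ℝ := ∑ i ∈ D, |c i| with hB
  have hBz : ∀ z ∈ V, |∑ i ∈ D, c i * z i| ≤ B := by
    intro z hz
    refine (Finset.abs_sum_le_sum_abs _ _).trans (Finset.sum_le_sum fun i _ => ?_)
    rw [abs_mul]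
    rcases h01 z hz i with h | h <;> simp [h]
  have hB0 : 0 ≤ B := Finset.sum_nonneg fun i _ => abs_nonneg _
  -- two values of the functional on `D` differ by at most `2 * B`
  let c' : ι → ℝ := fun i => if i ∈ D then c i else (2 * B + 1) * (2 * x i - 1)
  have hc' : ∀ z : ι → ℝ, coeffDual c' x - coeffDual c' z =
      (∑ i ∈ D, c i * x i - ∑ i ∈ D, c i * z i) +
        (2 * B + 1) * ∑ i ∈ Dᶜ, (2 * x i - 1) * (x i - z i) := by
    intro z
    rw [coeffDual_apply, coeffDual_apply, ← Finset.sum_add_sum_compl D,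
      ← Finset.sum_add_sum_compl D, Finset.mul_sum, ← Finset.sum_sub_distrib]
    rw [add_sub_add_comm, ← Finset.sum_sub_distrib, ← Finset.sum_sub_distrib]
    congr 1
    · exact Finset.sum_congr rfl fun i hi => by simp [c', hi]
    · refine Finset.sum_congr rfl fun i hi => ?_
      simp only [c', Finset.mem_compl.1 hi, if_false]
      ring
  have hoff : ∀ z ∈ V, (¬ ∀ i ∉ D, z i = x i) → coeffDual c' z < coeffDual c' x := by
    intro z hz hne
    push Not at hne
    obtain ⟨i, hi, hne⟩ := hne
    have h1 : 1 ≤ ∑ i ∈ Dᶜ, (2 * x i - 1) * (x i - z i) := by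
      refine (sign_mul_sub_nonneg h01 hx hz i).2 hne |>.symm.le.trans ?_
      exact Finset.single_le_sum (f := fun i => (2 * x i - 1) * (x i - z i))
        (fun i _ => (sign_mul_sub_nonneg h01 hx hz i).1) (Finset.mem_compl.2 hi)
    have h2 := hc' z
    have h3 := abs_le.1 (hBz z hz)
    have h4 := abs_le.1 (hBz x hx)
    nlinarith
  have hon : ∀ z : ι → ℝ, (∀ i ∉ D, z i = x i) → coeffDual c' x - coeffDual c' z =
      ∑ i ∈ D, c i * x i - ∑ i ∈ D, c i * z i := by
    intro z hz
    have h0 : ∑ i ∈ Dᶜ, (2 * x i - 1) * (x i - z i) = 0 :=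
      Finset.sum_eq_zero fun i hi => by rw [hz i (Finset.mem_compl.1 hi), sub_self, mul_zero]
    rw [hc', h0, mul_zero, add_zero]
  refine isPolytopeEdge_convexHull_pair (coeffDual c') hx hy hxy ?_ ?_ ?_
  · have := hon y hD
    linarith
  · intro z hz
    by_cases hz' : ∀ i ∉ D, z i = x i
    · have := hon z hz'
      have := (h z hz hz').1
      linarith
    · exact (hoff z hz hz').le
  · intro z hz hzx
    by_cases hz' : ∀ i ∉ D, z i = x i
    · have := hon z hz'
      exact subset_convexHull ℝ _ ((h z hz hz').2 (by linarith))
    · exact absurd hzx (hoff z hz hz').ne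

/-- An edge between comparable 0/1 vectors `x ≤ y`, detected by one coordinate. -/
theorem isPolytopeEdge_of_le [Fintype ι] (h01 : ∀ z ∈ V, ∀ i, z i = 0 ∨ z i = 1)
    (hx : x ∈ V) (hy : y ∈ V) (hle : x ≤ y) {r : ι} (hxr : x r = 0) (hyr : y r = 1)
    (h : ∀ z ∈ V, (∀ i, x i = y i → z i = x i) → z r = 1 → z = y) :
    IsPolytopeEdge (convexHull ℝ V) (convexHull ℝ {x, y}) := by
  have hxy : x ≠ y := fun h => by rw [h, hyr] at hxr; norm_num at hxr
  classical
  -- on `D` the functional gives `r` the weight `|D| - 1` and the other coordinates the weight `-1`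
  set D : Finset ι := Finset.univ.filter fun i => x i ≠ y i with hD
  have hmem : ∀ i, i ∈ D ↔ x i ≠ y i := by simp [hD]
  have hDv : ∀ i ∈ D, x i = 0 ∧ y i = 1 := by
    intro i hi
    have h1 := hle i
    have h2 := (hmem i).1 hi
    rcases h01 x hx i with h | h <;> rcases h01 y hy i with h' | h' <;> rw [h, h'] at h1 h2
    · simp at h2
    · exact ⟨h, h'⟩
    · norm_num at h1
    · simp at h2
  have hr : r ∈ D := (hmem r).2 (by rw [hxr, hyr]; norm_num)
  have hsum : ∀ z : ι → ℝ, (∑ i ∈ D, (if i = r then ((D.erase r).card : ℝ) else -1) * z i) =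
      (D.erase r).card * z r - ∑ i ∈ D.erase r, z i := by
    intro z
    rw [← Finset.add_sum_erase D _ hr, if_pos rfl, sub_eq_add_neg, ← Finset.sum_neg_distrib]
    congr 1
    refine Finset.sum_congr rfl fun i hi => ?_
    rw [if_neg (Finset.ne_of_mem_erase hi)]
    ring
  have hx0 : ∑ i ∈ D.erase r, x i = 0 :=
    Finset.sum_eq_zero fun i hi => (hDv i (Finset.mem_of_mem_erase hi)).1
  have hy1 : ∑ i ∈ D.erase r, y i = (D.erase r).card := by
    rw [Finset.sum_congr rfl fun i hi => (hDv i (Finset.mem_of_mem_erase hi)).2]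
    simp
  refine isPolytopeEdge_of_coeff h01 hx hy hxy D (fun i hi => ?_)
    (fun i => if i = r then ((D.erase r).card : ℝ) else -1) ?_ ?_
  · by_contra hc
    exact hi ((hmem i).2 (Ne.symm hc))
  · rw [hsum, hsum, hx0, hy1, hxr, hyr]
    ring
  · intro z hz hzx
    have hzx' : ∀ i, x i = y i → z i = x i := fun i hi => hzx i fun hc => (hmem i).1 hc hi
    rw [hsum, hsum, hx0, hxr]
    have hnn : ∀ i ∈ D.erase r, 0 ≤ z i := fun i _ => by
      rcases h01 z hz i with h | h <;> rw [h]; norm_num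
    rcases h01 z hz r with hzr | hzr
    · rw [hzr]
      refine ⟨by simpa using Finset.sum_nonneg hnn, fun h0 => Or.inl ?_⟩
      have h0' : ∑ i ∈ D.erase r, z i = 0 := by linarith
      rw [Finset.sum_eq_zero_iff_of_nonneg hnn] at h0'
      funext i
      by_cases hi : i ∈ D
      · rw [(hDv i hi).1]
        by_cases hir : i = r
        · rw [hir, hzr]
        · exact h0' i (Finset.mem_erase.2 ⟨hir, hi⟩)
      · exact hzx i hi
    · have := h z hz hzx' hzr
      subst this
      rw [hy1, hyr]
      refine ⟨by simp, fun _ => Or.inr rfl⟩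

/-- An edge between 0/1 vectors, each of which is detected by one coordinate. -/
theorem isPolytopeEdge_of_detect [Fintype ι] (h01 : ∀ z ∈ V, ∀ i, z i = 0 ∨ z i = 1)
    (hx : x ∈ V) (hy : y ∈ V) {r t : ι} (hxr : x r = 0) (hyr : y r = 1)
    (hxt : x t = 1) (hyt : y t = 0)
    (h : ∀ z ∈ V, (∀ i, x i = y i → z i = x i) → z r = 1 → z = y)
    (h' : ∀ z ∈ V, (∀ i, x i = y i → z i = x i) → z t = 1 → z = x) :
    IsPolytopeEdge (convexHull ℝ V) (convexHull ℝ {x, y}) := by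
  have hxy : x ≠ y := fun h => by rw [h, hyr] at hxr; norm_num at hxr
  have hrt : r ≠ t := by
    rintro rfl
    rw [hxr] at hxt
    norm_num at hxt
  classical
  set D : Finset ι := Finset.univ.filter fun i => x i ≠ y i with hD
  have hmem : ∀ i, i ∈ D ↔ x i ≠ y i := by simp [hD]
  have hr : r ∈ D := (hmem r).2 (by rw [hxr, hyr]; norm_num)
  have ht : t ∈ D := (hmem t).2 (by rw [hxt, hyt]; norm_num)
  set D' := (D.erase r).erase t with hD'
  have ht' : t ∈ D.erase r := Finset.mem_erase.2 ⟨hrt.symm, ht⟩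
  -- the weights of `r` and `t` give `x` and `y` the value one
  set c : ι → ℝ := fun i => if i = r then 1 + ∑ i ∈ D', y i else
    if i = t then 1 + ∑ i ∈ D', x i else -1 with hcdef
  have hsum : ∀ z : ι → ℝ, (∑ i ∈ D, c i * z i) =
      (1 + ∑ i ∈ D', y i) * z r + (1 + ∑ i ∈ D', x i) * z t - ∑ i ∈ D', z i := by
    intro z
    rw [← Finset.add_sum_erase D _ hr, ← Finset.add_sum_erase _ _ ht', ← hD']
    have : ∑ i ∈ D', c i * z i = - ∑ i ∈ D', z i := by
      rw [← Finset.sum_neg_distrib]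
      refine Finset.sum_congr rfl fun i hi => ?_
      have h1 := Finset.ne_of_mem_erase hi
      have h2 := Finset.ne_of_mem_erase (Finset.mem_of_mem_erase hi)
      simp [hcdef, h1, h2]
    rw [this]
    simp only [hcdef, if_pos, hrt.symm, if_false]
    ring
  have vx : ∑ i ∈ D, c i * x i = 1 := by
    rw [hsum, hxr, hxt]
    ring
  have vy : ∑ i ∈ D, c i * y i = 1 := by
    rw [hsum, hyr, hyt]
    ring
  refine isPolytopeEdge_of_coeff h01 hx hy hxy D (fun i hi => ?_) c (vx.trans vy.symm) ?_
  · by_contra hc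
    exact hi ((hmem i).2 (Ne.symm hc))
  · intro z hz hzx
    have hzx' : ∀ i, x i = y i → z i = x i := fun i hi => hzx i fun hc => (hmem i).1 hc hi
    have hnn : 0 ≤ ∑ i ∈ D', z i := Finset.sum_nonneg fun i _ => by
      rcases h01 z hz i with h | h <;> rw [h]; norm_num
    rcases h01 z hz r with hzr | hzr
    · rcases h01 z hz t with hzt | hzt
      · rw [vx, hsum, hzr, hzt]
        exact ⟨by linarith, fun _ => by linarith⟩
      · rw [h' z hz hzx' hzt]
        exact ⟨le_rfl, fun _ => Or.inl rfl⟩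
    · rw [h z hz hzx' hzr]
      exact ⟨(vy.trans vx.symm).le, fun _ => Or.inr rfl⟩

end Polytope

/-! ### Edges of the characteristic imset polytope -/

namespace DAG

variable {p : ℕ} {G H F : DAG p}

theorem charImset_eq_zero_or_one (G : DAG p) (S : {S : Finset (Fin p) // 2 ≤ S.card}) :
    charImset G S = 0 ∨ charImset G S = 1 := by
  by_cases h : G.HasSink S.1
  · exact Or.inr (charImset_eq_one.2 h)
  · exact Or.inl (charImset_eq_zero.2 h)

theorem hasSink_pair {a b : Fin p} (hab : a ≠ b) : G.HasSink {a, b} ↔ G.Neighbor a b := by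
  constructor
  · rintro ⟨i, hi, h⟩
    simp only [Finset.mem_insert, Finset.mem_singleton] at hi
    rcases hi with rfl | rfl
    · exact Or.inr (h b (by simp) hab.symm)
    · exact Or.inl (h a (by simp) hab)
  · rintro (h | h)
    · refine ⟨b, by simp, fun j hj hjb => ?_⟩
      simp only [Finset.mem_insert, Finset.mem_singleton] at hj
      rwa [hj.resolve_right hjb]
    · refine ⟨a, by simp, fun j hj hja => ?_⟩
      simp only [Finset.mem_insert, Finset.mem_singleton] at hj
      rwa [hj.resolve_left hja]

theorem Neighbor.arrow_of_path {a b c : Fin p} (h : G.Neighbor a c) (h1 : G.Arrow a b)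
    (h2 : G.Arrow b c) : G.Arrow a c :=
  h.resolve_right fun h3 => G.acyclic a (((Relation.TransGen.single h1).tail h2).tail h3)

/-- The characteristic imset of `F` agrees with those of `G` and `H` where these agree. -/
def Agrees (F G H : DAG p) : Prop :=
  ∀ S, (G.HasSink S ↔ H.HasSink S) → (F.HasSink S ↔ G.HasSink S)

theorem Agrees.symm (h : Agrees F G H) : Agrees F H G := fun S hS => (h S hS.symm).trans hS.symm

theorem agrees_left (G H : DAG p) : Agrees G G H := fun _ _ => Iff.rfl

/-- Only sets with at least two elements matter for agreement. -/
theorem agrees_of_charImset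
    (h : ∀ S, charImset G S = charImset H S → charImset F S = charImset G S) :
    Agrees F G H := by
  intro S hS
  by_cases hS2 : 2 ≤ S.card
  · exact charImset_eq_charImset_iff.1 (h ⟨S, hS2⟩ (charImset_eq_charImset_iff.2 hS))
  · rcases Nat.lt_or_ge 0 S.card with h0 | h0
    · obtain ⟨i, rfl⟩ := Finset.card_eq_one.1 (by omega : S.card = 1)
      have : ∀ G : DAG p, G.HasSink {i} := fun G => ⟨i, by simp, by simp⟩
      simp [this]
    · obtain rfl := Finset.card_eq_zero.1 (by omega : S.card = 0)
      have : ∀ G : DAG p, ¬ G.HasSink ∅ := fun G h => by simpa using h.nonempty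
      simp [this]

theorem mem_imsets_zero_or_one :
    ∀ z ∈ {x | ∃ G : DAG p, x = charImset G}, ∀ S, z S = 0 ∨ z S = 1 := by
  rintro _ ⟨G, rfl⟩ S
  exact G.charImset_eq_zero_or_one S

theorem two_le_card {i j : Fin p} (hij : i ≠ j) {S : Finset (Fin p)} (hi : i ∈ S) (hj : j ∈ S) :
    2 ≤ S.card := by
  have := Finset.card_le_card (Finset.insert_subset hi (Finset.singleton_subset_iff.2 hj))
  rwa [Finset.card_pair hij] at this

theorem isPolytopeEdge_of_hasSink_imp (hle : ∀ S, G.HasSink S → H.HasSink S)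
    {R : Finset (Fin p)} (hR : 2 ≤ R.card) (hG : ¬ G.HasSink R) (hH : H.HasSink R)
    (h : ∀ F, Agrees F G H → F.HasSink R → ∀ S, F.HasSink S ↔ H.HasSink S) :
    IsPolytopeEdge (CIM p) (convexHull ℝ {charImset G, charImset H}) := by
  refine isPolytopeEdge_of_le mem_imsets_zero_or_one ⟨G, rfl⟩ ⟨H, rfl⟩ ?_
    (r := ⟨R, hR⟩) (charImset_eq_zero.2 hG) (charImset_eq_one.2 hH) ?_
  · intro S
    by_cases hS : G.HasSink S.1
    · rw [charImset_eq_one.2 hS, charImset_eq_one.2 (hle _ hS)]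
    · rw [charImset_eq_zero.2 hS]
      rcases H.charImset_eq_zero_or_one S with h | h <;> rw [h]
      norm_num
  · rintro _ ⟨F, rfl⟩ hF hFR
    funext S
    exact charImset_eq_charImset_iff.2
      (h F (agrees_of_charImset hF) (charImset_eq_one.1 hFR) S.1)

theorem isPolytopeEdge_of_hasSink_detect {R T : Finset (Fin p)} (hR : 2 ≤ R.card)
    (hT : 2 ≤ T.card) (hGR : ¬ G.HasSink R) (hHR : H.HasSink R) (hGT : G.HasSink T)
    (hHT : ¬ H.HasSink T)
    (h : ∀ F, Agrees F G H → F.HasSink R → ∀ S, F.HasSink S ↔ H.HasSink S)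
    (h' : ∀ F, Agrees F G H → F.HasSink T → ∀ S, F.HasSink S ↔ G.HasSink S) :
    IsPolytopeEdge (CIM p) (convexHull ℝ {charImset G, charImset H}) := by
  refine isPolytopeEdge_of_detect mem_imsets_zero_or_one ⟨G, rfl⟩ ⟨H, rfl⟩
    (r := ⟨R, hR⟩) (t := ⟨T, hT⟩) (charImset_eq_zero.2 hGR) (charImset_eq_one.2 hHR)
    (charImset_eq_one.2 hGT) (charImset_eq_zero.2 hHT) ?_ ?_
  · rintro _ ⟨F, rfl⟩ hF hFR
    funext S
    exact charImset_eq_charImset_iff.2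
      (h F (agrees_of_charImset hF) (charImset_eq_one.1 hFR) S.1)
  · rintro _ ⟨F, rfl⟩ hF hFT
    funext S
    exact charImset_eq_charImset_iff.2
      (h' F (agrees_of_charImset hF) (charImset_eq_one.1 hFT) S.1)

/-! ### Adding an arrow -/

section Addition

variable {i j : Fin p}

theorem IsArrowAddition.hasSink_mono (h : G.IsArrowAddition H i j) {S : Finset (Fin p)}
    (hS : G.HasSink S) : H.HasSink S := by
  obtain ⟨k, hk, hk'⟩ := hS
  exact ⟨k, hk, fun a ha hak => (h.2.2 a k).2 (Or.inl (hk' a ha hak))⟩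

/-- The sets that gain a sink when `i → j` is added consist of `i`, `j` and parents of `j`. -/
theorem IsArrowAddition.of_hasSink (h : G.IsArrowAddition H i j) {S : Finset (Fin p)}
    (hS : H.HasSink S) (hG : ¬ G.HasSink S) :
    i ∈ S ∧ j ∈ S ∧ ∀ t ∈ S, t ≠ i → t ≠ j → G.Arrow t j := by
  obtain ⟨k, hk, hk'⟩ := hS
  obtain rfl : k = j := by
    by_contra hkj
    refine hG ⟨k, hk, fun a ha hak => ((h.2.2 a k).1 (hk' a ha hak)).resolve_right ?_⟩
    exact fun h' => hkj h'.2
  have har : ∀ a ∈ S, a ≠ k → a ≠ i → G.Arrow a k := fun a ha hak hai =>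
    ((h.2.2 a k).1 (hk' a ha hak)).resolve_right fun h' => hai h'.1
  refine ⟨?_, hk, fun t ht hti htk => har t ht htk hti⟩
  by_contra hi
  exact hG ⟨k, hk, fun a ha hak => har a ha hak fun hai => hi (hai ▸ ha)⟩

/-- The coordinate `R` recognizes `H`, where `R` consists of `i`, `j` and the parents of `j` that
are not joined to `i`. If such parents exist, only `j` can be a sink of `R`; otherwise `i` is
joined to all parents of `j`, and it suffices that `i` and `j` are joined. -/
theorem IsArrowAddition.hasSink_iff (h : G.IsArrowAddition H i j) {R : Finset (Fin p)}
    (hR : ∀ t, t ∈ R ↔ t = i ∨ t = j ∨ (G.Arrow t j ∧ ¬ G.Neighbor i t))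
    (hF : Agrees F G H) (hFR : F.HasSink R) (S : Finset (Fin p)) :
    F.HasSink S ↔ H.HasSink S := by
  have hij : i ≠ j := h.1
  have nbr : ∀ t, t ≠ i → t ≠ j → (F.Neighbor i t ↔ G.Neighbor i t) := by
    intro t hti htj
    rw [← hasSink_pair hti.symm, ← hasSink_pair hti.symm]
    refine hF _ ⟨fun h' => h.hasSink_mono h', fun h' => ?_⟩
    by_contra hG
    have := (h.of_hasSink h' hG).2.1
    simp [hij.symm, htj.symm] at this
  have key : F.Neighbor i j ∧ ∀ t, G.Arrow t j → ¬ G.Neighbor i t → F.Arrow t j ∧ F.Arrow i j := by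
    obtain ⟨k, hk, hk'⟩ := hFR
    by_cases he : ∃ t, G.Arrow t j ∧ ¬ G.Neighbor i t
    · obtain ⟨t, htj, hit⟩ := he
      have hti : t ≠ i := by
        rintro rfl
        exact h.2.1 (Or.inl htj)
      obtain rfl : k = j := by
        rcases (hR k).1 hk with rfl | rfl | ⟨hkj, hik⟩
        · exact (hit ((nbr t hti htj.ne).1
            (Or.inr (hk' t ((hR t).2 (Or.inr (Or.inr ⟨htj, hit⟩))) hti)))).elim
        · rfl
        · have hki : k ≠ i := by
            rintro rfl
            exact h.2.1 (Or.inl hkj)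
          exact (hik ((nbr k hki hkj.ne).1
            (Or.inl (hk' i ((hR i).2 (Or.inl rfl)) hki.symm)))).elim
      have hik := hk' i ((hR i).2 (Or.inl rfl)) hij
      exact ⟨Or.inl hik, fun u huk hiu =>
        ⟨hk' u ((hR u).2 (Or.inr (Or.inr ⟨huk, hiu⟩))) huk.ne, hik⟩⟩
    · refine ⟨?_, fun t ht hit => (he ⟨t, ht, hit⟩).elim⟩
      rcases (hR k).1 hk with rfl | rfl | hk
      · exact Or.inr (hk' j ((hR j).2 (Or.inr (Or.inl rfl))) hij.symm)
      · exact Or.inl (hk' i ((hR i).2 (Or.inl rfl)) hij)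
      · exact (he ⟨k, hk⟩).elim
  obtain ⟨hnij, key⟩ := key
  by_cases hGH : G.HasSink S ↔ H.HasSink S
  · exact (hF S hGH).trans hGH
  have hHS : H.HasSink S := by
    by_contra hc
    exact hGH ⟨fun h' => h.hasSink_mono h', fun h' => (hc h').elim⟩
  have hGS : ¬ G.HasSink S := fun hc => hGH ⟨fun _ => hHS, fun _ => hc⟩
  refine ⟨fun _ => hHS, fun _ => ?_⟩
  obtain ⟨hi, hj, hT⟩ := h.of_hasSink hHS hGS
  have hGi : G.HasSink (S.erase i) := ⟨j, Finset.mem_erase.2 ⟨hij.symm, hj⟩, fun t ht htj =>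
    hT t (Finset.mem_of_mem_erase ht) (Finset.ne_of_mem_erase ht) htj⟩
  obtain ⟨x, hx, hx'⟩ := (hF _ ⟨fun h' => h.hasSink_mono h', fun _ => hGi⟩).2 hGi
  have hxi := Finset.ne_of_mem_erase hx
  have hxS := Finset.mem_of_mem_erase hx
  have hx'' : ∀ t ∈ S, t ≠ i → t ≠ x → F.Arrow t x := fun t ht hti htx =>
    hx' t (Finset.mem_erase.2 ⟨hti, ht⟩) htx
  -- if `j → i` in `F`, then every other node of `S` is joined to `i`
  have hall : F.Arrow j i → ∀ t ∈ S, t ≠ i → F.Neighbor i t := by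
    intro hji t ht hti
    by_cases htj : t = j
    · rw [htj]
      exact hnij
    rw [nbr t hti htj]
    by_contra hc
    exact (key t (hT t ht hti htj) hc).2.not_symm hji
  by_cases hxj : x = j
  · subst hxj
    rcases hnij with hix | hxi'
    · refine ⟨x, hj, fun t ht htx => ?_⟩
      by_cases hti : t = i
      · rwa [hti]
      · exact hx'' t ht hti htx
    · refine ⟨i, hi, fun t ht hti => ?_⟩
      by_cases htx : t = x
      · rwa [htx]
      · exact (hall hxi' t ht hti).symm.arrow_of_path (hx'' t ht hti htx) hxi'
  · have hjx := hx'' j hj hij.symm (Ne.symm hxj)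
    have hnix : F.Neighbor i x := by
      rw [nbr x hxi hxj]
      by_contra hc
      exact (key x (hT x hxS hxi hxj) hc).1.not_symm hjx
    rcases hnix with hix | hxi'
    · refine ⟨x, hxS, fun t ht htx => ?_⟩
      by_cases hti : t = i
      · rwa [hti]
      · exact hx'' t ht hti htx
    · have hji : F.Arrow j i := hnij.symm.arrow_of_path hjx hxi'
      refine ⟨i, hi, fun t ht hti => ?_⟩
      by_cases htx : t = x
      · rwa [htx]
      · exact (hall hji t ht hti).symm.arrow_of_path (hx'' t ht hti htx) hxi'

theorem IsArrowAddition.isPolytopeEdge (h : G.IsArrowAddition H i j) :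
    IsPolytopeEdge (CIM p) (convexHull ℝ {charImset G, charImset H}) := by
  classical
  let R : Finset (Fin p) :=
    Finset.univ.filter fun t => t = i ∨ t = j ∨ (G.Arrow t j ∧ ¬ G.Neighbor i t)
  have hR : ∀ t, t ∈ R ↔ t = i ∨ t = j ∨ (G.Arrow t j ∧ ¬ G.Neighbor i t) := by simp [R]
  have hi : i ∈ R := (hR i).2 (Or.inl rfl)
  have hj : j ∈ R := (hR j).2 (Or.inr (Or.inl rfl))
  refine isPolytopeEdge_of_hasSink_imp (fun S => h.hasSink_mono)
    (two_le_card h.1 hi hj) (fun hG => ?_)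
    ⟨j, hj, fun t ht htj => ?_⟩ fun F hF => h.hasSink_iff hR hF
  · -- otherwise the imset of `G` would be that of `H`, although `i` and `j` are not joined in `G`
    refine h.2.1 ((hasSink_pair h.1).1 ((h.hasSink_iff hR (agrees_left G H) hG _).2 ?_))
    exact (hasSink_pair h.1).2 (Or.inl ((h.2.2 i j).2 (Or.inr ⟨rfl, rfl⟩)))
  · rcases (hR t).1 ht with rfl | rfl | ht
    · exact (h.2.2 t j).2 (Or.inr ⟨rfl, rfl⟩)
    · exact (htj rfl).elim
    · exact (h.2.2 t j).2 (Or.inl ht.1)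

end Addition

/-! ### Reversing an arrow -/

section Reversal

variable {i j : Fin p}

theorem IsArrowReversal.symm (h : G.IsArrowReversal H i j) : H.IsArrowReversal G j i := by
  have hji : H.Arrow j i := (h.2 j i).2 (Or.inr ⟨rfl, rfl⟩)
  refine ⟨hji, fun a b => ?_⟩
  rw [h.2 a b]
  constructor
  · intro hab
    by_cases he : a = i ∧ b = j
    · exact Or.inr he
    · refine Or.inl ⟨Or.inl ⟨hab, he⟩, ?_⟩
      rintro ⟨rfl, rfl⟩
      exact h.1.not_symm hab
  · rintro (⟨⟨hab, -⟩ | hab, h'⟩ | ⟨rfl, rfl⟩)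
    · exact hab
    · exact (h' hab).elim
    · exact h.1

theorem IsArrowReversal.neighbor_iff (h : G.IsArrowReversal H i j) {a b : Fin p} :
    H.Neighbor a b ↔ G.Neighbor a b := by
  have key : ∀ {G H : DAG p} {i j : Fin p}, G.IsArrowReversal H i j → ∀ {a b : Fin p},
      H.Neighbor a b → G.Neighbor a b := by
    intro G H i j h a b hab
    unfold Neighbor at hab
    rw [h.2, h.2] at hab
    rcases hab with (hab | ⟨rfl, rfl⟩) | (hab | ⟨rfl, rfl⟩)
    · exact Or.inl hab.1
    · exact Or.inr h.1
    · exact Or.inr hab.1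
    · exact Or.inl h.1
  exact ⟨key h, key h.symm⟩

/-- The sets that gain a sink when `i → j` is reversed consist of `i`, `j` and parents of `i`,
not all of them parents of `j`. -/
theorem IsArrowReversal.of_hasSink (h : G.IsArrowReversal H i j) {S : Finset (Fin p)}
    (hS : H.HasSink S) (hG : ¬ G.HasSink S) :
    i ∈ S ∧ j ∈ S ∧ (∀ t ∈ S, t ≠ i → t ≠ j → G.Arrow t i) ∧
      ∃ t ∈ S, t ≠ i ∧ t ≠ j ∧ ¬ G.Arrow t j := by
  obtain ⟨k, hk, hk'⟩ := hS
  obtain rfl : k = i := by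
    by_contra hki
    refine hG ⟨k, hk, fun a ha hak => (((h.2 a k).1 (hk' a ha hak)).resolve_right ?_).1⟩
    exact fun h' => hki h'.2
  have har : ∀ a ∈ S, a ≠ k → a ≠ j → G.Arrow a k := fun a ha hak haj =>
    (((h.2 a k).1 (hk' a ha hak)).resolve_right fun h' => haj h'.1).1
  have hj : j ∈ S := by
    by_contra hj
    exact hG ⟨k, hk, fun a ha hak => har a ha hak fun haj => hj (haj ▸ ha)⟩
  refine ⟨hk, hj, fun t ht htk htj => har t ht htk htj, ?_⟩
  by_contra hc
  push Not at hc
  refine hG ⟨j, hj, fun t ht htj => ?_⟩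
  by_cases htk : t = k
  · rw [htk]
    exact h.1
  · exact hc t ht htk htj

/-- If a parent of `i` other than `j` is not a parent of `j`, then it is not joined to `j`. -/
theorem IsArrowReversal.not_neighbor (h : G.IsArrowReversal H i j) {a : Fin p}
    (hai : G.Arrow a i) (haj : ¬ G.Arrow a j) : ¬ G.Neighbor a j := by
  rintro (h' | h')
  · exact haj h'
  · exact G.acyclic i (((Relation.TransGen.single h.1).tail h').tail hai)

theorem IsArrowReversal.arrow_iff (h : G.IsArrowReversal H i j) {a b : Fin p}
    (h1 : ¬ (a = i ∧ b = j)) (h2 : ¬ (a = j ∧ b = i)) : H.Arrow a b ↔ G.Arrow a b := by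
  rw [h.2]
  tauto

/-- The coordinate `R` recognizes `H`, where `R` consists of `i`, `j` and the parents of `i` that
are not parents of `j`, if there are such parents: they are not joined to `j`, so that only `i`
can be a sink of `R`. -/
theorem IsArrowReversal.hasSink_iff (h : G.IsArrowReversal H i j) {R : Finset (Fin p)}
    (hR : ∀ t, t ∈ R ↔ t = i ∨ t = j ∨ (G.Arrow t i ∧ ¬ G.Arrow t j))
    (hne : ∃ t, G.Arrow t i ∧ ¬ G.Arrow t j)
    (hF : Agrees F G H) (hFR : F.HasSink R) (S : Finset (Fin p)) :
    F.HasSink S ↔ H.HasSink S := by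
  have hij : i ≠ j := h.1.ne
  have nbr : ∀ a b, F.Neighbor a b ↔ G.Neighbor a b := by
    intro a b
    by_cases hab : a = b
    · subst hab
      exact ⟨fun h => (h.ne rfl).elim, fun h => (h.ne rfl).elim⟩
    rw [← hasSink_pair hab, ← hasSink_pair hab]
    refine hF _ ?_
    rw [hasSink_pair hab, hasSink_pair hab, h.neighbor_iff]
  obtain ⟨hji, hA⟩ : F.Arrow j i ∧ ∀ t, G.Arrow t i → ¬ G.Arrow t j → F.Arrow t i := by
    obtain ⟨k, hk, hk'⟩ := hFR
    obtain ⟨a, hai, haj⟩ := hne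
    have hjR := (hR j).2 (Or.inr (Or.inl rfl))
    have hne' : a ≠ j := by
      rintro rfl
      exact h.1.not_symm hai
    rcases (hR k).1 hk with rfl | rfl | ⟨hki, hkj⟩
    · refine ⟨hk' j hjR hij.symm, fun t hti htj => ?_⟩
      exact hk' t ((hR t).2 (Or.inr (Or.inr ⟨hti, htj⟩))) hti.ne
    · exact (h.not_neighbor hai haj ((nbr _ _).1
        (Or.inl (hk' a ((hR a).2 (Or.inr (Or.inr ⟨hai, haj⟩))) hne')))).elim
    · have hkj' : j ≠ k := by
        rintro rfl
        exact h.1.not_symm hki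
      exact (h.not_neighbor hki hkj ((nbr _ _).1 (Or.inr (hk' j hjR hkj')))).elim
  by_cases hGH : G.HasSink S ↔ H.HasSink S
  · exact (hF S hGH).trans hGH
  by_cases hHS : H.HasSink S
  · have hGS : ¬ G.HasSink S := fun hc => hGH ⟨fun _ => hHS, fun _ => hc⟩
    refine ⟨fun _ => hHS, fun _ => ?_⟩
    obtain ⟨hi, hj, hT, -⟩ := h.of_hasSink hHS hGS
    have hiS : i ∈ S.erase j := Finset.mem_erase.2 ⟨hij, hi⟩
    have hGj : G.HasSink (S.erase j) := ⟨i, hiS, fun t ht hti =>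
      hT t (Finset.mem_of_mem_erase ht) hti (Finset.ne_of_mem_erase ht)⟩
    have hHj : H.HasSink (S.erase j) := ⟨i, hiS, fun t ht hti =>
      (h.arrow_iff (fun h' => hti h'.1) fun h' => Finset.ne_of_mem_erase ht h'.1).2
        (hT t (Finset.mem_of_mem_erase ht) hti (Finset.ne_of_mem_erase ht))⟩
    obtain ⟨x, hx, hx'⟩ := (hF _ ⟨fun _ => hHj, fun _ => hGj⟩).2 hGj
    have hxj := Finset.ne_of_mem_erase hx
    have hxS := Finset.mem_of_mem_erase hx
    have hx'' : ∀ t ∈ S, t ≠ j → t ≠ x → F.Arrow t x := fun t ht htj htx =>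
      hx' t (Finset.mem_erase.2 ⟨htj, ht⟩) htx
    refine ⟨x, hxS, fun t ht htx => ?_⟩
    by_cases htj : t = j
    · rw [htj]
      by_cases hxi : x = i
      · rwa [hxi]
      have hix := hx'' i hi hij (Ne.symm hxi)
      have hxj' : G.Arrow x j := by
        by_contra hc
        exact hix.not_symm (hA x (hT x hxS hxi hxj) hc)
      exact ((nbr j x).2 (Or.inr hxj')).arrow_of_path hji hix
    · exact hx'' t ht htj htx
  · have hGS : G.HasSink S := by
      by_contra hc
      exact hGH ⟨fun h => (hc h).elim, fun h => (hHS h).elim⟩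
    refine ⟨fun hFS => ?_, fun h => (hHS h).elim⟩
    exfalso
    obtain ⟨hj, hi, hT, b, hb, hbj, hbi, hbi'⟩ := h.symm.of_hasSink hGS hHS
    have hT' : ∀ t ∈ S, t ≠ i → t ≠ j → G.Arrow t j := fun t ht hti htj =>
      (h.arrow_iff (fun h' => hti h'.1) fun h' => htj h'.1).1 (hT t ht htj hti)
    have hbj' : H.Arrow b j := hT b hb hbj hbi
    have hbn : ¬ G.Neighbor b i := by
      rw [← h.neighbor_iff]
      exact h.symm.not_neighbor hbj' hbi'
    obtain ⟨k, hk, hk'⟩ := hFS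
    have hki : k ≠ i := by
      rintro rfl
      exact hbn ((nbr b k).1 (Or.inl (hk' b hb hbi)))
    have hkj : k ≠ j := by
      rintro rfl
      exact hji.not_symm (hk' i hi hij)
    have hik := hk' i hi hki.symm
    have hkb : k ≠ b := by
      rintro rfl
      exact hbn ((nbr k i).1 (Or.inr hik))
    have hki' : G.Arrow k i := by
      by_contra hc
      have hkHi : ¬ H.Arrow k i := by
        rwa [h.arrow_iff (fun h' => hki h'.1) fun h' => hkj h'.1]
      refine h.symm.not_neighbor (hT k hk hkj hki) hkHi ?_
      rw [h.neighbor_iff, ← nbr]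
      exact Or.inr hik
    -- the v-structure `i → k ← b` of `F` is not in `G`, where `k → i`
    have hbk := hk' b hb hkb.symm
    have hFk : F.HasSink {i, b, k} := by
      refine ⟨k, by simp, fun t ht htk => ?_⟩
      simp only [Finset.mem_insert, Finset.mem_singleton] at ht
      rcases ht with rfl | rfl | rfl
      · exact hik
      · exact hbk
      · exact (htk rfl).elim
    have hGk : ¬ G.HasSink {i, b, k} := by
      rintro ⟨x, hx, hx'⟩
      simp only [Finset.mem_insert, Finset.mem_singleton] at hx
      rcases hx with rfl | rfl | rfl
      · exact hbn (Or.inl (hx' b (by simp) hbi))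
      · exact hbn (Or.inr (hx' i (by simp) hbi.symm))
      · exact hki'.not_symm (hx' i (by simp) hki.symm)
    refine hGk ((hF _ ⟨fun h' => (hGk h').elim, fun h' => ?_⟩).1 hFk)
    by_contra hc
    have := (h.of_hasSink h' hc).2.1
    simp [hij.symm, hbj.symm, hkj.symm] at this

theorem IsArrowReversal.isPolytopeEdge (h : G.IsArrowReversal H i j)
    (hne : charImset G ≠ charImset H) :
    IsPolytopeEdge (CIM p) (convexHull ℝ {charImset G, charImset H}) := by
  classical
  have hdiff : ¬ ∀ S, G.HasSink S ↔ H.HasSink S := fun hc =>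
    hne (funext fun S => charImset_eq_charImset_iff.2 (hc S.1))
  have exR : ∀ {G H : DAG p} {i j : Fin p}, G.IsArrowReversal H i j →
      (¬ ∀ S, G.HasSink S ↔ H.HasSink S) → (∃ t, G.Arrow t i ∧ ¬ G.Arrow t j) →
      ∃ R : Finset (Fin p), 2 ≤ R.card ∧ ¬ G.HasSink R ∧ H.HasSink R ∧
        ∀ F, Agrees F G H → F.HasSink R → ∀ S, F.HasSink S ↔ H.HasSink S := by
    intro G H i j h hdiff hA
    let R : Finset (Fin p) :=
      Finset.univ.filter fun t => t = i ∨ t = j ∨ (G.Arrow t i ∧ ¬ G.Arrow t j)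
    have hR : ∀ t, t ∈ R ↔ t = i ∨ t = j ∨ (G.Arrow t i ∧ ¬ G.Arrow t j) := by simp [R]
    have hi : i ∈ R := (hR i).2 (Or.inl rfl)
    have hj : j ∈ R := (hR j).2 (Or.inr (Or.inl rfl))
    refine ⟨R, two_le_card h.1.ne hi hj,
      fun hG => hdiff (h.hasSink_iff hR hA (agrees_left G H) hG),
      ⟨i, hi, fun t ht hti => ?_⟩, fun F hF => h.hasSink_iff hR hA hF⟩
    rcases (hR t).1 ht with rfl | rfl | ht
    · exact (hti rfl).elim
    · exact h.symm.1
    · refine (h.arrow_iff (fun h' => hti h'.1) fun h' => ?_).2 ht.1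
      rw [h'.1] at ht
      exact h.1.not_symm ht.1
  have hle : ∀ {G H : DAG p} {i j : Fin p}, G.IsArrowReversal H i j →
      (¬ ∃ t, G.Arrow t i ∧ ¬ G.Arrow t j) → ∀ S, H.HasSink S → G.HasSink S := by
    intro G H i j h hA S hS
    by_contra hc
    obtain ⟨-, -, h1, t, ht, hti, htj, htj'⟩ := h.of_hasSink hS hc
    exact hA ⟨t, h1 t ht hti htj, htj'⟩
  have hdiff' : ¬ ∀ S, H.HasSink S ↔ G.HasSink S := fun hc => hdiff fun S => (hc S).symm
  by_cases hA : ∃ t, G.Arrow t i ∧ ¬ G.Arrow t j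
  · obtain ⟨R, hR, hGR, hHR, hR'⟩ := exR h hdiff hA
    by_cases hB : ∃ t, H.Arrow t j ∧ ¬ H.Arrow t i
    · obtain ⟨T, hT, hHT, hGT, hT'⟩ := exR h.symm hdiff' hB
      exact isPolytopeEdge_of_hasSink_detect hR hT hGR hHR hGT hHT hR'
        fun F hF => hT' F hF.symm
    · exact isPolytopeEdge_of_hasSink_imp (hle h.symm hB) hR hGR hHR hR'
  · by_cases hB : ∃ t, H.Arrow t j ∧ ¬ H.Arrow t i
    · obtain ⟨T, hT, hHT, hGT, hT'⟩ := exR h.symm hdiff' hB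
      rw [Set.pair_comm]
      exact isPolytopeEdge_of_hasSink_imp (hle h hA) hT hHT hGT hT'
    · exact (hdiff fun S => ⟨hle h.symm hB S, hle h hA S⟩).elim

end Reversal

/-! ### Vertices, and the face of the DAGs below an undirected graph -/

theorem charImset_mem_exposedPoints (G : DAG p) : charImset G ∈ (CIM p).exposedPoints ℝ := by
  refine mem_exposedPoints_convexHull (coeffDual fun S => 2 * charImset G S - 1) ⟨G, rfl⟩ ?_
  intro z hz hne
  obtain ⟨S, hS⟩ : ∃ S, z S ≠ charImset G S := Function.ne_iff.1 hne
  rw [← sub_pos, coeffDual_apply, coeffDual_apply, ← Finset.sum_sub_distrib]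
  have h0 := sign_mul_sub_nonneg mem_imsets_zero_or_one
    (show charImset G ∈ {x | ∃ G : DAG p, x = charImset G} from ⟨G, rfl⟩) hz
  refine Finset.sum_pos' (fun T _ => ?_) ⟨S, Finset.mem_univ _, ?_⟩
  · rw [← mul_sub]
    exact (h0 T).1
  · rw [← mul_sub, (h0 S).2 hS]
    exact one_pos

theorem CIMBelow_subset (K : SimpleGraph (Fin p)) : CIMBelow K ⊆ CIM p :=
  convexHull_mono fun _ ⟨G, _, h⟩ => ⟨G, h⟩

/-- The sum of the coordinates of the pairs that are not joined in `K` vanishes exactly on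
the imsets of the DAGs below `K`. -/
theorem isExposed_CIMBelow (K : SimpleGraph (Fin p)) : IsExposed ℝ (CIM p) (CIMBelow K) := by
  classical
  let bad : {S : Finset (Fin p) // 2 ≤ S.card} → Prop := fun S =>
    ∃ a b, a ≠ b ∧ S.1 = {a, b} ∧ ¬ K.Adj a b
  have hval : ∀ G : DAG p, coeffDual (fun S => if bad S then -1 else 0) (charImset G) =
      - ∑ S with bad S, charImset G S := by
    intro G
    rw [coeffDual_apply, Finset.sum_filter, ← Finset.sum_neg_distrib]
    refine Finset.sum_congr rfl fun S _ => ?_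
    split_ifs <;> ring
  have hnn : ∀ (G : DAG p) (S : {S : Finset (Fin p) // 2 ≤ S.card}), 0 ≤ charImset G S := by
    intro G S
    rcases G.charImset_eq_zero_or_one S with h | h <;> rw [h]
    norm_num
  refine isExposed_convexHull (coeffDual fun S => if bad S then -1 else 0) 0 ?_ ?_ ?_ ?_
  · exact (subset_convexHull ℝ _).trans (CIMBelow_subset K)
  · rintro _ ⟨G, rfl⟩
    rw [hval, neg_nonpos]
    exact Finset.sum_nonneg fun S _ => hnn G S
  · rintro _ ⟨G, hG, rfl⟩
    rw [hval, neg_eq_zero]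
    refine Finset.sum_eq_zero fun S hS => charImset_eq_zero.2 fun hs => ?_
    obtain ⟨a, b, hab, hS, hK⟩ := (Finset.mem_filter.1 hS).2
    rw [hS, hasSink_pair hab] at hs
    exact hK (hG hs)
  · rintro _ ⟨G, rfl⟩ h0
    refine subset_convexHull ℝ _ ⟨G, fun a b hab => ?_, rfl⟩
    by_contra hK
    have hab' : a ≠ b := Neighbor.ne hab
    rw [hval, neg_eq_zero, Finset.sum_eq_zero_iff_of_nonneg fun S _ => hnn G S] at h0
    have := h0 ⟨{a, b}, (Finset.card_pair hab').ge⟩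
      (Finset.mem_filter.2 ⟨Finset.mem_univ _, a, b, hab', rfl, hK⟩)
    exact charImset_eq_zero.1 this ((hasSink_pair hab').2 hab)

end DAG

/-! ### Greedy phases on finite state spaces -/

section Greedy

variable {α : Type*}

theorem isChain_cons_append_of_getLastD {R : α → α → Prop} {x : α} {l m : List α}
    (hl : (x :: l).IsChain R) (hm : (l.getLastD x :: m).IsChain R) :
    (x :: (l ++ m)).IsChain R := by
  induction l generalizing x with
  | nil => simpa using hm
  | cons a l ih =>
    rw [List.isChain_cons_cons] at hl
    rw [List.getLastD_cons] at hm
    exact List.isChain_cons_cons.2 ⟨hl.1, ih hl.2 hm⟩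

theorem isChain_with_invariant {R : α → α → Prop} {P : α → Prop} {x : α} {l : List α}
    (hl : (x :: l).IsChain R) (hx : P x) (hP : ∀ a b, P a → R a b → P b) :
    (∀ y ∈ x :: l, P y) ∧ (x :: l).IsChain fun a b => P a ∧ R a b := by
  induction l generalizing x with
  | nil => simpa using hx
  | cons a l ih =>
    rw [List.isChain_cons_cons] at hl
    obtain ⟨h1, h2⟩ := ih hl.2 (hP x a hx hl.1)
    exact ⟨List.forall_mem_cons.2 ⟨hx, h1⟩, List.isChain_cons_cons.2 ⟨⟨hx, hl.1⟩, h2⟩⟩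

theorem score_le_getLastD {s : α → ℝ} {x : α} {l : List α}
    (h : (x :: l).IsChain fun a b => s a < s b) :
    s x ≤ s (l.getLastD x) ∧ (l ≠ [] → s x < s (l.getLastD x)) := by
  induction l generalizing x with
  | nil => simp
  | cons a l ih =>
    rw [List.isChain_cons_cons] at h
    rw [List.getLastD_cons]
    have := (ih h.2).1
    exact ⟨(h.1.trans_le this).le, fun _ => h.1.trans_le this⟩

variable {s : α → ℝ} {nbr : α → α → Prop}

theorem IsGreedyPhase.isChain {x : α} {l : List α} (h : IsGreedyPhase s nbr x l) :
    (x :: l).IsChain fun a b => nbr a b ∧ s a < s b :=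
  h.1.imp fun _ _ h => ⟨h.1, h.2.1⟩

theorem wellFounded_score_gt [Finite α] (s : α → ℝ) : WellFounded fun a b : α => s b < s a := by
  have : IsTrans α fun a b : α => s b < s a := ⟨fun a b c h1 h2 => h2.trans h1⟩
  have : Std.Irrefl fun a b : α => s b < s a := ⟨fun a h => lt_irrefl _ h⟩
  exact Finite.wellFounded_of_trans_of_irrefl _

theorem exists_isGreedyPhase [Finite α] (s : α → ℝ) (nbr : α → α → Prop) (x : α) :
    ∃ l, IsGreedyPhase s nbr x l := by
  induction x using (wellFounded_score_gt s).induction with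
  | _ x ih =>
    by_cases h : ∃ z, nbr x z ∧ s x < s z
    · obtain ⟨z, hz, hxz⟩ := h
      obtain ⟨y, hy, hmax⟩ := (Set.toFinite {z | nbr x z}).exists_maximalFor s _ ⟨z, hz⟩
      have hmax' : ∀ u, nbr x u → s u ≤ s y := fun u hu => by
        by_contra hc
        exact hc (hmax hu (not_le.1 hc).le)
      have hxy : s x < s y := hxz.trans_le (hmax' z hz)
      obtain ⟨l, hl⟩ := ih y hxy
      refine ⟨y :: l, List.isChain_cons_cons.2 ⟨⟨hy, hxy, hmax'⟩, hl.1⟩, ?_⟩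
      rw [List.getLastD_cons]
      exact hl.2
    · push Not at h
      exact ⟨[], by simp, h⟩

end Greedy

/-! ### GES, GIES and MMHC -/

section Runs

variable {p : ℕ}

instance : Finite (DAG p) := Finite.of_injective DAG.pa fun _ _ h => DAG.ext h

/-- The moves of GES and GIES. -/
def MECMove (E F : MEC p) : Prop := ForwardMove E F ∨ BackwardMove E F ∨ TurningMove E F

theorem IsGESRun.isChain {s : MEC p → ℝ} {l : List (MEC p)} (h : IsGESRun s l) :
    l ≠ [] ∧ l.IsChain fun E F => MECMove E F ∧ s E < s F := by
  obtain ⟨f, b, rfl, hf, hb⟩ := h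
  refine ⟨by simp, isChain_cons_append_of_getLastD ?_ ?_⟩
  · exact hf.isChain.imp fun _ _ h => ⟨Or.inl h.1, h.2⟩
  · exact hb.isChain.imp fun _ _ h => ⟨Or.inr (Or.inl h.1), h.2⟩

theorem exists_isGESRun (s : MEC p → ℝ) : ∃ l, IsGESRun s l := by
  obtain ⟨f, hf⟩ := exists_isGreedyPhase s ForwardMove ⟦DAG.empty p⟧
  obtain ⟨b, hb⟩ := exists_isGreedyPhase s BackwardMove (f.getLastD ⟦DAG.empty p⟧)
  exact ⟨_, f, b, rfl, hf, hb⟩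

theorem isChain_phases {s : MEC p → ℝ} {E : MEC p} {f b t : List (MEC p)}
    (hf : IsGreedyPhase s ForwardMove E f) (hb : IsGreedyPhase s BackwardMove (f.getLastD E) b)
    (ht : IsGreedyPhase s TurningMove ((f ++ b).getLastD E) t) :
    (E :: (f ++ b ++ t)).IsChain fun E F => MECMove E F ∧ s E < s F := by
  refine isChain_cons_append_of_getLastD (isChain_cons_append_of_getLastD ?_ ?_) ?_
  · exact hf.isChain.imp fun _ _ h => ⟨Or.inl h.1, h.2⟩
  · exact hb.isChain.imp fun _ _ h => ⟨Or.inr (Or.inl h.1), h.2⟩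
  · exact ht.isChain.imp fun _ _ h => ⟨Or.inr (Or.inr h.1), h.2⟩

theorem GIESFrom.isChain {s : MEC p → ℝ} {E : MEC p} {l : List (MEC p)} (h : GIESFrom s E l) :
    (E :: l).IsChain fun E F => MECMove E F ∧ s E < s F := by
  induction h with
  | last E f hf hb ht => exact hf.isChain.imp fun _ _ h => ⟨Or.inl h.1, h.2⟩
  | round E f b t r hf hb ht hne hr ih =>
    exact isChain_cons_append_of_getLastD (isChain_phases hf hb ht) ih

theorem exists_giesFrom (s : MEC p → ℝ) (E : MEC p) : ∃ l, GIESFrom s E l := by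
  induction E using (wellFounded_score_gt s).induction with
  | _ E ih =>
    obtain ⟨f, hf⟩ := exists_isGreedyPhase s ForwardMove E
    obtain ⟨b, hb⟩ := exists_isGreedyPhase s BackwardMove (f.getLastD E)
    obtain ⟨t, ht⟩ := exists_isGreedyPhase s TurningMove ((f ++ b).getLastD E)
    by_cases hne : b ≠ [] ∨ t ≠ []
    · have hlt := (score_le_getLastD ((isChain_phases hf hb ht).imp fun _ _ h => h.2)).2
        (by rcases hne with h | h <;> simp [h])
      obtain ⟨r, hr⟩ := ih _ hlt
      exact ⟨_, GIESFrom.round E f b t r hf hb ht hne hr⟩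
    · push Not at hne
      obtain ⟨rfl, rfl⟩ := hne
      rw [List.append_nil] at ht
      exact ⟨f, GIESFrom.last E f hf hb ht⟩

theorem IsPolytopeEdge.pair_comm {ι : Type*} {P : Set (ι → ℝ)} {x y : ι → ℝ}
    (h : IsPolytopeEdge P (convexHull ℝ {x, y})) : IsPolytopeEdge P (convexHull ℝ {y, x}) := by
  rwa [Set.pair_comm]

theorem MECMove.isPolytopeEdge {v : MEC p → ImsetSpace p} (hv : ∀ G : DAG p, v ⟦G⟧ = charImset G)
    {E F : MEC p} (h : MECMove E F) (hne : v E ≠ v F) :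
    IsPolytopeEdge (CIM p) (convexHull ℝ {v E, v F}) := by
  rcases h with ⟨G, H, rfl, rfl, i, j, h⟩ | ⟨G, H, rfl, rfl, i, j, h⟩ |
    ⟨G, H, rfl, rfl, i, j, h⟩ <;> rw [hv, hv] at hne ⊢
  · exact h.isPolytopeEdge
  · exact h.isPolytopeEdge.pair_comm
  · exact h.isPolytopeEdge hne

theorem isGreedyEdgeWalk_of_isChain {v : MEC p → ImsetSpace p}
    (hv : ∀ G : DAG p, v ⟦G⟧ = charImset G) {w : ImsetSpace p →ₗ[ℝ] ℝ} {s : MEC p → ℝ} {a : ℝ}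
    (hw : ∀ E, s E = w (v E) + a) {l : List (MEC p)} (hl : l ≠ [])
    (h : l.IsChain fun E F => MECMove E F ∧ s E < s F) :
    IsGreedyEdgeWalk (CIM p) w (l.map v) := by
  have hlt : ∀ {E F}, s E < s F → w (v E) < w (v F) := by
    intro E F h
    rw [hw, hw] at h
    linarith
  refine ⟨⟨by simpa using hl, ?_, ?_⟩, ?_⟩
  · intro x hx
    obtain ⟨E, -, rfl⟩ := List.mem_map.1 hx
    induction E using Quotient.inductionOn with
    | _ G =>
      rw [hv]
      exact G.charImset_mem_exposedPoints
  · rw [List.isChain_map]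
    exact h.imp fun E F h => h.1.isPolytopeEdge hv fun hc => (hlt h.2).ne (by rw [hc])
  · rw [List.isChain_map]
    exact h.imp fun E F h => hlt h.2

theorem HillClimbingMove.isPolytopeEdge {K : SimpleGraph (Fin p)} {G H : DAG p}
    (h : HillClimbingMove K G H) (hne : charImset G ≠ charImset H) :
    IsPolytopeEdge (CIM p) (convexHull ℝ {charImset G, charImset H}) := by
  obtain ⟨i, j, ⟨-, h⟩ | h | h⟩ := h
  · exact h.isPolytopeEdge
  · exact h.isPolytopeEdge.pair_comm
  · exact h.isPolytopeEdge hne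

theorem HillClimbingMove.skeleton_le {K : SimpleGraph (Fin p)} {G H : DAG p}
    (hG : G.skeleton ≤ K) (h : HillClimbingMove K G H) : H.skeleton ≤ K := by
  intro a b (hab : H.Neighbor a b)
  have hG' : ∀ {a b}, G.Neighbor a b → K.Adj a b := fun h => hG h
  obtain ⟨i, j, ⟨hK, h⟩ | h | h⟩ := h
  · rcases hab with hab | hab <;> rcases (h.2.2 _ _).1 hab with hab | ⟨rfl, rfl⟩
    · exact hG' (Or.inl hab)
    · exact hK
    · exact hG' (Or.inr hab)
    · exact hK.symm
  · rcases hab with hab | hab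
    · exact hG' (Or.inl ((h.2.2 _ _).2 (Or.inl hab)))
    · exact hG' (Or.inr ((h.2.2 _ _).2 (Or.inl hab)))
  · exact hG' (h.neighbor_iff.1 hab)

theorem charImset_mem_CIMBelow {K : SimpleGraph (Fin p)} {G : DAG p} (hG : G.skeleton ≤ K) :
    charImset G ∈ CIMBelow K := subset_convexHull ℝ _ ⟨G, hG, rfl⟩

theorem charImset_mem_exposedPoints_CIMBelow {K : SimpleGraph (Fin p)} {G : DAG p}
    (hG : G.skeleton ≤ K) : charImset G ∈ (CIMBelow K).exposedPoints ℝ := by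
  have h := G.charImset_mem_exposedPoints
  rw [mem_exposedPoints_iff_exposed_singleton] at h ⊢
  exact h.mono_ambient (DAG.CIMBelow_subset K)
    (Set.singleton_subset_iff.2 (charImset_mem_CIMBelow hG))

theorem IsMMHCRun.isGreedyEdgeWalk {s : DAG p → ℝ} {w : ImsetSpace p →ₗ[ℝ] ℝ} {a : ℝ}
    (hw : ∀ G, s G = w (charImset G) + a) {K : SimpleGraph (Fin p)} {l : List (DAG p)}
    (h : IsMMHCRun s K l) : IsGreedyEdgeWalk (CIMBelow K) w (l.map charImset) := by
  obtain ⟨r, rfl, hr⟩ := h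
  have hlt : ∀ {E F}, s E < s F → w (charImset E) < w (charImset F) := by
    intro E F h
    rw [hw, hw] at h
    linarith
  have h0 : (DAG.empty p).skeleton ≤ K := by
    rintro a b (h | h) <;> simp [DAG.Arrow, DAG.empty] at h
  obtain ⟨h1, h2⟩ := isChain_with_invariant (P := fun G => G.skeleton ≤ K) hr.isChain h0
    fun G H hG h => h.1.skeleton_le hG
  refine ⟨⟨by simp, ?_, ?_⟩, ?_⟩
  · intro x hx
    obtain ⟨G, hG, rfl⟩ := List.mem_map.1 hx
    exact charImset_mem_exposedPoints_CIMBelow (h1 G hG)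
  · rw [List.isChain_map]
    refine h2.imp fun G H h => ?_
    have he := h.2.1.isPolytopeEdge fun hc => (hlt h.2.2).ne (by rw [hc])
    refine ⟨he.1.mono_ambient (DAG.CIMBelow_subset K) ?_, he.2⟩
    exact convexHull_min (Set.pair_subset (charImset_mem_CIMBelow h.1)
      (charImset_mem_CIMBelow (h.2.1.skeleton_le h.1))) (convex_convexHull ℝ _)
  · rw [List.isChain_map]
    exact h2.imp fun E F h => hlt h.2.2

/-- GES, GIES and MMHC are greedy edge-walks. -/
theorem greedy_score_search (s : DAG p → ℝ) (hd : IsDecomposable s) (hs : IsScoreEquivalent s) :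
    ∃ (v : MEC p → ImsetSpace p) (w : ImsetSpace p →ₗ[ℝ] ℝ) (a : ℝ),
      (∀ G : DAG p, v ⟦G⟧ = charImset G) ∧
      (∀ G : DAG p, s G = w (charImset G) + a) ∧
      ((∃ l, IsGESRun (mecScore s hs) l) ∧
        ∀ l, IsGESRun (mecScore s hs) l → IsGreedyEdgeWalk (CIM p) w (l.map v)) ∧
      ((∃ l, IsGIESRun (mecScore s hs) l) ∧
        ∀ l, IsGIESRun (mecScore s hs) l → IsGreedyEdgeWalk (CIM p) w (l.map v)) ∧
      ∀ K : SimpleGraph (Fin p),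
        IsExposed ℝ (CIM p) (CIMBelow K) ∧
        (∃ l, IsMMHCRun s K l) ∧
        ∀ l, IsMMHCRun s K l → IsGreedyEdgeWalk (CIMBelow K) w (l.map charImset) := by
  obtain ⟨w, a, hw⟩ := DAG.exists_linear_score hd hs
  let v : MEC p → ImsetSpace p := Quotient.lift charImset fun G H h => h.charImset_eq
  have hv : ∀ G : DAG p, v ⟦G⟧ = charImset G := fun G => rfl
  have hwv : ∀ E, mecScore s hs E = w (v E) + a := by
    intro E
    induction E using Quotient.inductionOn with
    | _ G => exact hw G
  refine ⟨v, w, a, hv, hw, ⟨exists_isGESRun _, fun l hl => ?_⟩, ⟨?_, fun l hl => ?_⟩,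
    fun K => ⟨DAG.isExposed_CIMBelow K, ?_, fun l hl => hl.isGreedyEdgeWalk hw⟩⟩
  · exact isGreedyEdgeWalk_of_isChain hv hwv hl.isChain.1 hl.isChain.2
  · obtain ⟨l, hl⟩ := exists_giesFrom (mecScore s hs) ⟦DAG.empty p⟧
    exact ⟨_, l, rfl, hl⟩
  · obtain ⟨r, rfl, hr⟩ := hl
    exact isGreedyEdgeWalk_of_isChain hv hwv (by simp) hr.isChain
  · obtain ⟨r, hr⟩ := exists_isGreedyPhase s (HillClimbingMove K) (DAG.empty p)
    exact ⟨_, r, rfl, hr⟩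

end Runs

/-! ### Orderings and adjacent transpositions -/

section Orderings

variable {p : ℕ}

theorem mem_before {π : Equiv.Perm (Fin p)} {a b : Fin p} :
    a ∈ before π b ↔ π.symm a < π.symm b := by
  simp [before]

theorem swap_lt_swap_iff {k l x y : Fin p} (hkl : (k : ℕ) + 1 = l)
    (h1 : ¬ (x = k ∧ y = l)) (h2 : ¬ (x = l ∧ y = k)) :
    Equiv.swap k l x < Equiv.swap k l y ↔ x < y := by
  simp only [Fin.ext_iff, Fin.lt_def, Equiv.swap_apply_def] at *
  split_ifs <;> omega

theorem mul_swap_symm_apply (τ : Equiv.Perm (Fin p)) (k l x : Fin p) :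
    (τ * Equiv.swap k l).symm x = Equiv.swap k l (τ.symm x) := rfl

theorem mul_swap_mul_swap (τ : Equiv.Perm (Fin p)) (k l : Fin p) :
    τ * Equiv.swap k l * Equiv.swap k l = τ := by
  rw [mul_assoc, Equiv.swap_mul_self, mul_one]

theorem before_mul_swap_of_ne {τ : Equiv.Perm (Fin p)} {k l : Fin p} (hkl : (k : ℕ) + 1 = l)
    {y : Fin p} (hk : y ≠ τ k) (hl : y ≠ τ l) : before (τ * Equiv.swap k l) y = before τ y := by
  ext x
  rw [mem_before, mem_before, mul_swap_symm_apply, mul_swap_symm_apply]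
  refine swap_lt_swap_iff hkl (fun h => hl ?_) fun h => hk ?_
  · rw [← h.2, Equiv.apply_symm_apply]
  · rw [← h.2, Equiv.apply_symm_apply]

theorem before_mul_swap_left {τ : Equiv.Perm (Fin p)} {k l : Fin p} (hkl : (k : ℕ) + 1 = l) :
    before (τ * Equiv.swap k l) (τ l) = before τ (τ k) := by
  ext x
  rw [mem_before, mem_before, mul_swap_symm_apply, mul_swap_symm_apply, Equiv.symm_apply_apply,
    Equiv.symm_apply_apply]
  generalize τ.symm x = y
  simp only [Fin.lt_def, Equiv.swap_apply_def, Fin.ext_iff]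
  split_ifs <;> omega

theorem before_succ {τ : Equiv.Perm (Fin p)} {k l : Fin p} (hkl : (k : ℕ) + 1 = l) :
    before τ (τ l) = insert (τ k) (before τ (τ k)) := by
  ext x
  rw [Finset.mem_insert, mem_before, mem_before, Equiv.symm_apply_apply,
    Equiv.symm_apply_apply, ← Equiv.symm_apply_eq]
  simp only [Fin.lt_def, Fin.ext_iff]
  omega

theorem before_mul_swap_right {τ : Equiv.Perm (Fin p)} {k l : Fin p} (hkl : (k : ℕ) + 1 = l) :
    before (τ * Equiv.swap k l) (τ k) = insert (τ l) (before τ (τ k)) := by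
  have h := before_succ (τ := τ * Equiv.swap k l) hkl
  simp only [Equiv.Perm.mul_apply, Equiv.swap_apply_right, Equiv.swap_apply_left] at h
  rw [h, before_mul_swap_left hkl]

theorem eq_one_of_forall_lt {ρ : Equiv.Perm (Fin p)}
    (h : ∀ k l : Fin p, (k : ℕ) + 1 = l → ρ k < ρ l) : ρ = 1 := by
  have hρ : StrictMono ρ := by
    cases p with
    | zero => exact fun a => a.elim0
    | succ n => exact Fin.strictMono_iff_lt_succ.2 fun i => h _ _ (by simp)
  have hρ' : StrictMono ρ.symm := fun a b hab => by
    rw [← hρ.lt_iff_lt]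
    simpa using hab
  ext x
  refine congrArg Fin.val (le_antisymm ?_ (hρ.le_apply))
  have := hρ.monotone (hρ'.le_apply (x := x))
  simpa using this

/-- Bubble sort: every ordering is turned into `π` by transpositions of adjacent entries that
are in the wrong order. They increase the scalar product of the positions in both orderings. -/
theorem bubble_sort_induction (π : Equiv.Perm (Fin p)) {P : Equiv.Perm (Fin p) → Prop}
    (hπ : P π)
    (step : ∀ (τ : Equiv.Perm (Fin p)) (k l : Fin p), (k : ℕ) + 1 = l →
      π.symm (τ l) < π.symm (τ k) → P (τ * Equiv.swap k l) → P τ)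
    (τ : Equiv.Perm (Fin p)) : P τ := by
  let s : Equiv.Perm (Fin p) → ℝ := fun τ => ∑ k : Fin p, ((k : ℕ) : ℝ) * (π.symm (τ k) : ℕ)
  induction τ using (wellFounded_score_gt s).induction with
  | _ τ ih =>
    by_cases h : ∃ k l : Fin p, (k : ℕ) + 1 = l ∧ π.symm (τ l) < π.symm (τ k)
    · obtain ⟨k, l, hkl, hlt⟩ := h
      refine step τ k l hkl hlt (ih _ ?_)
      have hne : k ≠ l := by
        rintro rfl
        omega
      rw [← sub_pos]
      simp only [s]
      rw [← Finset.sum_sub_distrib, ← Finset.add_sum_erase _ _ (Finset.mem_univ k),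
        ← Finset.add_sum_erase _ _ (Finset.mem_erase.2 ⟨hne.symm, Finset.mem_univ l⟩),
        Finset.sum_eq_zero]
      · simp only [Equiv.Perm.mul_apply, Equiv.swap_apply_right, Equiv.swap_apply_left]
        have h1 : ((l : ℕ) : ℝ) = (k : ℕ) + 1 := by exact_mod_cast hkl.symm
        have h2 : ((π.symm (τ l) : ℕ) : ℝ) < (π.symm (τ k) : ℕ) := by exact_mod_cast hlt
        rw [h1]
        linarith
      · intro x hx
        simp only [Finset.mem_erase] at hx
        rw [Equiv.Perm.mul_apply, Equiv.swap_apply_of_ne_of_ne hx.2.1 hx.1, sub_self]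
    · push Not at h
      have : π⁻¹ * τ = 1 := eq_one_of_forall_lt fun k l hkl => by
        refine lt_of_le_of_ne (h k l hkl) fun hc => ?_
        have := congrArg Fin.val ((π⁻¹ * τ).injective hc)
        omega
      rw [← inv_mul_eq_one.1 this]
      exact hπ

theorem isLinearExtension_mul_swap {G : DAG p} {τ : Equiv.Perm (Fin p)}
    (hτ : IsLinearExtension G τ) {k l : Fin p} (hkl : (k : ℕ) + 1 = l)
    (h : ¬ G.Arrow (τ k) (τ l)) : IsLinearExtension G (τ * Equiv.swap k l) := by
  intro a b hab
  rw [mul_swap_symm_apply, mul_swap_symm_apply, swap_lt_swap_iff hkl]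
  · exact hτ a b hab
  · rintro ⟨h1, h2⟩
    rw [← h1, ← h2, Equiv.apply_symm_apply, Equiv.apply_symm_apply] at h
    exact h hab
  · rintro ⟨h1, h2⟩
    have := hτ a b hab
    rw [h1, h2, Fin.lt_def] at this
    omega

/-- A linear extension in which the ends of a covered arrow are adjacent: first the ancestors of
`i`, then `i` and `j`, then the other nodes. -/
theorem exists_isLinearExtension_adjacent {D : DAG p} {π : Equiv.Perm (Fin p)}
    (hπ : IsLinearExtension D π) {i j : Fin p} (hij : D.Arrow i j)
    (hcov : D.pa j = insert i (D.pa i)) :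
    ∃ (σ : Equiv.Perm (Fin p)) (k l : Fin p), IsLinearExtension D σ ∧ (k : ℕ) + 1 = l ∧
      σ k = i ∧ σ l = j := by
  classical
  let f : Fin p → ℕ := fun x =>
    if Relation.TransGen D.Arrow x i then 0 else if x = i then 1 else if x = j then 2 else 3
  let key : Fin p → ℕ := fun x => f x * p + π.symm x
  have f3 : ∀ x, f x ≤ 3 := fun x => by
    simp only [f]
    split_ifs <;> omega
  have fi : f i = 1 := by
    have h1 : ¬ Relation.TransGen D.Arrow i i := D.acyclic i
    simp [f, h1]
  have fj : f j = 2 := by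
    have h1 : ¬ Relation.TransGen D.Arrow j i := fun h => D.acyclic i (h.head hij)
    simp [f, h1, hij.ne.symm]
  have f1 : ∀ x, f x = 1 → x = i := fun x h => by
    simp only [f] at h
    split_ifs at h <;> first | assumption | omega
  have f2 : ∀ x, f x = 2 → x = j := fun x h => by
    simp only [f] at h
    split_ifs at h <;> first | assumption | omega
  have fmono : ∀ a b, D.Arrow a b → f a ≤ f b := by
    intro a b hab
    by_cases hb : Relation.TransGen D.Arrow b i
    · have : f a = 0 := by simp [f, hb.head hab]
      omega
    by_cases hbi : b = i
    · subst hbi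
      have : f a = 0 := by simp [f, Relation.TransGen.single hab]
      omega
    by_cases hbj : b = j
    · subst hbj
      rw [fj]
      have ha : a ∈ insert i (D.pa i) := hcov ▸ hab
      rcases Finset.mem_insert.1 ha with rfl | ha
      · omega
      · have : f a = 0 := by
          simp [f, Relation.TransGen.single (show D.Arrow a i from ha)]
        omega
    · have : f b = 3 := by simp [f, hb, hbi, hbj]
      rw [this]
      exact f3 a
  have klt : ∀ x, f x * p ≤ key x ∧ key x < f x * p + p := fun x =>
    ⟨Nat.le_add_right _ _, Nat.add_lt_add_left (π.symm x).2 _⟩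
  have kinj : Function.Injective key := by
    intro x y hxy
    have hx := klt x
    have hy := klt y
    have hf : f x = f y := by
      by_contra hc
      rcases Nat.lt_or_gt_of_ne hc with h | h
      · have := Nat.mul_le_mul_right p h
        rw [Nat.succ_mul] at this
        omega
      · have := Nat.mul_le_mul_right p h
        rw [Nat.succ_mul] at this
        omega
    have : (π.symm x : ℕ) = π.symm y := by
      simp only [key, hf] at hxy
      omega
    exact π.symm.injective (Fin.ext this)
  have hmono : StrictMono (key ∘ Tuple.sort key) :=
    (Tuple.monotone_sort key).strictMono_of_injective
      (kinj.comp (Tuple.sort key).injective)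
  set σ := Tuple.sort key with hσ
  have hlt : ∀ a b, σ.symm a < σ.symm b ↔ key a < key b := by
    intro a b
    rw [← hmono.lt_iff_lt]
    simp
  have hkey : ∀ a b, f a < f b → key a < key b := by
    intro a b h
    have h1 := klt a
    have h2 := klt b
    have := Nat.mul_le_mul_right p h
    rw [Nat.succ_mul] at this
    omega
  have hlin : IsLinearExtension D σ := by
    intro a b hab
    rw [hlt]
    rcases (fmono a b hab).lt_or_eq with h | h
    · exact hkey a b h
    · have := hπ a b hab
      simp only [key, h]
      exact Nat.add_lt_add_left this _
  refine ⟨σ, σ.symm i, σ.symm j, hlin, ?_, by simp, by simp⟩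
  have h1 : σ.symm i < σ.symm j := hlin i j hij
  by_contra hc
  rw [Fin.lt_def] at h1
  have h2 : (σ.symm i : ℕ) + 1 < σ.symm j := by omega
  let m : Fin p := ⟨σ.symm i + 1, h2.trans (σ.symm j).2⟩
  have h3 : key i < key (σ m) := by
    rw [← hlt, Equiv.symm_apply_apply, Fin.lt_def]
    simp [m]
  have h4 : key (σ m) < key j := by
    rw [← hlt, Equiv.symm_apply_apply, Fin.lt_def]
    exact h2
  have h5 : ¬ f (σ m) < f i := fun h => (hkey _ _ h).not_gt h3
  have h6 : ¬ f j < f (σ m) := fun h => (hkey _ _ h).not_gt h4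
  rw [fi] at h5
  rw [fj] at h6
  rcases (by omega : f (σ m) = 1 ∨ f (σ m) = 2) with h | h
  · rw [f1 _ h] at h3
    exact lt_irrefl _ h3
  · rw [f2 _ h] at h4
    exact lt_irrefl _ h4

end Orderings

/-! ### Graphoids and the DAGs of orderings -/

section Graphoid

variable {p : ℕ} {C : Fin p → Fin p → Finset (Fin p) → Prop}

theorem IsGraphoid.insert_iff (hC : IsGraphoid C) {a b c : Fin p} {L : Finset (Fin p)}
    (hab : a ≠ b) (hac : a ≠ c) (hbc : b ≠ c) (ha : a ∉ L) (hb : b ∉ L) (hc : c ∉ L)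
    (h : C a b (insert c L)) : C c b (insert a L) ↔ C c b L := by
  have h' : C b a (insert c L) :=
    hC.symm _ _ _ hab (by simp [hac, ha]) (by simp [hbc, hb]) h
  constructor
  · intro h1
    have h2 := hC.symm _ _ _ hbc.symm (by simp [hac.symm, hc]) (by simp [hab.symm, hb]) h1
    exact hC.symm _ _ _ hbc hb hc (hC.intersection b c a L hbc hab.symm hac.symm hb hc ha h2 h').1
  · intro h1
    have h2 := hC.symm _ _ _ hbc.symm hc hb h1
    exact hC.symm _ _ _ hbc (by simp [hab.symm, hb]) (by simp [hac.symm, hc])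
      (hC.exchange b c a L hbc hab.symm hac.symm hb hc ha h2 h').2

theorem minIMap_arrow {π : Equiv.Perm (Fin p)} {a b : Fin p} :
    (minIMap C π).Arrow a b ↔ a ∈ before π b ∧ ¬ C a b ((before π b).erase a) := by
  classical
  unfold DAG.Arrow minIMap
  simp

/-- A node that is independent of `b` given `N` does not influence which elements of `N` become
parents of `b`. -/
theorem IsGraphoid.parents_insert (hC : IsGraphoid C) {a b : Fin p} {N : Finset (Fin p)}
    (hab : a ≠ b) (ha : a ∉ N) (hb : b ∉ N) (h : C a b N) (x : Fin p) :
    (x ∈ insert a N ∧ ¬ C x b ((insert a N).erase x)) ↔ (x ∈ N ∧ ¬ C x b (N.erase x)) := by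
  by_cases hxa : x = a
  · subst hxa
    simp [ha, h]
  by_cases hx : x ∈ N
  · have hxb : b ≠ x := by
      rintro rfl
      exact hb hx
    have e1 : (insert a N).erase x = insert a (N.erase x) :=
      Finset.erase_insert_of_ne (Ne.symm hxa)
    simp only [Finset.mem_insert, hx, or_true, true_and, e1]
    refine not_congr (hC.insert_iff hab (Ne.symm hxa) hxb (by simp [ha]) (by simp [hb])
      (by simp) ?_)
    rwa [Finset.insert_erase hx]
  · simp [hx, hxa]

theorem isLinearExtension_minIMap (C : Fin p → Fin p → Finset (Fin p) → Prop)
    (π : Equiv.Perm (Fin p)) : IsLinearExtension (minIMap C π) π := fun _ _ h =>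
  mem_before.1 (minIMap_arrow.1 h).1

theorem dag_eq_of_arrow_iff {G H : DAG p} (h : ∀ a b, G.Arrow a b ↔ H.Arrow a b) : G = H :=
  DAG.ext (funext fun b => Finset.ext fun a => h a b)

/-- Transposing adjacent independent nodes does not change the DAG of an ordering. -/
theorem IsGraphoid.minIMap_mul_swap (hC : IsGraphoid C) {τ : Equiv.Perm (Fin p)} {k l : Fin p}
    (hkl : (k : ℕ) + 1 = l) (h : C (τ k) (τ l) (before τ (τ k))) :
    minIMap C (τ * Equiv.swap k l) = minIMap C τ := by
  have hne : τ k ≠ τ l := fun h => by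
    have := congrArg Fin.val (τ.injective h)
    omega
  have hk : τ k ∉ before τ (τ k) := by simp [mem_before]
  have hl : τ l ∉ before τ (τ k) := by
    simp only [mem_before, Equiv.symm_apply_apply, Fin.lt_def]
    omega
  refine dag_eq_of_arrow_iff fun x y => ?_
  rw [minIMap_arrow, minIMap_arrow]
  by_cases hyk : y = τ k
  · subst hyk
    rw [before_mul_swap_right hkl]
    exact hC.parents_insert hne.symm hl hk (hC.symm _ _ _ hne hk hl h) x
  by_cases hyl : y = τ l
  · subst hyl
    rw [before_mul_swap_left hkl, before_succ hkl]
    exact (hC.parents_insert hne hk hl h x).symm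
  · rw [before_mul_swap_of_ne hkl hyk hyl]

variable {Q : Set (Fin p → ℝ)} {v : Equiv.Perm (Fin p) → (Fin p → ℝ)}

/-- All linear extensions of a DAG `H` that contains the DAG of one of them have the same DAG
and belong to the same vertex. -/
theorem IsGraphoid.eq_of_isLinearExtension (hC : IsGraphoid C) (hQ : IsDAGAssociahedron C Q v)
    {H : DAG p} {π : Equiv.Perm (Fin p)} (hπ : IsLinearExtension H π)
    (hle : ∀ a b, (minIMap C π).Arrow a b → H.Arrow a b) {τ : Equiv.Perm (Fin p)}
    (hτ : IsLinearExtension H τ) : minIMap C τ = minIMap C π ∧ v τ = v π := by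
  induction τ using bubble_sort_induction π with
  | hπ => exact ⟨rfl, rfl⟩
  | step τ k l hkl hlt ih =>
    have hH : ¬ H.Arrow (τ k) (τ l) := fun h => (hπ _ _ h).not_gt hlt
    have hH' : ¬ H.Arrow (τ l) (τ k) := fun h => by
      have := hτ _ _ h
      rw [Equiv.symm_apply_apply, Equiv.symm_apply_apply, Fin.lt_def] at this
      omega
    obtain ⟨h1, h2⟩ := ih (isLinearExtension_mul_swap hτ hkl hH)
    set τ' := τ * Equiv.swap k l with hτ'
    have hk : τ' k = τ l := by simp [hτ']
    have hl : τ' l = τ k := by simp [hτ']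
    have hback : τ' * Equiv.swap k l = τ := mul_swap_mul_swap τ k l
    have hn : C (τ' k) (τ' l) (before τ' (τ' k)) := by
      by_contra hc
      apply hH'
      apply hle
      rw [← h1, minIMap_arrow, ← hk, ← hl, before_succ hkl]
      refine ⟨by simp, ?_⟩
      rwa [Finset.erase_insert (by simp [mem_before])]
    have h3 := hC.minIMap_mul_swap hkl hn
    have h4 := (hQ.wall τ' k l hkl).2 hn
    rw [hback] at h3 h4
    exact ⟨h3.trans h1, h4.trans h2⟩

/-! ### Vertices and edges of DAG associahedra -/

theorem IsDAGAssociahedron.mem_exposedPoints (hQ : IsDAGAssociahedron C Q v)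
    (π : Equiv.Perm (Fin p)) : v π ∈ Q.exposedPoints ℝ := by
  rw [hQ.hull]
  refine mem_exposedPoints_convexHull (coeffDual fun x => -((π.symm x : ℕ) : ℝ)) ⟨π, rfl⟩ ?_
  rintro _ ⟨τ, rfl⟩ hne
  rw [coeffDual_apply, coeffDual_apply]
  refine hQ.chamber π _ (fun a b hab => ?_) τ hne
  simpa using hab

/-- The inequality of a chamber extends to its closure. -/
theorem IsDAGAssociahedron.sum_le_of_antitone (hQ : IsDAGAssociahedron C Q v)
    {π : Equiv.Perm (Fin p)} {w : Fin p → ℝ} (hw : Antitone fun k => w (π k))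
    (τ : Equiv.Perm (Fin p)) : ∑ i, w i * v τ i ≤ ∑ i, w i * v π i := by
  by_cases hne : v τ = v π
  · rw [hne]
  set r : Fin p → ℝ := fun x => -((π.symm x : ℕ) : ℝ) with hr
  set A := ∑ i, r i * v π i - ∑ i, r i * v τ i with hA
  have key : ∀ ε : ℝ, 0 < ε → ∑ i, w i * v τ i < ∑ i, w i * v π i + ε * A := by
    intro ε hε
    have h := hQ.chamber π (fun i => w i + ε * r i) (fun a b hab => ?_) τ hne
    · simp only [add_mul, Finset.sum_add_distrib, mul_assoc, ← Finset.mul_sum] at h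
      rw [hA]
      linarith
    · have h1 := hw hab.le
      have h2 : r (π b) < r (π a) := by simpa [hr] using hab
      have h3 := mul_lt_mul_of_pos_left h2 hε
      simp only at h1 ⊢
      linarith
  by_contra hc
  push Not at hc
  set d := ∑ i, w i * v τ i - ∑ i, w i * v π i with hd
  have hd0 : 0 < d := by linarith
  have h1 := key (d / (|A| + 1)) (by positivity)
  have h2 : d / (|A| + 1) * A ≤ d := by
    rw [div_mul_eq_mul_div, div_le_iff₀ (by positivity)]
    have := le_abs_self A
    nlinarith
  linarith

/-- Weights that decrease by one along the ordering `σ`, except that those of the entries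
`k` and `k + 1` are equal. -/
def wallWeight (σ : Equiv.Perm (Fin p)) (k x : Fin p) : ℝ :=
  if σ.symm x ≤ k then -((σ.symm x : ℕ) : ℝ) else 1 - ((σ.symm x : ℕ) : ℝ)

theorem wallWeight_mul_swap (σ : Equiv.Perm (Fin p)) {k l : Fin p} (hkl : (k : ℕ) + 1 = l) :
    wallWeight (σ * Equiv.swap k l) k = wallWeight σ k := by
  funext x
  unfold wallWeight
  rw [mul_swap_symm_apply]
  generalize σ.symm x = y
  have hc : ((l : ℕ) : ℝ) = (k : ℕ) + 1 := by exact_mod_cast hkl.symm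
  have hlk : ¬ l ≤ k := by
    rw [Fin.le_def]
    omega
  by_cases hy : y = k
  · subst hy
    rw [Equiv.swap_apply_left, if_neg hlk, if_pos le_rfl, hc]
    ring
  by_cases hy' : y = l
  · subst hy'
    rw [Equiv.swap_apply_right, if_neg hlk, if_pos le_rfl, hc]
    ring
  · rw [Equiv.swap_apply_of_ne_of_ne hy hy']

theorem antitone_wallWeight_add (σ : Equiv.Perm (Fin p)) {k l : Fin p} (hkl : (k : ℕ) + 1 = l)
    {d : Fin p → ℝ} (hd : ∀ x, |d x| ≤ 1 / 2) (hlk : d (σ l) ≤ d (σ k)) :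
    Antitone fun m => wallWeight σ k (σ m) + d (σ m) := by
  intro m n hmn
  rcases hmn.eq_or_lt with rfl | hmn
  · rfl
  simp only [wallWeight, Equiv.symm_apply_apply]
  rw [Fin.lt_def] at hmn
  by_cases hmk : m = k ∧ n = l
  · obtain ⟨rfl, rfl⟩ := hmk
    have hc : ((n : ℕ) : ℝ) = (m : ℕ) + 1 := by exact_mod_cast hkl.symm
    rw [if_pos le_rfl, if_neg (by rw [Fin.le_def]; omega), hc]
    linarith
  have h1 := abs_le.1 (hd (σ m))
  have h2 := abs_le.1 (hd (σ n))
  have h3 : ((m : ℕ) : ℝ) + 1 ≤ (n : ℕ) := by exact_mod_cast hmn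
  simp only [Fin.le_def, Fin.ext_iff] at hmk ⊢
  split_ifs with h4 h5 h5
  · linarith
  · linarith
  · have h6 : ((m : ℕ) : ℝ) + 2 ≤ (n : ℕ) := by exact_mod_cast (by omega : (m : ℕ) + 2 ≤ n)
    linarith
  · linarith

/-- Orderings that differ by an adjacent transposition belong to the same vertex or to the ends
of an edge. The weights that are tied on the two transposed entries and strictly decreasing
otherwise are maximal on that edge: such weights form an open part of a hyperplane, so that the
differences of vertices on which one of them vanishes are parallel. -/
theorem IsDAGAssociahedron.isPolytopeEdge (hQ : IsDAGAssociahedron C Q v)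
    {σ : Equiv.Perm (Fin p)} {k l : Fin p} (hkl : (k : ℕ) + 1 = l)
    (hne : v σ ≠ v (σ * Equiv.swap k l)) :
    IsPolytopeEdge Q (convexHull ℝ {v σ, v (σ * Equiv.swap k l)}) := by
  classical
  set σ' := σ * Equiv.swap k l with hσ'
  have hk' : σ' k = σ l := by simp [hσ']
  have hl' : σ' l = σ k := by simp [hσ']
  have hij : σ k ≠ σ l := fun h => by
    have := congrArg Fin.val (σ.injective h)
    omega
  set w := wallWeight σ k with hw
  have hw' : wallWeight σ' k = w := wallWeight_mul_swap σ hkl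
  have le1 : ∀ d : Fin p → ℝ, (∀ x, |d x| ≤ 1 / 2) → d (σ l) ≤ d (σ k) → ∀ τ,
      ∑ i, w i * v τ i + ∑ i, d i * v τ i ≤ ∑ i, w i * v σ i + ∑ i, d i * v σ i := by
    intro d hd hlk τ
    have := hQ.sum_le_of_antitone (w := fun x => w x + d x)
      (antitone_wallWeight_add σ hkl hd hlk) τ
    simpa only [add_mul, Finset.sum_add_distrib] using this
  have le2 : ∀ d : Fin p → ℝ, (∀ x, |d x| ≤ 1 / 2) → d (σ k) ≤ d (σ l) → ∀ τ,
      ∑ i, w i * v τ i + ∑ i, d i * v τ i ≤ ∑ i, w i * v σ' i + ∑ i, d i * v σ' i := by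
    intro d hd hlk τ
    have := hQ.sum_le_of_antitone (π := σ') (w := fun x => w x + d x) (by
      have := antitone_wallWeight_add σ' hkl hd (by rwa [hk', hl'])
      rwa [hw'] at this) τ
    simpa only [add_mul, Finset.sum_add_distrib] using this
  have zero_half : ∀ x : Fin p, |(0 : Fin p → ℝ) x| ≤ 1 / 2 := fun x => by norm_num
  have hle : ∀ τ, ∑ i, w i * v τ i ≤ ∑ i, w i * v σ i := fun τ => by
    simpa using le1 0 zero_half le_rfl τ
  have heq : ∑ i, w i * v σ' i = ∑ i, w i * v σ i :=
    le_antisymm (hle σ') (by simpa using le2 0 zero_half le_rfl σ)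
  have single_half : ∀ y x : Fin p, |Pi.single (M := fun _ => ℝ) y (1 / 2 : ℝ) x| ≤ 1 / 2 := by
    intro y x
    by_cases h : x = y
    · subst h
      rw [Pi.single_eq_same, abs_of_pos (by norm_num)]
    · rw [Pi.single_eq_of_ne h, abs_zero]
      norm_num
  have sum_single : ∀ (y : Fin p) (z : Fin p → ℝ),
      ∑ i, Pi.single (M := fun _ => ℝ) y (1 / 2 : ℝ) i * z i = 1 / 2 * z y := by
    intro y z
    rw [Finset.sum_eq_single y]
    · rw [Pi.single_eq_same]
    · intro b _ hb
      rw [Pi.single_eq_of_ne hb, zero_mul]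
    · simp
  -- the vertices on the face differ from `v σ` only in the coordinates of `σ k` and `σ l`
  have face : ∀ τ, ∑ i, w i * v τ i = ∑ i, w i * v σ i →
      (∀ x, x ≠ σ k → x ≠ σ l → v τ x = v σ x) ∧
      v τ (σ k) + v τ (σ l) = v σ (σ k) + v σ (σ l) ∧ v σ (σ l) ≤ v τ (σ l) ∧
      v τ (σ l) ≤ v σ' (σ l) := by
    intro τ hτ
    have tie : ∀ d : Fin p → ℝ, (∀ x, |d x| ≤ 1 / 2) → d (σ l) = d (σ k) →
        ∑ i, d i * v τ i = ∑ i, d i * v σ i := by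
      intro d hd h
      have h1 := le1 d hd h.le τ
      have h2 := le1 (-d) (fun x => by simpa using hd x) (by simp [h]) τ
      simp only [Pi.neg_apply, neg_mul, Finset.sum_neg_distrib] at h2
      linarith
    have hsum : v τ (σ k) + v τ (σ l) = v σ (σ k) + v σ (σ l) := by
      have h := tie (Pi.single (σ k) (1 / 2) + Pi.single (σ l) (1 / 2)) ?_ ?_
      · simp only [Pi.add_apply, add_mul, Finset.sum_add_distrib, sum_single] at h
        linarith
      · intro x
        by_cases hx : x = σ k
        · subst hx
          rw [Pi.add_apply, Pi.single_eq_of_ne (i := σ l) hij, add_zero]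
          exact single_half _ _
        · rw [Pi.add_apply, Pi.single_eq_of_ne (i := σ k) hx, zero_add]
          exact single_half _ _
      · simp [hij, hij.symm]
    refine ⟨fun x hxk hxl => ?_, hsum, ?_, ?_⟩
    · have h := tie (Pi.single x (1 / 2)) (single_half x) (by
        rw [Pi.single_eq_of_ne hxk.symm, Pi.single_eq_of_ne hxl.symm])
      rw [sum_single, sum_single] at h
      linarith
    · have h := le1 (Pi.single (σ k) (1 / 2)) (single_half _) (by
        rw [Pi.single_eq_of_ne hij.symm, Pi.single_eq_same]
        norm_num) τ
      rw [sum_single, sum_single] at h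
      linarith
    · have h := le2 (Pi.single (σ l) (1 / 2)) (single_half _) (by
        rw [Pi.single_eq_of_ne hij, Pi.single_eq_same]
        norm_num) τ
      rw [sum_single, sum_single] at h
      linarith
  rw [hQ.hull]
  refine isPolytopeEdge_convexHull_pair (coeffDual w) ⟨σ, rfl⟩ ⟨σ', rfl⟩ hne ?_ ?_ ?_
  · rw [coeffDual_apply, coeffDual_apply, heq]
  · rintro _ ⟨τ, rfl⟩
    rw [coeffDual_apply, coeffDual_apply]
    exact hle τ
  · rintro _ ⟨τ, rfl⟩ hτ
    rw [coeffDual_apply, coeffDual_apply] at hτ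
    obtain ⟨h1, h2, h3, h4⟩ := face τ hτ
    obtain ⟨h1', h2', -, -⟩ := face σ' heq
    have hlt : v σ (σ l) < v σ' (σ l) := by
      refine lt_of_le_of_ne (h3.trans h4) fun hc => hne (funext fun x => ?_)
      by_cases hxk : x = σ k
      · rw [hxk]
        linarith
      by_cases hxl : x = σ l
      · rw [hxl, hc]
      · exact (h1' x hxk hxl).symm
    have hpos : 0 < v σ' (σ l) - v σ (σ l) := sub_pos.2 hlt
    rw [convexHull_pair, segment_eq_image_lineMap]
    refine ⟨(v τ (σ l) - v σ (σ l)) / (v σ' (σ l) - v σ (σ l)),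
      ⟨div_nonneg (sub_nonneg.2 h3) hpos.le, (div_le_one hpos).2 (by linarith)⟩, ?_⟩
    funext x
    rw [AffineMap.lineMap_apply]
    simp only [vsub_eq_sub, vadd_eq_add, Pi.add_apply, Pi.smul_apply, Pi.sub_apply, smul_eq_mul]
    by_cases hxk : x = σ k
    · subst hxk
      have : v σ' (σ k) - v σ (σ k) = - (v σ' (σ l) - v σ (σ l)) := by linarith
      rw [this, mul_neg, div_mul_cancel₀ _ hpos.ne']
      linarith
    by_cases hxl : x = σ l
    · subst hxl
      rw [div_mul_cancel₀ _ hpos.ne']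
      ring
    · rw [h1 x hxk hxl, h1' x hxk hxl]
      ring

/-! ### Greedy SP -/

/-- Reversing a covered arrow of the DAG of an ordering gives a DAG that contains the DAGs of
its orderings. -/
theorem IsGraphoid.minIMap_mul_swap_le (hC : IsGraphoid C) {σ : Equiv.Perm (Fin p)}
    {k l : Fin p} (hkl : (k : ℕ) + 1 = l)
    (hcov : (minIMap C σ).pa (σ l) = insert (σ k) ((minIMap C σ).pa (σ k))) {H : DAG p}
    (hH : (minIMap C σ).IsArrowReversal H (σ k) (σ l)) (x y : Fin p)
    (hxy : (minIMap C (σ * Equiv.swap k l)).Arrow x y) : H.Arrow x y := by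
  set D := minIMap C σ with hD
  have hij : σ k ≠ σ l := hH.1.ne
  rw [hH.2]
  by_contra hc
  push Not at hc
  have hnot : x ∈ before σ (σ k) → (y = σ k ∨ y = σ l) → False := by
    intro hx hy
    set K := before σ (σ k) with hK
    have hkK : σ k ∉ K := by simp [hK, mem_before]
    have hlK : σ l ∉ K := by
      simp only [hK, mem_before, Equiv.symm_apply_apply, Fin.lt_def]
      omega
    have hxk : x ≠ σ k := fun h => hkK (h ▸ hx)
    have hxl : x ≠ σ l := fun h => hlK (h ▸ hx)
    have h1 : ¬ D.Arrow x y := fun h => hxk (hc.1 h).1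
    have hpa : D.Arrow x (σ l) ↔ D.Arrow x (σ k) := by
      unfold DAG.Arrow
      rw [hcov, Finset.mem_insert]
      simp [hxk]
    have h2 : ¬ D.Arrow x (σ k) := by
      rcases hy with rfl | rfl
      · exact h1
      · rwa [← hpa]
    have h3 : ¬ D.Arrow x (σ l) := by rwa [hpa]
    have h4 : C x (σ k) (K.erase x) := by
      by_contra h
      exact h2 (minIMap_arrow.2 ⟨hx, h⟩)
    have h5 : C x (σ l) (insert (σ k) (K.erase x)) := by
      by_contra h
      refine h3 (minIMap_arrow.2 ?_)
      rw [before_succ hkl, Finset.erase_insert_of_ne hxk.symm]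
      exact ⟨Finset.mem_insert_of_mem hx, h⟩
    have h6 := hC.exchange x (σ k) (σ l) (K.erase x) hxk hxl hij (by simp) (by simp [hkK])
      (by simp [hlK]) h4 h5
    have h7 := (minIMap_arrow.1 hxy).2
    rcases hy with rfl | rfl
    · rw [before_mul_swap_right hkl, Finset.erase_insert_of_ne hxl.symm] at h7
      exact h7 h6.2
    · rw [before_mul_swap_left hkl] at h7
      exact h7 h6.1
  obtain ⟨hx, hx'⟩ := minIMap_arrow.1 hxy
  by_cases hyk : y = σ k
  · rw [hyk, before_mul_swap_right hkl, Finset.mem_insert] at hx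
    rcases hx with rfl | hx
    · exact hc.2 rfl hyk
    · exact hnot hx (Or.inl hyk)
  by_cases hyl : y = σ l
  · rw [hyl, before_mul_swap_left hkl] at hx
    exact hnot hx (Or.inr hyl)
  · rw [before_mul_swap_of_ne hkl hyk hyl] at hx hx'
    exact hyl (hc.1 (minIMap_arrow.2 ⟨hx, hx'⟩)).2

/-- A move of greedy SP follows an edge of the DAG associahedron. -/
theorem GreedySPMove.isPolytopeEdge (hC : IsGraphoid C) (hQ : IsDAGAssociahedron C Q v)
    {π : Equiv.Perm (Fin p)} {E : DAG p} (h : GreedySPMove C (minIMap C π) E) :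
    ∃ τ, E = minIMap C τ ∧ IsPolytopeEdge Q (convexHull ℝ {v π, v τ}) := by
  obtain ⟨i, j, hij, hcov, H, hH, τ, hτ, rfl⟩ := h
  refine ⟨τ, rfl, ?_⟩
  obtain ⟨σ, k, l, hσ, hkl, rfl, rfl⟩ :=
    exists_isLinearExtension_adjacent (isLinearExtension_minIMap C π) hij hcov
  obtain ⟨h1, h2⟩ := hC.eq_of_isLinearExtension hQ (isLinearExtension_minIMap C π)
    (fun _ _ h => h) hσ
  rw [← h1] at hij hcov hH hσ
  rw [← h2]
  have hlin : IsLinearExtension H (σ * Equiv.swap k l) := by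
    intro a b hab
    rw [mul_swap_symm_apply, mul_swap_symm_apply]
    rcases (hH.2 a b).1 hab with ⟨hab, hne⟩ | ⟨rfl, rfl⟩
    · rw [swap_lt_swap_iff hkl]
      · exact hσ a b hab
      · rintro ⟨h3, h4⟩
        exact hne ⟨by rw [← h3, Equiv.apply_symm_apply], by rw [← h4, Equiv.apply_symm_apply]⟩
      · rintro ⟨h3, h4⟩
        have := hσ a b hab
        rw [h3, h4, Fin.lt_def] at this
        omega
    · rw [Equiv.symm_apply_apply, Equiv.symm_apply_apply, Equiv.swap_apply_right,
        Equiv.swap_apply_left, Fin.lt_def]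
      omega
  obtain ⟨-, h4⟩ := hC.eq_of_isLinearExtension hQ hlin
    (fun x y => hC.minIMap_mul_swap_le hkl hcov hH x y) hτ
  rw [h4]
  refine hQ.isPolytopeEdge hkl fun he => ?_
  have := (hQ.wall σ k l hkl).1 he.symm
  rw [minIMap_arrow, before_succ hkl, Finset.erase_insert (by simp [mem_before])] at hij
  exact hij.2 this

theorem exists_greedySPFrom (C : Fin p → Fin p → Finset (Fin p) → Prop) (d : ℕ∞) (D : DAG p) :
    ∃ l, GreedySPFrom C d D l := by
  induction hn : D.numArrows using Nat.strong_induction_on generalizing D with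
  | _ n ih =>
    by_cases h : ∃ t E, IsGreedySPSearch C d D t E
    · obtain ⟨t, E, h⟩ := h
      obtain ⟨r, hr⟩ := ih _ (hn ▸ h.2.2.2.1) E rfl
      exact ⟨_, GreedySPFrom.search D t E r h hr⟩
    · push Not at h
      exact ⟨_, GreedySPFrom.finish D h⟩

theorem GreedySPFrom.isChain {d : ℕ∞} {D : DAG p} {l : List (DAG p)}
    (h : GreedySPFrom C d D l) : (∃ r, l = D :: r) ∧ l.IsChain (GreedySPMove C) ∧
      l.IsChain (fun D E => E.numArrows ≤ D.numArrows) ∧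
      ∀ E, l.getLast? = some E → E = D ∨ E.numArrows < D.numArrows := by
  induction h with
  | finish D h => simp
  | search D t E r h hr ih =>
    obtain ⟨⟨r, rfl⟩, h1, h2, h3⟩ := ih
    obtain ⟨h4, -, h5, h6, -⟩ := h
    refine ⟨⟨t ++ E :: r, rfl⟩, List.isChain_split.2 ⟨h4, h1⟩, List.isChain_split.2 ⟨?_, h2⟩, ?_⟩
    · have h7 : ∀ F ∈ D :: t, F.numArrows = D.numArrows := List.forall_mem_cons.2 ⟨rfl, h5⟩
      refine List.Pairwise.isChain (List.pairwise_append.2 ⟨?_, by simp, ?_⟩)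
      · exact List.pairwise_of_forall_mem_list fun a ha b hb => ((h7 b hb).trans (h7 a ha).symm).le
      · intro a ha b hb
        rw [List.mem_singleton.1 hb, h7 a ha]
        exact h6.le
    · intro F hF
      rw [List.getLast?_append_of_ne_nil _ (by simp)] at hF
      rcases h3 F hF with rfl | h
      · exact Or.inr h6
      · exact Or.inr (h.trans h6)

/-- Greedy SP is an edge-walk on a DAG associahedron. -/
theorem greedySP_search (hC : IsGraphoid C) (hQ : IsDAGAssociahedron C Q v) :
    ∃ u : DAG p → (Fin p → ℝ),
      (∀ π, u (minIMap C π) = v π) ∧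
      ∀ (d : ℕ∞) (π : Equiv.Perm (Fin p)),
        (∃ l, GreedySPFrom C d (minIMap C π) l) ∧
        ∀ l, GreedySPFrom C d (minIMap C π) l →
          IsEdgeWalk Q (l.map u) ∧
          l.IsChain (fun D E => E.numArrows ≤ D.numArrows) ∧
          ∀ E, l.getLast? = some E → E = minIMap C π ∨
            E.numArrows < (minIMap C π).numArrows := by
  classical
  let u : DAG p → (Fin p → ℝ) := fun D =>
    if h : ∃ π, D = minIMap C π then v h.choose else 0
  have hu : ∀ π, u (minIMap C π) = v π := by
    intro π
    have h : ∃ τ, minIMap C π = minIMap C τ := ⟨π, rfl⟩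
    simp only [u, dif_pos h]
    refine (hC.eq_of_isLinearExtension hQ (isLinearExtension_minIMap C π) (fun _ _ h => h) ?_).2
    have := isLinearExtension_minIMap C h.choose
    rwa [← h.choose_spec] at this
  refine ⟨u, hu, fun d π => ⟨exists_greedySPFrom C d _, fun l hl => ?_⟩⟩
  obtain ⟨⟨r, rfl⟩, h1, h2, h3⟩ := hl.isChain
  obtain ⟨h4, h5⟩ := isChain_with_invariant (P := fun D => ∃ π, D = minIMap C π) h1 ⟨π, rfl⟩ (by
    rintro _ E ⟨τ, rfl⟩ h
    obtain ⟨ρ, hρ, -⟩ := h.isPolytopeEdge hC hQ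
    exact ⟨ρ, hρ⟩)
  refine ⟨⟨by simp, ?_, ?_⟩, h2, h3⟩
  · intro x hx
    obtain ⟨D, hD, rfl⟩ := List.mem_map.1 hx
    obtain ⟨τ, rfl⟩ := h4 D hD
    rw [hu]
    exact hQ.mem_exposedPoints τ
  · rw [List.isChain_map]
    refine h5.imp ?_
    rintro _ E ⟨⟨τ, rfl⟩, h⟩
    obtain ⟨ρ, rfl, hρ⟩ := h.isPolytopeEdge hC hQ
    rw [hu, hu]
    exact hρ

end Graphoid

/-! ### The d-separation graphoid -/

namespace DAG

variable {p : ℕ}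

theorem isGraphoid_dSep (G : DAG p) : IsGraphoid G.DSep where
  symm i j K _ _ _ h := by
    rw [dSep_iff] at *
    exact fun h' => h h'.symm
  exchange i j k L _ _ _ _ _ _ h1 h2 := by
    rw [dSep_iff] at *
    have h3 : ¬ G.Conn L i k := fun h => (h.insert_or j).elim h2 h1
    rw [dSep_iff]
    exact ⟨h3, fun h => h.of_insert.elim h1 h3⟩
  intersection i j k L _ _ hjk _ _ _ h1 h2 := by
    rw [dSep_iff] at *
    rw [dSep_iff]
    exact ⟨fun h => (h.insert_or_insert hjk.symm).elim h1 h2,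
      fun h => (h.insert_or_insert hjk).elim h2 h1⟩

/-! ### A submodular function for d-separation -/

/-- The conditional mutual information of `i` and `j` given `K` for the "entropy" `g`. -/
def condInfo (g : Finset (Fin p) → ℝ) (i j : Fin p) (K : Finset (Fin p)) : ℝ :=
  g (insert i K) + g (insert j K) - g (insert i (insert j K)) - g K

theorem condInfo_comm (g : Finset (Fin p) → ℝ) (i j : Fin p) (K : Finset (Fin p)) :
    condInfo g i j K = condInfo g j i K := by
  unfold condInfo
  rw [Finset.insert_comm]
  ring

/-- On the subsets of `A`, the function `g` is strictly increasing and submodular, and the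
submodular inequality of `i`, `j` given `K` is tight exactly if `K` d-separates `i` and `j`. -/
structure IsFaithfulOn (G : DAG p) (A : Finset (Fin p)) (g : Finset (Fin p) → ℝ) : Prop where
  lt : ∀ i ∈ A, ∀ K ⊆ A, i ∉ K → g K < g (insert i K)
  nonneg : ∀ i ∈ A, ∀ j ∈ A, ∀ K ⊆ A, i ≠ j → i ∉ K → j ∉ K → 0 ≤ condInfo g i j K
  eq_zero_iff : ∀ i ∈ A, ∀ j ∈ A, ∀ K ⊆ A, i ≠ j → i ∉ K → j ∉ K →
    (condInfo g i j K = 0 ↔ G.DSep i j K)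

variable {G : DAG p} {A : Finset (Fin p)} {g : Finset (Fin p) → ℝ}

/-- The information of `i` about a set `F` vanishes exactly if `i` is separated from each
element of `F`: by the chain rule, as d-separation satisfies composition and contraction. -/
theorem IsFaithfulOn.condInfo_set (hg : G.IsFaithfulOn A g) {F : Finset (Fin p)} (hF : F ⊆ A)
    {i : Fin p} (hi : i ∈ A) {K : Finset (Fin p)} (hK : K ⊆ A) (hiK : i ∉ K) :
    0 ≤ g (insert i K) + g (K ∪ F) - g (insert i (K ∪ F)) - g K ∧
      (g (insert i K) + g (K ∪ F) - g (insert i (K ∪ F)) - g K = 0 ↔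
        ∀ u ∈ F, u ∉ K → G.DSep i u K) := by
  by_cases hiF : i ∈ F
  · have h1 := hg.lt i hi K hK hiK
    rw [Finset.insert_eq_of_mem (Finset.mem_union_right K hiF)]
    refine ⟨by linarith, fun h => by linarith, fun h => ?_⟩
    exact (not_dSep_iff.2 (Conn.refl i) (h i hiF hiK)).elim
  induction hn : (F \ K).card using Nat.strong_induction_on generalizing K with
  | _ n ih =>
    by_cases hFK : F ⊆ K
    · rw [Finset.union_eq_left.2 hFK]
      exact ⟨by linarith, fun _ u hu hu' => (hu' (hFK hu)).elim, fun _ => by ring⟩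
    obtain ⟨u, hu, huK⟩ := Finset.not_subset.1 hFK
    have hiu : i ≠ u := fun h => hiF (h ▸ hu)
    have hlt : (F \ insert u K).card < n := by
      rw [← hn]
      refine Finset.card_lt_card ⟨fun x hx => ?_, fun h => ?_⟩
      · simp only [Finset.mem_sdiff, Finset.mem_insert, not_or] at hx ⊢
        exact ⟨hx.1, hx.2.2⟩
      · have := h (Finset.mem_sdiff.2 ⟨hu, huK⟩)
        simp at this
    obtain ⟨h1, h2⟩ := ih _ hlt (Finset.insert_subset (hF hu) hK) (by simp [hiu, hiK]) rfl
    have h3 := hg.nonneg i hi u (hF hu) K hK hiu hiK huK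
    have h4 := hg.eq_zero_iff i hi u (hF hu) K hK hiu hiK huK
    have hun : insert u K ∪ F = K ∪ F := by
      rw [Finset.insert_union, Finset.insert_eq_of_mem (Finset.mem_union_right K hu)]
    rw [hun] at h1 h2
    have hsum : g (insert i K) + g (K ∪ F) - g (insert i (K ∪ F)) - g K =
        condInfo g i u K + (g (insert i (insert u K)) + g (K ∪ F) - g (insert i (K ∪ F)) -
          g (insert u K)) := by
      unfold condInfo
      ring
    rw [hsum]
    refine ⟨add_nonneg h3 h1, ?_⟩
    rw [add_eq_zero_iff_of_nonneg h3 h1, h4, h2]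
    constructor
    · rintro ⟨h5, h6⟩ x hx hxK
      by_cases hxu : x = u
      · rwa [hxu]
      have h7 := h6 x hx (by simp [hxu, hxK])
      rw [dSep_iff] at *
      exact fun h => (h.insert_or u).elim h7 h5
    · intro h
      refine ⟨h u hu huK, fun x hx hxK => ?_⟩
      have h5 := h u hu huK
      have h6 := h x hx fun h => hxK (Finset.mem_insert_of_mem h)
      rw [dSep_iff] at *
      exact fun h => h.of_insert.elim h6 h5

/-- The exponential of minus the information that the parents of `v` add to `S`. -/
noncomputable def parentExp (G : DAG p) (v : Fin p) (g : Finset (Fin p) → ℝ)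
    (S : Finset (Fin p)) : ℝ :=
  Real.exp (-(g (S ∪ G.pa v) - g S))

/-- The extension of `g` to a new node `v`: the amount that `v` adds to a set `S` depends on the
information of the parents of `v` given `S`, through a strictly concave function. -/
noncomputable def extend (G : DAG p) (v : Fin p) (g : Finset (Fin p) → ℝ) (ε : ℝ)
    (S : Finset (Fin p)) : ℝ :=
  if v ∈ S then g (S.erase v) + 1 - ε * G.parentExp v g (S.erase v) else g S

theorem extend_of_notMem {v : Fin p} {ε : ℝ} {S : Finset (Fin p)} (hv : v ∉ S) :
    G.extend v g ε S = g S := if_neg hv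

theorem extend_insert {v : Fin p} {ε : ℝ} {S : Finset (Fin p)} (hv : v ∉ S) :
    G.extend v g ε (insert v S) = g S + 1 - ε * G.parentExp v g S := by
  rw [extend, if_pos (Finset.mem_insert_self v S), Finset.erase_insert hv]

/-- The set `A` contains the parents of its elements. -/
def IsAncestral (G : DAG p) (A : Finset (Fin p)) : Prop := ∀ b ∈ A, G.pa b ⊆ A

theorem IsAncestral.not_reflTransGen (hA : G.IsAncestral A) {v : Fin p} (hv : v ∉ A) {d : Fin p}
    (hd : d ∈ A) : ¬ Relation.ReflTransGen G.Arrow v d := by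
  intro h
  induction h with
  | refl => exact hv hd
  | tail _ h ih => exact ih (hA _ hd h)

section Extend

variable {v : Fin p} (hA : G.IsAncestral A) (hv : v ∉ A) (hpa : G.pa v ⊆ A)
  (hg : G.IsFaithfulOn A g)

include hA hv hpa hg

theorem parentExp_le_insert {i : Fin p} (hi : i ∈ A) {K : Finset (Fin p)} (hK : K ⊆ A)
    (hiK : i ∉ K) : G.parentExp v g K ≤ G.parentExp v g (insert i K) ∧
      (G.parentExp v g K = G.parentExp v g (insert i K) ↔ G.DSep i v K) := by
  obtain ⟨h1, h2⟩ := hg.condInfo_set hpa hi hK hiK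
  unfold parentExp
  rw [Finset.insert_union, Real.exp_le_exp, Real.exp_eq_exp]
  refine ⟨by linarith, ?_⟩
  have h3 : G.DSep i v K ↔ ∀ u ∈ G.pa v, u ∉ K → G.DSep i u K := by
    rw [dSep_iff, conn_iff_exists_parent hiK]
    · push Not
      simp only [dSep_iff]
    · exact fun d hd => hA.not_reflTransGen hv (Finset.insert_subset hi hK hd)
  rw [h3, ← h2]
  constructor <;> intro h <;> linarith

/-- The strict concavity of `-exp (-x)` at work: among nodes separated by `K`, the second
difference of `parentExp` vanishes only if one of the first differences does. -/
theorem parentExp_second_difference {i j : Fin p} (hi : i ∈ A) (hj : j ∈ A)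
    {K : Finset (Fin p)} (hK : K ⊆ A) (hij : i ≠ j) (hiK : i ∉ K) (hjK : j ∉ K)
    (hsep : G.DSep i j K) :
    0 ≤ G.parentExp v g K + G.parentExp v g (insert i (insert j K)) -
        G.parentExp v g (insert i K) - G.parentExp v g (insert j K) ∧
      (G.parentExp v g K + G.parentExp v g (insert i (insert j K)) -
        G.parentExp v g (insert i K) - G.parentExp v g (insert j K) = 0 ↔
        G.DSep i v K ∨ G.DSep j v K) := by
  obtain ⟨h1, h1'⟩ := parentExp_le_insert hA hv hpa hg hi hK hiK
  obtain ⟨h2, h2'⟩ := parentExp_le_insert hA hv hpa hg hj hK hjK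
  obtain ⟨h3, h3'⟩ := parentExp_le_insert hA hv hpa hg hi (Finset.insert_subset hj hK)
    (by simp [hij, hiK])
  obtain ⟨h4, h4'⟩ := parentExp_le_insert hA hv hpa hg hj (Finset.insert_subset hi hK)
    (by simp [hij.symm, hjK])
  rw [Finset.insert_comm] at h4 h4'
  have h0 : 0 < G.parentExp v g K := Real.exp_pos _
  have hprod : G.parentExp v g (insert i K) * G.parentExp v g (insert j K) ≤
      G.parentExp v g K * G.parentExp v g (insert i (insert j K)) := by
    unfold parentExp
    rw [← Real.exp_add, ← Real.exp_add, Real.exp_le_exp]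
    simp only [Finset.insert_union]
    have hcond := (hg.eq_zero_iff i hi j hj K hK hij hiK hjK).2 hsep
    have hnn : 0 ≤ condInfo g i j (K ∪ G.pa v) := by
      by_cases hiF : i ∈ K ∪ G.pa v
      · unfold condInfo
        rw [Finset.insert_eq_of_mem hiF,
          Finset.insert_eq_of_mem (Finset.mem_insert_of_mem hiF)]
        linarith
      by_cases hjF : j ∈ K ∪ G.pa v
      · unfold condInfo
        rw [Finset.insert_eq_of_mem hjF]
        linarith
      exact hg.nonneg i hi j hj _ (Finset.union_subset hK hpa) hij hiF hjF
    unfold condInfo at hcond hnn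
    linarith
  generalize G.parentExp v g K = a at *
  generalize G.parentExp v g (insert i K) = b at *
  generalize G.parentExp v g (insert j K) = c at *
  generalize G.parentExp v g (insert i (insert j K)) = d at *
  have hmul : (b - a) * (c - a) ≤ a * (a + d - b - c) := by nlinarith
  have hbc : 0 ≤ (b - a) * (c - a) := mul_nonneg (sub_nonneg.2 h1) (sub_nonneg.2 h2)
  refine ⟨nonneg_of_mul_nonneg_right (hbc.trans hmul) h0, fun h => ?_, fun h => ?_⟩
  · rw [h, mul_zero] at hmul
    rcases mul_eq_zero.1 (le_antisymm hmul hbc) with h | h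
    · exact Or.inl (h1'.1 (by linarith))
    · exact Or.inr (h2'.1 (by linarith))
  · rcases h with h | h
    · have e1 := h1'.2 h
      have e2 : c = d := h3'.2 (by
        rw [dSep_iff] at *
        exact fun h' => h'.of_insert.elim h hsep)
      linarith
    · have e1 := h2'.2 h
      have e2 : b = d := h4'.2 (by
        rw [dSep_iff] at *
        exact fun h' => h'.of_insert.elim h fun h' => hsep h'.symm)
      linarith

theorem exists_isFaithfulOn_insert : ∃ f, G.IsFaithfulOn (insert v A) f := by
  have ev : ∀ a b : ℝ, ∀ᶠ ε in nhdsWithin (0 : ℝ) (Set.Ioi 0), 0 < a → 0 < a + ε * b := by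
    intro a b
    by_cases ha : 0 < a
    · have hc : Filter.Tendsto (fun ε : ℝ => a + ε * b) (nhds 0) (nhds (a + 0 * b)) :=
        (continuous_const.add (continuous_id.mul continuous_const)).tendsto 0
      rw [zero_mul, add_zero] at hc
      filter_upwards [nhdsWithin_le_nhds (hc.eventually (lt_mem_nhds ha))] with ε h _ using h
    · exact Filter.Eventually.of_forall fun ε h => (ha h).elim
  set e := G.parentExp v g with he
  have ev1 : ∀ᶠ ε in nhdsWithin (0 : ℝ) (Set.Ioi 0), ∀ K, 0 < 1 + ε * (-e K) := by
    refine Filter.eventually_all.2 fun K => ?_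
    filter_upwards [ev 1 (-e K)] with ε h using h one_pos
  have ev2 : ∀ᶠ ε in nhdsWithin (0 : ℝ) (Set.Ioi 0), ∀ (i : Fin p) (K : Finset (Fin p)),
      0 < g (insert i K) - g K → 0 < g (insert i K) - g K + ε * (e K - e (insert i K)) :=
    Filter.eventually_all.2 fun i => Filter.eventually_all.2 fun K => ev _ _
  have ev3 : ∀ᶠ ε in nhdsWithin (0 : ℝ) (Set.Ioi 0), ∀ (i j : Fin p) (K : Finset (Fin p)),
      0 < condInfo g i j K → 0 < condInfo g i j K +
        ε * (e K + e (insert i (insert j K)) - e (insert i K) - e (insert j K)) :=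
    Filter.eventually_all.2 fun i => Filter.eventually_all.2 fun j =>
      Filter.eventually_all.2 fun K => ev _ _
  obtain ⟨ε, h1, h2, h3, hε⟩ := (ev1.and (ev2.and (ev3.and self_mem_nhdsWithin))).exists
  replace hε : 0 < ε := hε
  set f := G.extend v g ε with hf
  have fn : ∀ S, v ∉ S → f S = g S := fun S hS => extend_of_notMem hS
  have fi : ∀ S, v ∉ S → f (insert v S) = g S + 1 - ε * e S := fun S hS => extend_insert hS
  have notMem : ∀ {K}, K ⊆ A → v ∉ K := fun hK h => hv (hK h)
  have split : ∀ K ⊆ insert v A, K ⊆ A ∨ ∃ K', K' ⊆ A ∧ K = insert v K' := by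
    intro K hK
    by_cases hvK : v ∈ K
    · refine Or.inr ⟨K.erase v, fun x hx => ?_, (Finset.insert_erase hvK).symm⟩
      exact (Finset.mem_insert.1 (hK (Finset.mem_of_mem_erase hx))).resolve_left
        (Finset.ne_of_mem_erase hx)
    · exact Or.inl ((Finset.subset_insert_iff_of_notMem hvK).1 hK)
  have new : ∀ i ∈ A, ∀ K ⊆ A, i ∉ K → 0 ≤ condInfo f i v K ∧
      (condInfo f i v K = 0 ↔ G.DSep i v K) := by
    intro i hi K hK hiK
    obtain ⟨h4, h5⟩ := parentExp_le_insert hA hv hpa hg hi hK hiK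
    have hiA := Finset.insert_subset hi hK
    have : condInfo f i v K = ε * (e (insert i K) - e K) := by
      unfold condInfo
      rw [Finset.insert_comm, fn _ (notMem hiA), fi _ (notMem hK), fi _ (notMem hiA),
        fn _ (notMem hK)]
      ring
    rw [this, mul_eq_zero, or_iff_right hε.ne', sub_eq_zero, ← h5]
    exact ⟨mul_nonneg hε.le (sub_nonneg.2 h4), eq_comm⟩
  have main : ∀ i ∈ insert v A, ∀ j ∈ insert v A, ∀ K ⊆ insert v A, i ≠ j → i ∉ K → j ∉ K →
      0 ≤ condInfo f i j K ∧ (condInfo f i j K = 0 ↔ G.DSep i j K) := by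
    intro i hi' j hj' K hK' hij hiK' hjK'
    rcases Finset.mem_insert.1 hj' with rfl | hj
    · exact new i ((Finset.mem_insert.1 hi').resolve_left hij) K
        ((Finset.subset_insert_iff_of_notMem hjK').1 hK') hiK'
    rcases Finset.mem_insert.1 hi' with rfl | hi
    · have := new j hj K ((Finset.subset_insert_iff_of_notMem hiK').1 hK') hjK'
      rw [condInfo_comm] at this
      refine ⟨this.1, this.2.trans ?_⟩
      rw [dSep_iff, dSep_iff]
      exact not_congr ⟨Conn.symm, Conn.symm⟩
    rcases split K hK' with hK | ⟨K, hK, rfl⟩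
    · have : condInfo f i j K = condInfo g i j K := by
        unfold condInfo
        rw [fn _ (notMem (Finset.insert_subset hi hK)), fn _ (notMem (Finset.insert_subset hj hK)),
          fn _ (notMem (Finset.insert_subset hi (Finset.insert_subset hj hK))),
          fn _ (notMem hK)]
      rw [this]
      exact ⟨hg.nonneg i hi j hj K hK hij hiK' hjK', hg.eq_zero_iff i hi j hj K hK hij hiK' hjK'⟩
    have hiK : i ∉ K := fun h => hiK' (Finset.mem_insert_of_mem h)
    have hjK : j ∉ K := fun h => hjK' (Finset.mem_insert_of_mem h)
    have hjA := Finset.insert_subset hj hK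
    have : condInfo f i j (insert v K) = condInfo g i j K +
        ε * (e K + e (insert i (insert j K)) - e (insert i K) - e (insert j K)) := by
      unfold condInfo
      rw [Finset.insert_comm j v, Finset.insert_comm i v, Finset.insert_comm i v,
        fi _ (notMem (Finset.insert_subset hi hK)), fi _ (notMem hjA),
        fi _ (notMem (Finset.insert_subset hi hjA)), fi _ (notMem hK)]
      ring
    rw [this]
    have hsep : G.DSep i j (insert v K) ↔ G.DSep i j K ∧ (G.DSep i v K ∨ G.DSep j v K) := by
      simp only [dSep_iff]
      rw [conn_insert_iff hiK hjK]
      · tauto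
      · exact fun d hd => hA.not_reflTransGen hv (Finset.insert_subset hi hjA hd)
    rw [hsep]
    have h4 := hg.nonneg i hi j hj K hK hij hiK hjK
    have h5 := hg.eq_zero_iff i hi j hj K hK hij hiK hjK
    rcases h4.eq_or_lt with h4 | h4
    · have hs := h5.1 h4.symm
      obtain ⟨h6, h7⟩ := parentExp_second_difference hA hv hpa hg hi hj hK hij hiK hjK hs
      rw [← h4, zero_add, mul_eq_zero, or_iff_right hε.ne', h7]
      exact ⟨mul_nonneg hε.le h6, ⟨fun h => ⟨hs, h⟩, fun h => h.2⟩⟩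
    · have h6 := h3 i j K h4
      exact ⟨h6.le, fun h => (h6.ne' h).elim, fun h => (h4.ne' (h5.2 h.1)).elim⟩
  refine ⟨f, ?_, fun i hi j hj K hK h4 h5 h6 => (main i hi j hj K hK h4 h5 h6).1,
    fun i hi j hj K hK h4 h5 h6 => (main i hi j hj K hK h4 h5 h6).2⟩
  intro i hi' K hK' hiK'
  rcases Finset.mem_insert.1 hi' with rfl | hi
  · rw [fi _ hiK', fn _ hiK']
    have := h1 K
    linarith
  rcases split K hK' with hK | ⟨K, hK, rfl⟩
  · rw [fn _ (notMem hK), fn _ (notMem (Finset.insert_subset hi hK))]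
    exact hg.lt i hi K hK hiK'
  · have hiK : i ∉ K := fun h => hiK' (Finset.mem_insert_of_mem h)
    rw [Finset.insert_comm, fi _ (notMem hK), fi _ (notMem (Finset.insert_subset hi hK))]
    have := h2 i K (sub_pos.2 (hg.lt i hi K hK hiK))
    linarith

end Extend

theorem exists_no_ancestor (G : DAG p) {S : Finset (Fin p)} (hS : S.Nonempty) :
    ∃ i ∈ S, ∀ j ∈ S, ¬ G.Arrow j i := by
  let r : Fin p → Fin p → Prop := fun a b => Relation.TransGen G.Arrow a b
  have : IsTrans (Fin p) r := ⟨fun a b c h1 h2 => h1.trans h2⟩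
  have : Std.Irrefl r := ⟨fun a h => G.acyclic a h⟩
  obtain ⟨i, hi, h⟩ := (Finite.wellFounded_of_trans_of_irrefl r).has_min (S : Set (Fin p)) hS
  exact ⟨i, hi, fun j hj hij => h j hj (Relation.TransGen.single hij)⟩

theorem exists_isFaithfulOn_univ (G : DAG p) : ∃ g, G.IsFaithfulOn Finset.univ g := by
  obtain ⟨A, ⟨hA, g, hg⟩, hmax⟩ :=
    (Set.toFinite {A | G.IsAncestral A ∧ ∃ g, G.IsFaithfulOn A g}).exists_maximalFor id _
      ⟨∅, by simp [IsAncestral], 0, by constructor <;> simp⟩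
  by_cases hu : A = Finset.univ
  · exact ⟨g, hu ▸ hg⟩
  have hne : Aᶜ.Nonempty := by
    rw [Finset.nonempty_iff_ne_empty, Ne, Finset.compl_eq_empty_iff]
    exact hu
  obtain ⟨v, hv, hanc⟩ := G.exists_no_ancestor hne
  rw [Finset.mem_compl] at hv
  have hpa : G.pa v ⊆ A := fun a ha => by
    by_contra hc
    exact hanc a (Finset.mem_compl.2 hc) ha
  have hins : G.IsAncestral (insert v A) := by
    intro b hb
    rcases Finset.mem_insert.1 hb with rfl | hb
    · exact hpa.trans (Finset.subset_insert _ _)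
    · exact (hA b hb).trans (Finset.subset_insert _ _)
  have := hmax ⟨hins, exists_isFaithfulOn_insert hA hv hpa hg⟩ (Finset.subset_insert v A)
  exact (hv (this (Finset.mem_insert_self v A))).elim

/-! ### The DAG associahedron of d-separation -/

/-- The vertex, for the ordering `π`, of the base polytope of `g`. -/
def greedyVertex (g : Finset (Fin p) → ℝ) (π : Equiv.Perm (Fin p)) (b : Fin p) : ℝ :=
  g (insert b (before π b)) - g (before π b)

/-- An adjacent transposition moves the vertex by the conditional information. -/
theorem greedyVertex_mul_swap (g : Finset (Fin p) → ℝ) (τ : Equiv.Perm (Fin p)) {k l : Fin p}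
    (hkl : (k : ℕ) + 1 = l) :
    greedyVertex g (τ * Equiv.swap k l) = greedyVertex g τ +
      condInfo g (τ k) (τ l) (before τ (τ k)) •
        (Pi.single (τ l) (1 : ℝ) - Pi.single (τ k) (1 : ℝ)) := by
  have hne : τ k ≠ τ l := fun h => by
    have := congrArg Fin.val (τ.injective h)
    omega
  funext b
  simp only [Pi.add_apply, Pi.smul_apply, Pi.sub_apply, smul_eq_mul, greedyVertex]
  by_cases hbk : b = τ k
  · subst hbk
    rw [before_mul_swap_right hkl, Pi.single_eq_of_ne hne, Pi.single_eq_same, condInfo]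
    ring
  by_cases hbl : b = τ l
  · subst hbl
    rw [before_mul_swap_left hkl, before_succ hkl, Pi.single_eq_of_ne hne.symm,
      Pi.single_eq_same, condInfo, Finset.insert_comm]
    ring
  · rw [before_mul_swap_of_ne hkl hbk hbl, Pi.single_eq_of_ne hbl, Pi.single_eq_of_ne hbk]
    ring

theorem exists_isDAGAssociahedron (G : DAG p) : ∃ Q v, IsDAGAssociahedron G.DSep Q v := by
  obtain ⟨g, hg⟩ := G.exists_isFaithfulOn_univ
  refine ⟨_, greedyVertex g, rfl, ?_, ?_⟩
  · intro π w hw τ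
    have hnn : ∀ (τ : Equiv.Perm (Fin p)) (k l : Fin p), (k : ℕ) + 1 = l →
        0 ≤ condInfo g (τ k) (τ l) (before τ (τ k)) := by
      intro τ k l hkl
      refine hg.nonneg _ (Finset.mem_univ _) _ (Finset.mem_univ _) _ (Finset.subset_univ _)
        (fun h => ?_) (by simp [mem_before]) ?_
      · have := congrArg Fin.val (τ.injective h)
        omega
      · simp only [mem_before, Equiv.symm_apply_apply, Fin.lt_def]
        omega
    induction τ using bubble_sort_induction π with
    | hπ => exact fun h => (h rfl).elim
    | step τ k l hkl hlt ih =>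
      intro hne
      have hwlt : w (τ k) < w (τ l) := by simpa using hw hlt
      have hsum : ∑ i, w i * greedyVertex g (τ * Equiv.swap k l) i =
          ∑ i, w i * greedyVertex g τ i +
            condInfo g (τ k) (τ l) (before τ (τ k)) * (w (τ l) - w (τ k)) := by
        rw [greedyVertex_mul_swap g τ hkl]
        simp only [Pi.add_apply, Pi.smul_apply, Pi.sub_apply, smul_eq_mul, mul_add,
          Finset.sum_add_distrib, add_right_inj, mul_sub, Finset.sum_sub_distrib,
          Pi.single_apply, mul_ite, mul_one, mul_zero, Finset.sum_ite_eq', Finset.mem_univ, if_true]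
        ring
      rcases (hnn τ k l hkl).eq_or_lt with h0 | h0
      · have heq := greedyVertex_mul_swap g τ hkl
        rw [← h0, zero_smul, add_zero] at heq
        rw [heq] at ih
        exact ih hne
      · have h1 := mul_pos h0 (sub_pos.2 hwlt)
        by_cases he : greedyVertex g (τ * Equiv.swap k l) = greedyVertex g π
        · rw [he] at hsum
          linarith
        · have := ih he
          linarith
  · intro π k l hkl
    have hne : π k ≠ π l := fun h => by
      have := congrArg Fin.val (π.injective h)
      omega
    rw [← hg.eq_zero_iff _ (Finset.mem_univ _) _ (Finset.mem_univ _) _ (Finset.subset_univ _) hne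
      (by simp [mem_before])
      (by simp only [mem_before, Equiv.symm_apply_apply, Fin.lt_def]; omega),
      greedyVertex_mul_swap g π hkl, add_eq_left, smul_eq_zero, or_iff_left]
    intro h
    have := congrFun h (π l)
    simp [hne.symm] at this

end DAG

theorem mainTheorem12 (p : ℕ) :
    -- GES, GIES on observational data and MMHC, for every decomposable, score equivalent score
    (∀ s : DAG p → ℝ, IsDecomposable s → ∀ hs : IsScoreEquivalent s,
      ∃ (v : MEC p → ImsetSpace p) (w : ImsetSpace p →ₗ[ℝ] ℝ) (a : ℝ),
        (∀ G : DAG p, v ⟦G⟧ = charImset G) ∧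
        (∀ G : DAG p, s G = w (charImset G) + a) ∧
        ((∃ l, IsGESRun (mecScore s hs) l) ∧
          ∀ l, IsGESRun (mecScore s hs) l → IsGreedyEdgeWalk (CIM p) w (l.map v)) ∧
        ((∃ l, IsGIESRun (mecScore s hs) l) ∧
          ∀ l, IsGIESRun (mecScore s hs) l → IsGreedyEdgeWalk (CIM p) w (l.map v)) ∧
        ∀ K : SimpleGraph (Fin p),
          IsExposed ℝ (CIM p) (CIMBelow K) ∧
          (∃ l, IsMMHCRun s K l) ∧
          ∀ l, IsMMHCRun s K l → IsGreedyEdgeWalk (CIMBelow K) w (l.map charImset)) ∧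
    -- greedy SP, for every graphoid that has a DAG associahedron
    (∀ C : Fin p → Fin p → Finset (Fin p) → Prop, IsGraphoid C →
      ∀ (Q : Set (Fin p → ℝ)) (v : Equiv.Perm (Fin p) → (Fin p → ℝ)),
        IsDAGAssociahedron C Q v →
        ∃ u : DAG p → (Fin p → ℝ),
          (∀ π, u (minIMap C π) = v π) ∧
          ∀ (d : ℕ∞) (π : Equiv.Perm (Fin p)),
            (∃ l, GreedySPFrom C d (minIMap C π) l) ∧
            ∀ l, GreedySPFrom C d (minIMap C π) l →
              IsEdgeWalk Q (l.map u) ∧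
              l.IsChain (fun D E => E.numArrows ≤ D.numArrows) ∧
              ∀ E, l.getLast? = some E → E = minIMap C π ∨
                E.numArrows < (minIMap C π).numArrows) ∧
    -- the conditional independence relations of a DAG have a DAG associahedron
    (∀ G : DAG p, IsGraphoid G.DSep ∧ ∃ Q v, IsDAGAssociahedron G.DSep Q v) := by
  exact ⟨greedy_score_search, fun C hC Q v hQ => greedySP_search hC hQ,
    fun G => ⟨G.isGraphoid_dSep, G.exists_isDAGAssociahedron⟩⟩
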